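/- All operads are in the category of sets, have no units, and no stability condition is imposed. **Definitions.** A *cyclic operad* $P$ is a functor $S\mapsto P(S)$ from finite sets (including $\emptyset$) and bijections to sets, with compositions ${}_a\circ_b\colon P(S')\times P(S'')\to P(S'\sqcup S''\setminus\{a,b\})$ for $a\in S'$, $b\in S''$, that are equivariant, symmetric ($x\,{}_a\circ_b\,y=y\,{}_b\circ_a\,x$) and associative ($x\,{}_a\circ_b(y\,{}_c\circ_d\,z)=(x\,{}_a\circ_b\,y)\,{}_c\circ_d\,z$ for $b\neq c$ in the middle set). A *modular operad* has components $P(S;g)$, $g\in\mathbb N$, compositions as above that add the genera, and equivariant contractions $\xi_{ab}=\xi_{ba}\colon P(S;g)\to P(S\setminus\{a,b\};g+1)$, $a\ne b$, with $\xi_{ab}\xi_{cd}=\xi_{cd}\xi_{ab}$, $\xi_{ab}(x\,{}_c\circ_d\,y)=\xi_{cd}(x\,{}_a\circ_b\,y)$ (for $a,c$ in the first and $b,d$ in the second set) and $(\xi_{cd}x)\,{}_a\circ_b\,y=\xi_{cd}(x\,{}_a\circ_b\,y)$. A *multicyclically ordered set* ${\sf S}=C_1\cup\dots\cup C_b$ is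 a finite set with a decomposition into $b>0$ possibly empty totally cyclically ordered sets; an isomorphism is an order-preserving bijection together with a compatible bijection of the index sets. It is *cyclically ordered* if $b=1$. For $u\in C_i$, $v\in C_j$, $u\ne v$, the cut ${\sf S}\setminus\{u,v\}$ replaces $C_i=[A\,u]$ and $C_j=[v\,B]$ by the single cyclically ordered set $[A\,B]$ if $i\neq j$, and replaces $C_i=[u\,A\,v\,B]$ by the two cyclically ordered sets $[A]$, $[B]$ if $i=j$. The merging of ${\sf S}'$ and ${\sf S}''$ at $u\in{\sf S}'$, $v\in{\sf S}''$ is the cut of ${\sf S}'\sqcup{\sf S}''$ at $u,v$. A pair $({\sf S},g)$ is *geometric* if $\frac12(g-b+1)\in\mathbb N$. A *non-$\Sigma$ cyclic operad* is defined as a cyclic operad, with cyclically ordered finite sets as arities and merging as the arity of a composition. A *(geometric) non-$\Sigma$ modular operad* is defined as a modular operad, with multicyclically ordered finite sets as arities, mergings and cuts as the arities of compositions and contractions, and $P({\sf S};g)=\emptyset$ unless $({\sf S},g)$ is geometric. Let $\Box$ (resp. $\underline\Box$) be the forgetful functor from modular operads to cyclic operads, $P\mapsto\{P(S;0)\}$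 (resp. from non-$\Sigma$ modular operads to non-$\Sigma$ cyclic operads, $P\mapsto\{P(C;0)\}$, $C$ cyclically ordered). The modular envelope $\mathrm{Mod}$ (resp. $\underline{\mathrm{Mod}}$) is the left adjoint of $\Box$ (resp. $\underline\Box$). Let $*_C$, $*_M$, $\underline*_C$ be the cyclic, modular and non-$\Sigma$ cyclic operads with a one-point set in each arity, and $\underline*_M$ the non-$\Sigma$ modular operad with a one-point set at each geometric $({\sf S},g)$. **Theorem.** The operads $*_C$, $*_M$, $\underline*_C$, $\underline*_M$ are terminal in their categories, and $$\mathrm{Mod}(*_C)\cong *_M,\qquad \underline{\mathrm{Mod}}(\underline*_C)\cong\underline*_M .$$ That is, there is a universal morphism $*_C\to\Box(*_M)$ from $*_C$ to $\Box$ (each morphism $*_C\to\Box P$ factors through it via a unique morphism $*_M\to P$), so that every left adjoint of $\Box$ takes $*_C$ to an operad isomorphic to $*_M$; and likewise in the non-$\Sigma$ case. Equivalently, let $P$ be a modular operad and let $\varsigma(S)\in P(S;0)$, $S$ a finite set, be a family preserved by all bijections and satisfying $\varsigma(S')\,{}_u\circ_v\,\varsigma(S'')=\varsigma(S'\sqcup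 S''\setminus\{u,v\})$. Then there is exactly one family $\varpi(S;g)\in P(S;g)$, preserved by all bijections, with $\varpi(S;0)=\varsigma(S)$, $\varpi(S';g')\,{}_u\circ_v\,\varpi(S'';g'')=\varpi(S'\sqcup S''\setminus\{u,v\};g'+g'')$ and $\xi_{uv}\varpi(S;g)=\varpi(S\setminus\{u,v\};g+1)$. Similarly, in a non-$\Sigma$ modular operad each such family $\varsigma(C)\in P(C;0)$, $C$ cyclically ordered, extends to exactly one such family $\varpi({\sf S};g)\in P({\sf S};g)$ indexed by the geometric pairs $({\sf S},g)$. -/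

import Mathlib

open CategoryTheory

/-! ### Gluing circles, in terms of permutations -/

namespace GluePerm

open scoped Classical in
/-- The permutation `σ` followed by the transposition of `u` and `v`.  If `σ` describes the passage from
a point on a union of oriented circles to the next one, this is the passage after the circles have
been glued at `u` and `v`: on reaching `u` one continues from `v`, and vice versa. -/
noncomputable def glue {α : Type*} (σ : Equiv.Perm α) (u v : α) : Equiv.Perm α :=
  Equiv.swap u v * σ

open scoped Classical in
/-- Removal of the point `w` from its cycle: the predecessor of `w` is sent to the successor of `w`, and
`w` becomes a fixed point. -/
noncomputable def skip {α : Type*} (φ : Equiv.Perm α) (w : α) : Equiv.Perm α :=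
  Equiv.swap w (φ w) * φ

variable {α : Type*}

theorem skip_self (φ : Equiv.Perm α) (w : α) : skip φ w w = w := by
  simp [skip]

theorem skip_of_eq (φ : Equiv.Perm α) {w x : α} (h : φ x = w) : skip φ w x = φ w := by
  simp [skip, h]

theorem skip_of_ne (φ : Equiv.Perm α) {w x : α} (h : φ x ≠ w) (hx : x ≠ w) :
    skip φ w x = φ x := by
  classical
  simp only [skip, Equiv.Perm.mul_apply]
  exact Equiv.swap_apply_of_ne_of_ne h (fun e => hx (φ.injective e))

theorem sameCycle_of_step {f φ : Equiv.Perm α} (h : ∀ x, φ.SameCycle x (f x)) {x y : α}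
    (hxy : f.SameCycle x y) : φ.SameCycle x y := by
  have key : ∀ (n : ℕ) (x : α), φ.SameCycle x ((f ^ n) x) := by
    intro n
    induction n with
    | zero => intro x; exact Equiv.Perm.SameCycle.refl _ _
    | succ n ih =>
      intro x
      rw [pow_succ', Equiv.Perm.mul_apply]
      exact (ih x).trans (h _)
  obtain ⟨i, hi⟩ := hxy
  rcases Int.eq_nat_or_neg i with ⟨n, rfl | rfl⟩
  · rw [zpow_natCast] at hi
    rw [← hi]; exact key n x
  · have : (f ^ n) y = x := by
      rw [← hi, ← zpow_natCast, ← Equiv.Perm.mul_apply, ← zpow_add]; simp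
    rw [← this]; exact (key n y).symm

theorem sameCycle_skip [Finite α] (φ : Equiv.Perm α) (w : α) {x y : α} (hx : x ≠ w) (hy : y ≠ w) :
    (skip φ w).SameCycle x y ↔ φ.SameCycle x y := by
  constructor
  · refine sameCycle_of_step (fun z => ?_)
    by_cases hz : z = w
    · subst hz; rw [skip_self]
    by_cases h : φ z = w
    · rw [skip_of_eq φ h, ← h]
      simp only [Equiv.Perm.sameCycle_apply_right]
      exact Equiv.Perm.SameCycle.refl _ _
    · rw [skip_of_ne φ h hz]
      simp only [Equiv.Perm.sameCycle_apply_right]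
      exact Equiv.Perm.SameCycle.refl _ _
  · intro h
    obtain ⟨n, hn⟩ := h.exists_nat_pow_eq
    subst hn
    induction n using Nat.strong_induction_on with
    | _ n ih =>
      match n with
      | 0 => exact Equiv.Perm.SameCycle.refl _ _
      | 1 =>
        have hy' : φ x ≠ w := by simpa using hy
        have := skip_of_ne φ hy' hx
        simp only [pow_one]
        rw [← this]; simp only [Equiv.Perm.sameCycle_apply_right]
        exact Equiv.Perm.SameCycle.refl _ _
      | m + 2 =>
        have e1 : (φ ^ (m + 2)) x = φ ((φ ^ (m + 1)) x) := by
          rw [pow_succ', Equiv.Perm.mul_apply]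
        have e2 : (φ ^ (m + 1)) x = φ ((φ ^ m) x) := by
          rw [pow_succ', Equiv.Perm.mul_apply]
        rw [e1] at hy ⊢
        by_cases hz : (φ ^ (m + 1)) x = w
        · have hz' : (φ ^ m) x ≠ w := by
            intro h'
            rw [e2, h'] at hz
            exact hy (by rw [e2, h', hz, hz])
          have hm := ih m (by omega) hz' ⟨m, by simp⟩
          have : skip φ w ((φ ^ m) x) = φ w := skip_of_eq φ (by rw [← e2, hz])
          rw [hz, ← this]
          simpa only [Equiv.Perm.sameCycle_apply_right] using hm
        · have hm := ih (m + 1) (by omega) hz ⟨((m + 1 : ℕ) : ℤ), by rw [zpow_natCast]⟩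
          rw [← skip_of_ne φ hy hz]
          simpa only [Equiv.Perm.sameCycle_apply_right] using hm

theorem skip_skip_mem (φ : Equiv.Perm α) (u v x : α) :
    (skip (skip φ u) v x ≠ u ∧ skip (skip φ u) v x ≠ v) ↔ (x ≠ u ∧ x ≠ v) := by
  have hv : skip (skip φ u) v v = v := skip_self _ _
  have hu : skip (skip φ u) v u = u := by
    by_cases h : u = v
    · subst h; exact hv
    · have h1 : skip φ u u = u := skip_self _ _
      rw [skip_of_ne _ (by rw [h1]; exact h) h, h1]
  have key : ∀ w, skip (skip φ u) v w = w → (skip (skip φ u) v x ≠ w ↔ x ≠ w) := by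
    intro w hw
    conv_lhs => rw [← hw]
    simp only [ne_eq, EmbeddingLike.apply_eq_iff_eq]
  rw [key u hu, key v hv]

/-- The permutation of the complement of `{u, v}` obtained from `φ` by removing `u` and `v` from their
cycles. -/
noncomputable def firstReturn (φ : Equiv.Perm α) (u v : α) :
    Equiv.Perm {x : α // x ≠ u ∧ x ≠ v} :=
  (skip (skip φ u) v).subtypePerm (skip_skip_mem φ u v)

theorem sameCycle_firstReturn [Finite α] (φ : Equiv.Perm α) (u v : α)
    (x y : {x : α // x ≠ u ∧ x ≠ v}) :
    (firstReturn φ u v).SameCycle x y ↔ φ.SameCycle x.1 y.1 := by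
  rw [firstReturn, Equiv.Perm.sameCycle_subtypePerm, sameCycle_skip _ _ x.2.2 y.2.2,
    sameCycle_skip _ _ x.2.1 y.2.1]

theorem glue_apply_of_ne (σ : Equiv.Perm α) {u v x : α} (hu : σ x ≠ u) (hv : σ x ≠ v) :
    glue σ u v x = σ x := by
  classical
  simp only [glue, Equiv.Perm.mul_apply]
  exact Equiv.swap_apply_of_ne_of_ne hu hv

theorem glue_apply_left (σ : Equiv.Perm α) {u v x : α} (h : σ x = u) : glue σ u v x = v := by
  simp [glue, h]

theorem glue_apply_right (σ : Equiv.Perm α) {u v x : α} (h : σ x = v) : glue σ u v x = u := by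
  simp [glue, h]

theorem glue_glue (σ : Equiv.Perm α) (u v : α) : glue (glue σ u v) u v = σ := by
  ext x; simp [glue]

theorem glue_comm (σ : Equiv.Perm α) (u v : α) : glue σ u v = glue σ v u := by
  simp [glue, Equiv.swap_comm]

theorem sameCycle_glue_of_left [Finite α] {σ : Equiv.Perm α} {u v : α} (h : ¬ σ.SameCycle u v)
    {x : α} (hx : σ.SameCycle u x) : (glue σ u v).SameCycle u x := by
  obtain ⟨n, rfl⟩ := hx.exists_nat_pow_eq
  clear hx
  induction n with
  | zero => exact Equiv.Perm.SameCycle.refl _ _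
  | succ n ih =>
    have e : (σ ^ (n + 1)) u = σ ((σ ^ n) u) := by rw [pow_succ', Equiv.Perm.mul_apply]
    rw [e]
    have hv : σ ((σ ^ n) u) ≠ v := by
      rw [← e]; intro h'; exact h ⟨((n + 1 : ℕ) : ℤ), by rw [zpow_natCast, h']⟩
    by_cases hu : σ ((σ ^ n) u) = u
    · rw [hu]
    · rw [← glue_apply_of_ne σ hu hv]
      simpa only [Equiv.Perm.sameCycle_apply_right] using ih

theorem sameCycle_glue [Finite α] {σ : Equiv.Perm α} {u v : α} (h : ¬ σ.SameCycle u v) :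
    (glue σ u v).SameCycle u v := by
  have h1 : (glue σ u v).SameCycle u (σ.symm u) :=
    sameCycle_glue_of_left h (by simp [Equiv.Perm.SameCycle.refl])
  have h2 : glue σ u v (σ.symm u) = v := glue_apply_left σ (by simp)
  have h3 := (Equiv.Perm.sameCycle_apply_right (f := glue σ u v)).2 h1
  rwa [h2] at h3

theorem sameCycle_glue_of_right [Finite α] {σ : Equiv.Perm α} {u v : α} (h : ¬ σ.SameCycle u v)
    {x : α} (hx : σ.SameCycle v x) : (glue σ u v).SameCycle v x := by
  rw [glue_comm]
  exact sameCycle_glue_of_left (fun h' => h h'.symm) hx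

theorem sameCycle_glue_of_sameCycle [Finite α] {σ : Equiv.Perm α} {u v : α}
    (h : ¬ σ.SameCycle u v) {x y : α} (hxy : σ.SameCycle x y) : (glue σ u v).SameCycle x y := by
  refine sameCycle_of_step (fun z => ?_) hxy
  by_cases hu : σ.SameCycle u z
  · exact (sameCycle_glue_of_left h hu).symm.trans (sameCycle_glue_of_left h (by simpa using hu))
  by_cases hv : σ.SameCycle v z
  · exact (sameCycle_glue_of_right h hv).symm.trans (sameCycle_glue_of_right h (by simpa using hv))
  have h1 : σ z ≠ u := fun e => hu (by rw [← e]; simp [Equiv.Perm.SameCycle.refl])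
  have h2 : σ z ≠ v := fun e => hv (by rw [← e]; simp [Equiv.Perm.SameCycle.refl])
  rw [← glue_apply_of_ne σ h1 h2]
  simp [Equiv.Perm.SameCycle.refl]

theorem sameCycle_glue_cases [Finite α] {σ : Equiv.Perm α} {u v : α} {x y : α}
    (hxy : (glue σ u v).SameCycle x y) :
    σ.SameCycle x y ∨ ((σ.SameCycle u x ∨ σ.SameCycle v x) ∧
      (σ.SameCycle u y ∨ σ.SameCycle v y)) := by
  obtain ⟨n, rfl⟩ := hxy.exists_nat_pow_eq
  clear hxy
  induction n with
  | zero => exact Or.inl (Equiv.Perm.SameCycle.refl _ _)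
  | succ n ih =>
    rw [pow_succ', Equiv.Perm.mul_apply]
    set z := ((glue σ u v) ^ n) x
    have rr : ∀ w, σ.SameCycle w w := fun w => Equiv.Perm.SameCycle.refl _ _
    by_cases hu : σ z = u
    · have hz : σ.SameCycle u z := by rw [← hu]; simp [Equiv.Perm.SameCycle.refl]
      rw [glue_apply_left σ hu]
      rcases ih with h | ⟨h, -⟩
      · exact Or.inr ⟨Or.inl (hz.trans h.symm), Or.inr (rr _)⟩
      · exact Or.inr ⟨h, Or.inr (rr _)⟩
    by_cases hv : σ z = v
    · have hz : σ.SameCycle v z := by rw [← hv]; simp [Equiv.Perm.SameCycle.refl]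
      rw [glue_apply_right σ hv]
      rcases ih with h | ⟨h, -⟩
      · exact Or.inr ⟨Or.inr (hz.trans h.symm), Or.inl (rr _)⟩
      · exact Or.inr ⟨h, Or.inl (rr _)⟩
    rw [glue_apply_of_ne σ hu hv]
    simpa only [Equiv.Perm.sameCycle_apply_right] using ih

theorem not_sameCycle_glue [Finite α] {σ : Equiv.Perm α} {u v : α} (huv : u ≠ v)
    (h : σ.SameCycle u v) : ¬ (glue σ u v).SameCycle u v := by
  classical
  have hex : ∃ n : ℕ, (σ ^ n) u = v := h.exists_nat_pow_eq
  have hm := Nat.find_spec hex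
  have hlt : ∀ i, i < Nat.find hex → (σ ^ i) u ≠ v := fun i hi => Nat.find_min hex hi
  set m := Nat.find hex with hm_def
  have hm0 : m ≠ 0 := by intro h0; rw [h0] at hm; exact huv (by simpa using hm)
  have hne : ∀ i, 0 < i → i < m → (σ ^ i) u ≠ u := by
    intro i hi him he
    have : (σ ^ (m - i)) u = v := by
      have e : m = (m - i) + i := by omega
      rw [← hm]
      conv_rhs => rw [e, pow_add, Equiv.Perm.mul_apply, he]
    exact hlt (m - i) (by omega) this
  have key : ∀ n : ℕ, ∃ i, i < m ∧ ((glue σ u v) ^ n) u = (σ ^ i) u := by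
    intro n
    induction n with
    | zero => exact ⟨0, by omega, rfl⟩
    | succ n ih =>
      obtain ⟨i, hi, he⟩ := ih
      rw [pow_succ', Equiv.Perm.mul_apply, he]
      have e : (σ ^ (i + 1)) u = σ ((σ ^ i) u) := by rw [pow_succ', Equiv.Perm.mul_apply]
      by_cases hi' : i + 1 = m
      · refine ⟨0, by omega, ?_⟩
        rw [glue_apply_right σ (by rw [← e, hi', hm])]
        simp
      · refine ⟨i + 1, by omega, ?_⟩
        rw [glue_apply_of_ne σ (by rw [← e]; exact hne _ (by omega) (by omega))
          (by rw [← e]; exact hlt _ (by omega)), e]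
  intro hs
  obtain ⟨n, hn⟩ := hs.exists_nat_pow_eq
  obtain ⟨i, hi, he⟩ := key n
  exact hlt i hi (by rw [← he, hn])

/-- The set of cycles of a permutation, fixed points included. -/
abbrev Cycles (σ : Equiv.Perm α) : Type _ := Quotient (Equiv.Perm.SameCycle.setoid σ)

theorem mk_eq_iff (σ : Equiv.Perm α) (x y : α) :
    (Quotient.mk (Equiv.Perm.SameCycle.setoid σ) x = Quotient.mk _ y) ↔ σ.SameCycle x y :=
  Quotient.eq (r := Equiv.Perm.SameCycle.setoid σ)

theorem card_cycles_glue_of_not [Finite α] {σ : Equiv.Perm α} {u v : α}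
    (h : ¬ σ.SameCycle u v) : Nat.card (Cycles (glue σ u v)) + 1 = Nat.card (Cycles σ) := by
  classical
  have : Fintype (Cycles σ) := Fintype.ofFinite _
  have hcard : Nat.card {q : Cycles σ // q ≠ Quotient.mk _ v} + 1 = Nat.card (Cycles σ) := by
    rw [Nat.card_eq_fintype_card, Nat.card_eq_fintype_card, Fintype.card_subtype_compl,
      Fintype.card_subtype_eq]
    have : 0 < Fintype.card (Cycles σ) := Fintype.card_pos_iff.2 ⟨Quotient.mk _ v⟩
    omega
  rw [← hcard]
  congr 1
  let f : Cycles σ → Cycles (glue σ u v) :=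
    Quotient.map' id (fun x y hxy => sameCycle_glue_of_sameCycle h hxy)
  have hf : ∀ x, f (Quotient.mk _ x) = Quotient.mk _ x := fun x => rfl
  symm
  refine Nat.card_congr (Equiv.ofBijective (fun q => f q.1) ⟨?_, ?_⟩)
  · rintro ⟨p, hp⟩ ⟨q, hq⟩ hpq
    induction p using Quotient.inductionOn with | _ x => ?_
    induction q using Quotient.inductionOn with | _ y => ?_
    simp only [hf, mk_eq_iff] at hpq
    rw [ne_eq, mk_eq_iff] at hp hq
    rw [Subtype.mk.injEq, mk_eq_iff]
    rcases sameCycle_glue_cases hpq with h1 | ⟨h1 | h1, h2 | h2⟩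
    · exact h1
    · exact h1.symm.trans h2
    · exact absurd h2.symm hq
    · exact absurd h1.symm hp
    · exact absurd h1.symm hp
  · intro q
    induction q using Quotient.inductionOn with | _ x => ?_
    by_cases hx : σ.SameCycle x v
    · refine ⟨⟨Quotient.mk _ u, by rw [ne_eq, mk_eq_iff]; exact h⟩, ?_⟩
      simp only [hf, mk_eq_iff]
      exact (sameCycle_glue h).trans (sameCycle_glue_of_right h hx.symm)
    · exact ⟨⟨Quotient.mk _ x, by rw [ne_eq, mk_eq_iff]; exact hx⟩, rfl⟩

theorem card_cycles_glue_of_sameCycle [Finite α] {σ : Equiv.Perm α} {u v : α} (huv : u ≠ v)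
    (h : σ.SameCycle u v) : Nat.card (Cycles (glue σ u v)) = Nat.card (Cycles σ) + 1 := by
  have := card_cycles_glue_of_not (not_sameCycle_glue huv h)
  rw [glue_glue] at this
  omega

end GluePerm

/-! ### Removing two elements and grafting, for plain finite sets -/

/-- The set `S \ {a, b}`. -/
abbrev Without {S : Type*} (a b : S) : Type _ := {x : S // x ≠ a ∧ x ≠ b}

/-- The set `(S ⊔ T) \ {a, b}` for `a ∈ S` and `b ∈ T`. -/
abbrev Graft {S T : Type*} (a : S) (b : T) : Type _ :=
  Without (Sum.inl a : S ⊕ T) (Sum.inr b)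

/-- An element `x ≠ a` of `S`, regarded as an element of `(S ⊔ T) \ {a, b}`. -/
def Graft.left {S T : Type*} {a : S} {b : T} (x : S) (h : x ≠ a) : Graft a b :=
  ⟨Sum.inl x, by simpa using h, by simp⟩

/-- An element `y ≠ b` of `T`, regarded as an element of `(S ⊔ T) \ {a, b}`. -/
def Graft.right {S T : Type*} {a : S} {b : T} (y : T) (h : y ≠ b) : Graft a b :=
  ⟨Sum.inr y, by simp, by simpa using h⟩

/-! ### Cyclic operads in sets -/

universe u v

/-- A cyclic operad in the category of sets, with arities arbitrary finite sets (including the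
empty one), without units.  In each axiom, `θ` is the canonical bijection between the two finite
sets in question, i.e. the one that is the identity on underlying elements (or, in `map_comp`,
the restriction of the given bijections). -/
structure CyclicOperad where
  obj (S : Type u) [Finite S] : Type v
  map {S T : Type u} [Finite S] [Finite T] (ρ : S ≃ T) : obj S → obj T
  map_refl {S : Type u} [Finite S] (x : obj S) : map (Equiv.refl S) x = x
  map_trans {S T R : Type u} [Finite S] [Finite T] [Finite R] (ρ : S ≃ T) (τ : T ≃ R) (x : obj S) :
    map (ρ.trans τ) x = map τ (map ρ x)
  comp {S T : Type u} [Finite S] [Finite T] (a : S) (b : T) : obj S → obj T → obj (Graft a b)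
  comp_symm {S T : Type u} [Finite S] [Finite T] (a : S) (b : T) (x : obj S) (y : obj T)
    (θ : Graft b a ≃ Graft a b) (_ : ∀ z, (θ z).1 = z.1.swap) :
    map θ (comp b a y x) = comp a b x y
  comp_assoc {S₁ S₂ S₃ : Type u} [Finite S₁] [Finite S₂] [Finite S₃]
    (a : S₁) (b c : S₂) (d : S₃) (hbc : b ≠ c) (x : obj S₁) (y : obj S₂) (z : obj S₃)
    (θ : Graft a (Graft.left (a := c) (b := d) b hbc) ≃
      Graft (Graft.right (a := a) (b := b) c hbc.symm) d)
    (_ : ∀ w, Equiv.sumAssoc S₁ S₂ S₃ (Sum.map Subtype.val id (θ w).1) =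
      Sum.map id Subtype.val w.1) :
    map θ (comp a (Graft.left b hbc) x (comp c d y z)) =
      comp (Graft.right c hbc.symm) d (comp a b x y) z
  map_comp {S T S' T' : Type u} [Finite S] [Finite T] [Finite S'] [Finite T']
    (ρ : S ≃ S') (τ : T ≃ T') (a : S) (b : T) (x : obj S) (y : obj T)
    (θ : Graft a b ≃ Graft (ρ a) (τ b)) (_ : ∀ z, (θ z).1 = Sum.map ρ τ z.1) :
    map θ (comp a b x y) = comp (ρ a) (τ b) (map ρ x) (map τ y)

namespace CyclicOperad

/-- A morphism of cyclic operads. -/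
@[ext]
structure Hom (P Q : CyclicOperad.{u, v}) where
  app (S : Type u) [Finite S] : P.obj S → Q.obj S
  app_map {S T : Type u} [Finite S] [Finite T] (ρ : S ≃ T) (x : P.obj S) :
    app T (P.map ρ x) = Q.map ρ (app S x)
  app_comp {S T : Type u} [Finite S] [Finite T] (a : S) (b : T) (x : P.obj S) (y : P.obj T) :
    app _ (P.comp a b x y) = Q.comp a b (app S x) (app T y)

instance : Category CyclicOperad.{u, v} where
  Hom := Hom
  id P :=
    { app := fun _ _ x => x
      app_map := fun _ _ => rfl
      app_comp := fun _ _ _ _ => rfl }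
  comp F G :=
    { app := fun S _ x => G.app S (F.app S x)
      app_map := fun ρ x => by rw [F.app_map, G.app_map]
      app_comp := fun a b x y => by rw [F.app_comp, G.app_comp] }

/-- The cyclic operad `*_C` with a one-point set in each arity. -/
def point : CyclicOperad.{u, v} where
  obj _ _ := PUnit
  map _ x := x
  map_refl _ := rfl
  map_trans _ _ _ := rfl
  comp _ _ _ _ := PUnit.unit
  comp_symm _ _ _ _ _ _ := rfl
  comp_assoc _ _ _ _ _ _ _ _ _ _ := rfl
  map_comp _ _ _ _ _ _ _ _ := rfl

/-- An internal operad in the cyclic operad `P`. -/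
structure IsInternal (P : CyclicOperad.{u, v}) (ς : ∀ (S : Type u) [Finite S], P.obj S) :
    Prop where
  map {S T : Type u} [Finite S] [Finite T] (ρ : S ≃ T) : P.map ρ (ς S) = ς T
  comp {S T : Type u} [Finite S] [Finite T] (a : S) (b : T) :
    P.comp a b (ς S) (ς T) = ς (Graft a b)

end CyclicOperad

/-! ### Modular operads in sets -/

/-- A modular operad in the category of sets, with arities arbitrary finite sets, graded by the
genus, without units and without a stability condition.  The genus of a composition is written as
a number `k` with `g + h = k`.  In each axiom, `θ` is the canonical bijection between the two
finite sets in question, i.e. the one that is the identity on underlying elements (or, in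
`map_comp` and `map_contr`, the restriction of the given bijections). -/
structure ModularOperad where
  obj (S : Type u) [Finite S] (g : ℕ) : Type v
  map {S T : Type u} [Finite S] [Finite T] {g : ℕ} (ρ : S ≃ T) : obj S g → obj T g
  map_refl {S : Type u} [Finite S] {g : ℕ} (x : obj S g) : map (Equiv.refl S) x = x
  map_trans {S T R : Type u} [Finite S] [Finite T] [Finite R] {g : ℕ} (ρ : S ≃ T) (τ : T ≃ R)
    (x : obj S g) : map (ρ.trans τ) x = map τ (map ρ x)
  comp {S T : Type u} [Finite S] [Finite T] {g h k : ℕ} (a : S) (b : T) (_ : g + h = k) :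
    obj S g → obj T h → obj (Graft a b) k
  contr {S : Type u} [Finite S] {g : ℕ} (a b : S) (_ : a ≠ b) : obj S g → obj (Without a b) (g + 1)
  contr_symm {S : Type u} [Finite S] {g : ℕ} (a b : S) (hab : a ≠ b) (x : obj S g)
    (θ : Without b a ≃ Without a b) (_ : ∀ z, (θ z).1 = z.1) :
    map θ (contr b a hab.symm x) = contr a b hab x
  comp_symm {S T : Type u} [Finite S] [Finite T] {g h k : ℕ} (a : S) (b : T)
    (hk : g + h = k) (hk' : h + g = k) (x : obj S g) (y : obj T h)
    (θ : Graft b a ≃ Graft a b) (_ : ∀ z, (θ z).1 = z.1.swap) :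
    map θ (comp b a hk' y x) = comp a b hk x y
  comp_assoc {S₁ S₂ S₃ : Type u} [Finite S₁] [Finite S₂] [Finite S₃] {g₁ g₂ g₃ g₁₂ g₂₃ g : ℕ}
    (h₁₂ : g₁ + g₂ = g₁₂) (h₂₃ : g₂ + g₃ = g₂₃) (hl : g₁ + g₂₃ = g) (hr : g₁₂ + g₃ = g)
    (a : S₁) (b c : S₂) (d : S₃) (hbc : b ≠ c) (x : obj S₁ g₁) (y : obj S₂ g₂) (z : obj S₃ g₃)
    (θ : Graft a (Graft.left (a := c) (b := d) b hbc) ≃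
      Graft (Graft.right (a := a) (b := b) c hbc.symm) d)
    (_ : ∀ w, Equiv.sumAssoc S₁ S₂ S₃ (Sum.map Subtype.val id (θ w).1) =
      Sum.map id Subtype.val w.1) :
    map θ (comp a (Graft.left b hbc) hl x (comp c d h₂₃ y z)) =
      comp (Graft.right c hbc.symm) d hr (comp a b h₁₂ x y) z
  contr_contr {S : Type u} [Finite S] {g : ℕ} (a b c d : S) (hab : a ≠ b) (hac : a ≠ c)
    (had : a ≠ d) (hbc : b ≠ c) (hbd : b ≠ d) (hcd : c ≠ d) (x : obj S g)
    (θ : Without (⟨a, hac, had⟩ : Without c d) ⟨b, hbc, hbd⟩ ≃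
      Without (⟨c, hac.symm, hbc.symm⟩ : Without a b) ⟨d, had.symm, hbd.symm⟩)
    (_ : ∀ z, (θ z).1.1 = z.1.1) :
    map θ (contr ⟨a, hac, had⟩ ⟨b, hbc, hbd⟩ (by simpa using hab) (contr c d hcd x)) =
      contr ⟨c, hac.symm, hbc.symm⟩ ⟨d, had.symm, hbd.symm⟩ (by simpa using hcd)
        (contr a b hab x)
  contr_comp {S T : Type u} [Finite S] [Finite T] {g h k : ℕ} (hk : g + h = k)
    (a c : S) (b d : T) (hac : a ≠ c) (hbd : b ≠ d) (x : obj S g) (y : obj T h)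
    (θ : Without (Graft.left a hac : Graft c d) (Graft.right b hbd) ≃
      Without (Graft.left c hac.symm : Graft a b) (Graft.right d hbd.symm))
    (_ : ∀ z, (θ z).1.1 = z.1.1) :
    map θ (contr (Graft.left a hac) (Graft.right b hbd) (by simp [Graft.left, Graft.right])
        (comp c d hk x y)) =
      contr (Graft.left c hac.symm) (Graft.right d hbd.symm) (by simp [Graft.left, Graft.right])
        (comp a b hk x y)
  comp_contr {S T : Type u} [Finite S] [Finite T] {g h k : ℕ} (hk : g + h = k)
    (hk' : g + 1 + h = k + 1) (a c d : S) (b : T) (hac : a ≠ c) (had : a ≠ d) (hcd : c ≠ d)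
    (x : obj S g) (y : obj T h)
    (θ : Graft (⟨a, hac, had⟩ : Without c d) b ≃
      Without (Graft.left c hac.symm : Graft a b) (Graft.left d had.symm))
    (_ : ∀ z, (θ z).1.1 = Sum.map Subtype.val id z.1) :
    map θ (comp ⟨a, hac, had⟩ b hk' (contr c d hcd x) y) =
      contr (Graft.left c hac.symm) (Graft.left d had.symm) (by simpa [Graft.left] using hcd)
        (comp a b hk x y)
  map_comp {S T S' T' : Type u} [Finite S] [Finite T] [Finite S'] [Finite T'] {g h k : ℕ}
    (hk : g + h = k) (ρ : S ≃ S') (τ : T ≃ T') (a : S) (b : T) (x : obj S g) (y : obj T h)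
    (θ : Graft a b ≃ Graft (ρ a) (τ b)) (_ : ∀ z, (θ z).1 = Sum.map ρ τ z.1) :
    map θ (comp a b hk x y) = comp (ρ a) (τ b) hk (map ρ x) (map τ y)
  map_contr {S S' : Type u} [Finite S] [Finite S'] {g : ℕ} (ρ : S ≃ S') (a b : S) (hab : a ≠ b)
    (x : obj S g) (θ : Without a b ≃ Without (ρ a) (ρ b)) (_ : ∀ z, (θ z).1 = ρ z.1) :
    map θ (contr a b hab x) = contr (ρ a) (ρ b) (ρ.injective.ne hab) (map ρ x)

namespace ModularOperad

/-- A morphism of modular operads. -/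
@[ext]
structure Hom (P Q : ModularOperad.{u, v}) where
  app (S : Type u) [Finite S] (g : ℕ) : P.obj S g → Q.obj S g
  app_map {S T : Type u} [Finite S] [Finite T] {g : ℕ} (ρ : S ≃ T) (x : P.obj S g) :
    app T g (P.map ρ x) = Q.map ρ (app S g x)
  app_comp {S T : Type u} [Finite S] [Finite T] {g h k : ℕ} (a : S) (b : T) (hk : g + h = k)
    (x : P.obj S g) (y : P.obj T h) :
    app _ k (P.comp a b hk x y) = Q.comp a b hk (app S g x) (app T h y)
  app_contr {S : Type u} [Finite S] {g : ℕ} (a b : S) (hab : a ≠ b) (x : P.obj S g) :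
    app _ _ (P.contr a b hab x) = Q.contr a b hab (app S g x)

instance : Category ModularOperad.{u, v} where
  Hom := Hom
  id P :=
    { app := fun _ _ _ x => x
      app_map := fun _ _ => rfl
      app_comp := fun _ _ _ _ _ => rfl
      app_contr := fun _ _ _ _ => rfl }
  comp F G :=
    { app := fun S _ g x => G.app S g (F.app S g x)
      app_map := fun ρ x => by rw [F.app_map, G.app_map]
      app_comp := fun a b hk x y => by rw [F.app_comp, G.app_comp]
      app_contr := fun a b hab x => by rw [F.app_contr, G.app_contr] }

/-- The modular operad `*_M` with a one-point set in each arity and genus. -/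
def point : ModularOperad.{u, v} where
  obj _ _ _ := PUnit
  map _ x := x
  map_refl _ := rfl
  map_trans _ _ _ := rfl
  comp _ _ _ _ _ := PUnit.unit
  contr _ _ _ _ := PUnit.unit
  contr_symm _ _ _ _ _ _ := rfl
  comp_symm _ _ _ _ _ _ _ _ := rfl
  comp_assoc _ _ _ _ _ _ _ _ _ _ _ _ _ _ := rfl
  contr_contr _ _ _ _ _ _ _ _ _ _ _ _ _ := rfl
  contr_comp _ _ _ _ _ _ _ _ _ _ _ := rfl
  comp_contr _ _ _ _ _ _ _ _ _ _ _ _ _ := rfl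
  map_comp _ _ _ _ _ _ _ _ _ := rfl
  map_contr _ _ _ _ _ _ _ := rfl

/-- The genus zero part of a modular operad, a cyclic operad. -/
def genusZero (P : ModularOperad.{u, v}) : CyclicOperad.{u, v} where
  obj S _ := P.obj S 0
  map ρ := P.map ρ
  map_refl := P.map_refl
  map_trans := P.map_trans
  comp a b := P.comp a b (zero_add 0)
  comp_symm a b := P.comp_symm a b _ _
  comp_assoc := P.comp_assoc _ _ _ _
  map_comp := P.map_comp _

/-- The forgetful functor `□` from modular operads to cyclic operads. -/
def forget : ModularOperad.{u, v} ⥤ CyclicOperad.{u, v} where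
  obj := genusZero
  map F :=
    { app := fun S _ => F.app S 0
      app_map := F.app_map
      app_comp := fun a b => F.app_comp a b _ }

/-- An internal operad in the modular operad `P`. -/
structure IsInternal (P : ModularOperad.{u, v})
    (ϖ : ∀ (S : Type u) [Finite S] (g : ℕ), P.obj S g) : Prop where
  map {S T : Type u} [Finite S] [Finite T] {g : ℕ} (ρ : S ≃ T) : P.map ρ (ϖ S g) = ϖ T g
  comp {S T : Type u} [Finite S] [Finite T] {g h k : ℕ} (a : S) (b : T) (hk : g + h = k) :
    P.comp a b hk (ϖ S g) (ϖ T h) = ϖ (Graft a b) k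
  contr {S : Type u} [Finite S] {g : ℕ} (a b : S) (hab : a ≠ b) :
    P.contr a b hab (ϖ S g) = ϖ (Without a b) (g + 1)

end ModularOperad

/-! ### Multicyclically ordered sets -/

/-- A finite multicyclically ordered set: a finite set `carrier` with a decomposition into
finitely many, but at least one, possibly empty, totally cyclically ordered parts.  The parts are
indexed by the finite non-empty set `index`, and `part x` is the part that contains `x`.
The total cyclic orders of all (finite) parts are encoded by the permutation `next`, which sends
an element to its immediate successor in its part (a one-element part being its own successor):
a total cyclic order on a finite set is the same as a permutation with at most one orbit. -/
structure MultCyc where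
  carrier : Type u
  index : Type u
  part : carrier → index
  next : Equiv.Perm carrier
  finite_carrier : Finite carrier
  finite_index : Finite index
  nonempty_index : Nonempty index
  part_eq_iff : ∀ x y, part x = part y ↔ next.SameCycle x y

namespace MultCyc

instance (S : MultCyc.{u}) : Finite S.carrier := S.finite_carrier
instance (S : MultCyc.{u}) : Finite S.index := S.finite_index
instance (S : MultCyc.{u}) : Nonempty S.index := S.nonempty_index

/-- Isomorphisms of multicyclically ordered sets: a bijection of the underlying sets that preserves
the cyclic orders, together with a compatible bijection between the indexing sets. -/
@[ext]
structure Iso (S T : MultCyc.{u}) where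
  toEquiv : S.carrier ≃ T.carrier
  indexEquiv : S.index ≃ T.index
  part_apply : ∀ x, T.part (toEquiv x) = indexEquiv (S.part x)
  next_apply : ∀ x, T.next (toEquiv x) = toEquiv (S.next x)

/-- The identity. -/
def Iso.refl (S : MultCyc.{u}) : Iso S S where
  toEquiv := Equiv.refl _
  indexEquiv := Equiv.refl _
  part_apply _ := rfl
  next_apply _ := rfl

/-- Composition of isomorphisms. -/
def Iso.trans {S T R : MultCyc.{u}} (ρ : Iso S T) (τ : Iso T R) : Iso S R where
  toEquiv := ρ.toEquiv.trans τ.toEquiv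
  indexEquiv := ρ.indexEquiv.trans τ.indexEquiv
  part_apply x := by simp [τ.part_apply, ρ.part_apply]
  next_apply x := by simp [τ.next_apply, ρ.next_apply]

/-- The indices of the empty parts. -/
abbrev EmptyPart (S : MultCyc.{u}) : Type u := {i : S.index // ∀ x, S.part x ≠ i}

/-- The set of arcs.  If one draws the elements of each part on an oriented circle, they cut the
circle into arcs: `Sum.inl x` is the arc from `x` to its successor, and `Sum.inr i` is the whole
circle of the empty part `i`. -/
abbrev Arc (S : MultCyc.{u}) : Type u := S.carrier ⊕ S.EmptyPart

/-- The bijection between the arcs induced by an isomorphism. -/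
def Iso.onArc {S T : MultCyc.{u}} (ρ : Iso S T) : S.Arc → T.Arc
  | Sum.inl x => Sum.inl (ρ.toEquiv x)
  | Sum.inr i => Sum.inr ⟨ρ.indexEquiv i.1, fun y hy => i.2 (ρ.toEquiv.symm y) (by
      apply ρ.indexEquiv.injective
      rw [← ρ.part_apply, Equiv.apply_symm_apply, hy])⟩

/-- The disjoint union of multicyclically ordered sets. -/
def disjointUnion (S T : MultCyc.{u}) : MultCyc.{u} where
  carrier := S.carrier ⊕ T.carrier
  index := S.index ⊕ T.index
  part := Sum.map S.part T.part
  next := Equiv.sumCongr S.next T.next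
  finite_carrier := inferInstance
  finite_index := inferInstance
  nonempty_index := inferInstance
  part_eq_iff := by
    have hl : ∀ (n : ℕ) (x : S.carrier), ((Equiv.sumCongr S.next T.next :
        Equiv.Perm (S.carrier ⊕ T.carrier)) ^ n) (Sum.inl x) = Sum.inl ((S.next ^ n) x) := by
      intro n x
      induction n with
      | zero => rfl
      | succ n ih => rw [pow_succ', Equiv.Perm.mul_apply, ih, pow_succ', Equiv.Perm.mul_apply]; rfl
    have hr : ∀ (n : ℕ) (x : T.carrier), ((Equiv.sumCongr S.next T.next :
        Equiv.Perm (S.carrier ⊕ T.carrier)) ^ n) (Sum.inr x) = Sum.inr ((T.next ^ n) x) := by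
      intro n x
      induction n with
      | zero => rfl
      | succ n ih => rw [pow_succ', Equiv.Perm.mul_apply, ih, pow_succ', Equiv.Perm.mul_apply]; rfl
    rintro (x | x) (y | y)
    · simp only [Sum.map_inl, Sum.inl.injEq]
      rw [S.part_eq_iff]
      constructor
      · intro h
        obtain ⟨n, rfl⟩ := h.exists_nat_pow_eq
        exact ⟨(n : ℤ), by rw [zpow_natCast, hl]⟩
      · intro h
        obtain ⟨n, hn⟩ := h.exists_nat_pow_eq
        rw [hl] at hn
        exact ⟨(n : ℤ), by rw [zpow_natCast]; exact Sum.inl_injective hn⟩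
    · simp only [Sum.map_inl, Sum.map_inr, reduceCtorEq, false_iff]
      intro h
      obtain ⟨n, hn⟩ := h.exists_nat_pow_eq
      rw [hl] at hn
      cases hn
    · simp only [Sum.map_inl, Sum.map_inr, reduceCtorEq, false_iff]
      intro h
      obtain ⟨n, hn⟩ := h.exists_nat_pow_eq
      rw [hr] at hn
      cases hn
    · simp only [Sum.map_inr, Sum.inr.injEq]
      rw [T.part_eq_iff]
      constructor
      · intro h
        obtain ⟨n, rfl⟩ := h.exists_nat_pow_eq
        exact ⟨(n : ℤ), by rw [zpow_natCast, hr]⟩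
      · intro h
        obtain ⟨n, hn⟩ := h.exists_nat_pow_eq
        rw [hr] at hn
        exact ⟨(n : ℤ), by rw [zpow_natCast]; exact Sum.inr_injective hn⟩

/-- The cut `S \ {u, v}` at two (distinct) elements, obtained by gluing the circles at `u` and `v`:
after the elements before `u` one continues with the elements after `v`, and after the elements
before `v` one continues with the elements after `u`.  If `u` and `v` lie in different parts
`[A u]` and `[v B]`, these are replaced by the single part `[A B]`; if they lie in the same part
`[u A v B]`, it is replaced by the two parts `[A]` and `[B]`.  All other parts are left alone.
The indexing set consists of the empty parts of `S` and of the cycles of the permutation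
`GluePerm.glue S.next u v` of the underlying set of `S`; this has the same cycles as `S.next`,
apart from one or two cycles containing `u` and `v`, which are replaced by `(A v B u)` in the first
case and by `(u A)` and `(v B)` in the second case. -/
noncomputable def cut (S : MultCyc.{u}) (u v : S.carrier) : MultCyc.{u} where
  carrier := Without u v
  index := S.EmptyPart ⊕ GluePerm.Cycles (GluePerm.glue S.next u v)
  part x := Sum.inr (Quotient.mk _ x.1)
  next := GluePerm.firstReturn (GluePerm.glue S.next u v) u v
  finite_carrier := inferInstance
  finite_index := inferInstance
  nonempty_index := ⟨Sum.inr (Quotient.mk _ u)⟩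
  part_eq_iff x y := by
    rw [GluePerm.sameCycle_firstReturn, Sum.inr.injEq, GluePerm.mk_eq_iff]

open scoped Classical in
/-- The map from the arcs of `S` to the arcs of `S \ {u, v}`.  An arc beginning at an element that
survives is sent to the arc beginning at this element.  The arcs beginning at `u` and `v` are
prolonged backwards through the points where the circles have been glued, until one meets a
surviving element; if there is none, they become the circle of an empty part. -/
noncomputable def cutArc (S : MultCyc.{u}) (u v : S.carrier) : S.Arc → (S.cut u v).Arc
  | Sum.inl x =>
    if h : ∃ n : ℕ, (((GluePerm.glue S.next u v)⁻¹ ^ n) x ≠ u ∧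
        ((GluePerm.glue S.next u v)⁻¹ ^ n) x ≠ v) then
      Sum.inl ⟨((GluePerm.glue S.next u v)⁻¹ ^ Nat.find h) x, Nat.find_spec h⟩
    else
      Sum.inr ⟨Sum.inr (Quotient.mk _ x), fun y hy => h (by
        have h1 := (GluePerm.mk_eq_iff _ _ _).1 (Sum.inr_injective hy)
        obtain ⟨n, hn⟩ := (Equiv.Perm.sameCycle_inv.2 h1.symm).exists_nat_pow_eq
        exact ⟨n, by rw [hn]; exact y.2⟩)⟩
  | Sum.inr i => Sum.inr ⟨Sum.inl i, fun y hy => by cases hy⟩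

/-- The merging `(S ⊔ T) \ {u, v}` of two multicyclically ordered sets at `u ∈ S` and `v ∈ T`. -/
noncomputable def merge (S T : MultCyc.{u}) (u : S.carrier) (v : T.carrier) : MultCyc.{u} :=
  (S.disjointUnion T).cut (Sum.inl u) (Sum.inr v)

/-- The map from the arcs of `S` to the arcs of `(S ⊔ T) \ {u, v}`. -/
noncomputable def mergeArcLeft (S T : MultCyc.{u}) (u : S.carrier) (v : T.carrier) :
    S.Arc → (S.merge T u v).Arc := fun α =>
  (S.disjointUnion T).cutArc (Sum.inl u) (Sum.inr v)
    (α.map Sum.inl fun i => ⟨Sum.inl i.1, by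
      rintro (x | x) hx
      · exact i.2 x (Sum.inl_injective hx)
      · cases hx⟩)

/-- The map from the arcs of `T` to the arcs of `(S ⊔ T) \ {u, v}`. -/
noncomputable def mergeArcRight (S T : MultCyc.{u}) (u : S.carrier) (v : T.carrier) :
    T.Arc → (S.merge T u v).Arc := fun α =>
  (S.disjointUnion T).cutArc (Sum.inl u) (Sum.inr v)
    (α.map Sum.inr fun i => ⟨Sum.inr i.1, by
      rintro (x | x) hx
      · cases hx
      · exact i.2 x (Sum.inr_injective hx)⟩)

/-- The pair `(S, g)` is geometric: `(g - b + 1) / 2` is a natural number, where `b` is the number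
of parts of `S`. -/
def Geometric (S : MultCyc.{u}) (g : ℕ) : Prop := ∃ G : ℕ, g + 1 = Nat.card S.index + 2 * G

/-- Cyclically ordered sets are the multicyclically ordered sets with exactly one part. -/
def IsCyc (S : MultCyc.{u}) : Prop := Subsingleton S.index

theorem IsCyc.sameCycle {S : MultCyc.{u}} (hS : S.IsCyc) (x y : S.carrier) :
    S.next.SameCycle x y :=
  (S.part_eq_iff x y).1 (@Subsingleton.elim _ hS _ _)

theorem not_sameCycle_disjointUnion (S T : MultCyc.{u}) (x : S.carrier) (y : T.carrier) :
    ¬ (S.disjointUnion T).next.SameCycle (Sum.inl x) (Sum.inr y) := by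
  intro h
  have := ((S.disjointUnion T).part_eq_iff (Sum.inl x) (Sum.inr y)).2 h
  cases this

theorem IsCyc.merge {S T : MultCyc.{u}} (hS : S.IsCyc) (hT : T.IsCyc) (u : S.carrier)
    (v : T.carrier) : (S.merge T u v).IsCyc := by
  have huv := not_sameCycle_disjointUnion S T u v
  have he : ∀ i : (S.disjointUnion T).EmptyPart, False := by
    rintro ⟨i | i, hi⟩
    · exact hi (Sum.inl u) (congrArg Sum.inl (@Subsingleton.elim _ hS _ _))
    · exact hi (Sum.inr v) (congrArg Sum.inr (@Subsingleton.elim _ hT _ _))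
  have hu : ∀ x, (GluePerm.glue (S.disjointUnion T).next (Sum.inl u) (Sum.inr v)).SameCycle
      (Sum.inl u) x := by
    rintro (x | x)
    · exact GluePerm.sameCycle_glue_of_left huv (((S.disjointUnion T).part_eq_iff _ _).1
        (congrArg Sum.inl (@Subsingleton.elim _ hS _ _)))
    · exact (GluePerm.sameCycle_glue huv).trans (GluePerm.sameCycle_glue_of_right huv
        (((S.disjointUnion T).part_eq_iff _ _).1
          (congrArg Sum.inr (@Subsingleton.elim _ hT _ _))))
  refine ⟨?_⟩
  rintro (i | p) (j | q)
  · exact (he i).elim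
  · exact (he i).elim
  · exact (he j).elim
  · induction p using Quotient.inductionOn with | _ x => ?_
    induction q using Quotient.inductionOn with | _ y => ?_
    exact congrArg Sum.inr ((GluePerm.mk_eq_iff _ x y).2 ((hu x).symm.trans (hu y)))

theorem IsCyc.geometric_zero {S : MultCyc.{u}} (hS : S.IsCyc) : S.Geometric 0 := by
  have : Subsingleton S.index := hS
  exact ⟨0, by simp⟩

theorem card_index (S : MultCyc.{u}) :
    Nat.card S.index = Nat.card S.EmptyPart + Nat.card (GluePerm.Cycles S.next) := by
  classical
  rw [← Nat.card_sum]
  symm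
  let f : GluePerm.Cycles S.next → S.index :=
    Quotient.lift S.part fun x y hxy => (S.part_eq_iff x y).2 hxy
  have hf : ∀ x, f (Quotient.mk _ x) = S.part x := fun x => rfl
  refine Nat.card_congr (Equiv.ofBijective (Sum.elim Subtype.val f) ⟨?_, ?_⟩)
  · rintro (i | p) (j | q) h
    · exact congrArg Sum.inl (Subtype.ext h)
    · induction q using Quotient.inductionOn with | _ y => ?_
      exact (i.2 y h.symm).elim
    · induction p using Quotient.inductionOn with | _ y => ?_
      exact (j.2 y h).elim
    · induction p using Quotient.inductionOn with | _ x => ?_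
      induction q using Quotient.inductionOn with | _ y => ?_
      exact congrArg Sum.inr ((GluePerm.mk_eq_iff _ x y).2 ((S.part_eq_iff x y).1 h))
  · intro i
    by_cases hi : ∀ x, S.part x ≠ i
    · exact ⟨Sum.inl ⟨i, hi⟩, rfl⟩
    · push Not at hi
      obtain ⟨x, rfl⟩ := hi
      exact ⟨Sum.inr (Quotient.mk _ x), rfl⟩

theorem card_index_cut_of_ne (S : MultCyc.{u}) {u v : S.carrier} (h : S.part u ≠ S.part v) :
    Nat.card (S.cut u v).index + 1 = Nat.card S.index := by
  rw [card_index S, show Nat.card (S.cut u v).index = _ from Nat.card_sum, add_assoc,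
    GluePerm.card_cycles_glue_of_not (fun hs => h ((S.part_eq_iff _ _).2 hs))]

theorem card_index_cut_of_eq (S : MultCyc.{u}) {u v : S.carrier} (huv : u ≠ v)
    (h : S.part u = S.part v) : Nat.card (S.cut u v).index = Nat.card S.index + 1 := by
  rw [card_index S, show Nat.card (S.cut u v).index = _ from Nat.card_sum, add_assoc,
    GluePerm.card_cycles_glue_of_sameCycle huv ((S.part_eq_iff _ _).1 h)]

theorem Geometric.cut {S : MultCyc.{u}} {g : ℕ} (hS : S.Geometric g) {u v : S.carrier}
    (huv : u ≠ v) : (S.cut u v).Geometric (g + 1) := by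
  obtain ⟨G, hG⟩ := hS
  by_cases h : S.part u = S.part v
  · exact ⟨G, by rw [card_index_cut_of_eq S huv h]; omega⟩
  · have := card_index_cut_of_ne S h
    exact ⟨G + 1, by omega⟩

theorem Geometric.merge {S T : MultCyc.{u}} {g h k : ℕ} (hS : S.Geometric g) (hT : T.Geometric h)
    (hk : g + h = k) (u : S.carrier) (v : T.carrier) : (S.merge T u v).Geometric k := by
  obtain ⟨G, hG⟩ := hS
  obtain ⟨H, hH⟩ := hT
  have h1 : Nat.card (S.merge T u v).index + 1 = Nat.card (S.disjointUnion T).index :=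
    card_index_cut_of_ne _ (by intro h; cases h)
  have h2 : Nat.card (S.disjointUnion T).index = Nat.card S.index + Nat.card T.index :=
    Nat.card_sum
  exact ⟨G + H, by omega⟩

theorem Geometric.iso {S T : MultCyc.{u}} {g : ℕ} (hS : S.Geometric g) (ρ : Iso S T) :
    T.Geometric g := by
  obtain ⟨G, hG⟩ := hS
  exact ⟨G, by rw [hG, Nat.card_congr ρ.indexEquiv]⟩

end MultCyc

/-! ### Non-symmetric cyclic operads in sets -/

/-- Finite cyclically ordered sets. -/
abbrev CycSet : Type (u + 1) := {C : MultCyc.{u} // C.IsCyc}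

/-- The merging of cyclically ordered sets. -/
noncomputable def CycSet.merge (C D : CycSet.{u}) (a : C.1.carrier) (b : D.1.carrier) :
    CycSet.{u} :=
  ⟨C.1.merge D.1 a b, C.2.merge D.2 a b⟩

/-- A non-symmetric cyclic operad in the category of sets, with arities arbitrary finite cyclically
ordered sets (including the empty one), without units.  In each axiom, `θ` is the canonical
isomorphism between the two sets in question, i.e. the one that is compatible with the maps from
the arcs of the original sets. -/
structure NsCyclicOperad where
  obj (C : CycSet.{u}) : Type v
  map {C D : CycSet.{u}} (ρ : MultCyc.Iso C.1 D.1) : obj C → obj D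
  map_refl {C : CycSet.{u}} (x : obj C) : map (MultCyc.Iso.refl C.1) x = x
  map_trans {C D E : CycSet.{u}} (ρ : MultCyc.Iso C.1 D.1) (τ : MultCyc.Iso D.1 E.1) (x : obj C) :
    map (ρ.trans τ) x = map τ (map ρ x)
  comp {C D : CycSet.{u}} (a : C.1.carrier) (b : D.1.carrier) : obj C → obj D → obj (C.merge D a b)
  comp_symm {C D : CycSet.{u}} (a : C.1.carrier) (b : D.1.carrier) (x : obj C) (y : obj D)
    (θ : MultCyc.Iso (D.merge C b a).1 (C.merge D a b).1)
    (_ : ∀ α, θ.onArc (D.1.mergeArcRight C.1 b a α) = C.1.mergeArcLeft D.1 a b α)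
    (_ : ∀ α, θ.onArc (D.1.mergeArcLeft C.1 b a α) = C.1.mergeArcRight D.1 a b α) :
    map θ (comp b a y x) = comp a b x y
  comp_assoc {C₁ C₂ C₃ : CycSet.{u}} (a : C₁.1.carrier) (b c : C₂.1.carrier) (d : C₃.1.carrier)
    (hbc : b ≠ c) (x : obj C₁) (y : obj C₂) (z : obj C₃)
    (θ : MultCyc.Iso (C₁.merge (C₂.merge C₃ c d) a (Graft.left b hbc)).1
      ((C₁.merge C₂ a b).merge C₃ (Graft.right c hbc.symm) d).1)
    (_ : ∀ α, θ.onArc (C₁.1.mergeArcLeft (C₂.merge C₃ c d).1 a (Graft.left b hbc) α) =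
      (C₁.merge C₂ a b).1.mergeArcLeft C₃.1 (Graft.right c hbc.symm) d
        (C₁.1.mergeArcLeft C₂.1 a b α))
    (_ : ∀ α, θ.onArc (C₁.1.mergeArcRight (C₂.merge C₃ c d).1 a (Graft.left b hbc)
        (C₂.1.mergeArcLeft C₃.1 c d α)) =
      (C₁.merge C₂ a b).1.mergeArcLeft C₃.1 (Graft.right c hbc.symm) d
        (C₁.1.mergeArcRight C₂.1 a b α))
    (_ : ∀ α, θ.onArc (C₁.1.mergeArcRight (C₂.merge C₃ c d).1 a (Graft.left b hbc)
        (C₂.1.mergeArcRight C₃.1 c d α)) =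
      (C₁.merge C₂ a b).1.mergeArcRight C₃.1 (Graft.right c hbc.symm) d α) :
    map θ (comp a (Graft.left b hbc) x (comp c d y z)) =
      comp (Graft.right c hbc.symm) d (comp a b x y) z
  map_comp {C D C' D' : CycSet.{u}} (ρ : MultCyc.Iso C.1 C'.1) (τ : MultCyc.Iso D.1 D'.1)
    (a : C.1.carrier) (b : D.1.carrier) (x : obj C) (y : obj D)
    (θ : MultCyc.Iso (C.merge D a b).1 (C'.merge D' (ρ.toEquiv a) (τ.toEquiv b)).1)
    (_ : ∀ α, θ.onArc (C.1.mergeArcLeft D.1 a b α) =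
      C'.1.mergeArcLeft D'.1 (ρ.toEquiv a) (τ.toEquiv b) (ρ.onArc α))
    (_ : ∀ α, θ.onArc (C.1.mergeArcRight D.1 a b α) =
      C'.1.mergeArcRight D'.1 (ρ.toEquiv a) (τ.toEquiv b) (τ.onArc α)) :
    map θ (comp a b x y) = comp (ρ.toEquiv a) (τ.toEquiv b) (map ρ x) (map τ y)

namespace NsCyclicOperad

/-- A morphism of non-symmetric cyclic operads. -/
@[ext]
structure Hom (P Q : NsCyclicOperad.{u, v}) where
  app (C : CycSet.{u}) : P.obj C → Q.obj C
  app_map {C D : CycSet.{u}} (ρ : MultCyc.Iso C.1 D.1) (x : P.obj C) :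
    app D (P.map ρ x) = Q.map ρ (app C x)
  app_comp {C D : CycSet.{u}} (a : C.1.carrier) (b : D.1.carrier) (x : P.obj C) (y : P.obj D) :
    app _ (P.comp a b x y) = Q.comp a b (app C x) (app D y)

instance : Category NsCyclicOperad.{u, v} where
  Hom := Hom
  id P :=
    { app := fun _ x => x
      app_map := fun _ _ => rfl
      app_comp := fun _ _ _ _ => rfl }
  comp F G :=
    { app := fun C x => G.app C (F.app C x)
      app_map := fun ρ x => by rw [F.app_map, G.app_map]
      app_comp := fun a b x y => by rw [F.app_comp, G.app_comp] }

/-- The non-symmetric cyclic operad with a one-point set in each arity. -/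
def point : NsCyclicOperad.{u, v} where
  obj _ := PUnit
  map _ x := x
  map_refl _ := rfl
  map_trans _ _ _ := rfl
  comp _ _ _ _ := PUnit.unit
  comp_symm _ _ _ _ _ _ _ := rfl
  comp_assoc _ _ _ _ _ _ _ _ _ _ _ _ := rfl
  map_comp _ _ _ _ _ _ _ _ _ := rfl

/-- An internal operad in the non-symmetric cyclic operad `P`. -/
structure IsInternal (P : NsCyclicOperad.{u, v}) (ς : ∀ C : CycSet.{u}, P.obj C) : Prop where
  map {C D : CycSet.{u}} (ρ : MultCyc.Iso C.1 D.1) : P.map ρ (ς C) = ς D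
  comp {C D : CycSet.{u}} (a : C.1.carrier) (b : D.1.carrier) :
    P.comp a b (ς C) (ς D) = ς (C.merge D a b)

end NsCyclicOperad

/-! ### Non-symmetric modular operads in sets -/

/-- A (geometric) non-symmetric modular operad in the category of sets, with arities arbitrary
finite multicyclically ordered sets, graded by the genus, without units and without a stability
condition.  The genus of a composition is written as a number `k` with `g + h = k`.  In each axiom,
`θ` is the canonical isomorphism between the two multicyclically ordered sets in question, i.e. the
one that is compatible with the maps from the arcs of the original sets. -/
structure NsModularOperad where
  obj (S : MultCyc.{u}) (g : ℕ) : Type v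
  geometric {S : MultCyc.{u}} {g : ℕ} : obj S g → S.Geometric g
  map {S T : MultCyc.{u}} {g : ℕ} (ρ : MultCyc.Iso S T) : obj S g → obj T g
  map_refl {S : MultCyc.{u}} {g : ℕ} (x : obj S g) : map (MultCyc.Iso.refl S) x = x
  map_trans {S T R : MultCyc.{u}} {g : ℕ} (ρ : MultCyc.Iso S T) (τ : MultCyc.Iso T R)
    (x : obj S g) : map (ρ.trans τ) x = map τ (map ρ x)
  comp {S T : MultCyc.{u}} {g h k : ℕ} (a : S.carrier) (b : T.carrier) (_ : g + h = k) :
    obj S g → obj T h → obj (S.merge T a b) k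
  contr {S : MultCyc.{u}} {g : ℕ} (a b : S.carrier) (_ : a ≠ b) :
    obj S g → obj (S.cut a b) (g + 1)
  contr_symm {S : MultCyc.{u}} {g : ℕ} (a b : S.carrier) (hab : a ≠ b) (x : obj S g)
    (θ : MultCyc.Iso (S.cut b a) (S.cut a b))
    (_ : ∀ α, θ.onArc (S.cutArc b a α) = S.cutArc a b α) :
    map θ (contr b a hab.symm x) = contr a b hab x
  comp_symm {S T : MultCyc.{u}} {g h k : ℕ} (a : S.carrier) (b : T.carrier) (hk : g + h = k)
    (hk' : h + g = k) (x : obj S g) (y : obj T h)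
    (θ : MultCyc.Iso (T.merge S b a) (S.merge T a b))
    (_ : ∀ α, θ.onArc (T.mergeArcRight S b a α) = S.mergeArcLeft T a b α)
    (_ : ∀ α, θ.onArc (T.mergeArcLeft S b a α) = S.mergeArcRight T a b α) :
    map θ (comp b a hk' y x) = comp a b hk x y
  comp_assoc {S₁ S₂ S₃ : MultCyc.{u}} {g₁ g₂ g₃ g₁₂ g₂₃ g : ℕ}
    (h₁₂ : g₁ + g₂ = g₁₂) (h₂₃ : g₂ + g₃ = g₂₃) (hl : g₁ + g₂₃ = g) (hr : g₁₂ + g₃ = g)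
    (a : S₁.carrier) (b c : S₂.carrier) (d : S₃.carrier)
    (hbc : b ≠ c) (x : obj S₁ g₁) (y : obj S₂ g₂) (z : obj S₃ g₃)
    (θ : MultCyc.Iso (S₁.merge (S₂.merge S₃ c d) a (Graft.left b hbc))
      ((S₁.merge S₂ a b).merge S₃ (Graft.right c hbc.symm) d))
    (_ : ∀ α, θ.onArc (S₁.mergeArcLeft (S₂.merge S₃ c d) a (Graft.left b hbc) α) =
      (S₁.merge S₂ a b).mergeArcLeft S₃ (Graft.right c hbc.symm) d (S₁.mergeArcLeft S₂ a b α))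
    (_ : ∀ α, θ.onArc (S₁.mergeArcRight (S₂.merge S₃ c d) a (Graft.left b hbc)
        (S₂.mergeArcLeft S₃ c d α)) =
      (S₁.merge S₂ a b).mergeArcLeft S₃ (Graft.right c hbc.symm) d (S₁.mergeArcRight S₂ a b α))
    (_ : ∀ α, θ.onArc (S₁.mergeArcRight (S₂.merge S₃ c d) a (Graft.left b hbc)
        (S₂.mergeArcRight S₃ c d α)) =
      (S₁.merge S₂ a b).mergeArcRight S₃ (Graft.right c hbc.symm) d α) :
    map θ (comp a (Graft.left b hbc) hl x (comp c d h₂₃ y z)) =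
      comp (Graft.right c hbc.symm) d hr (comp a b h₁₂ x y) z
  contr_contr {S : MultCyc.{u}} {g : ℕ} (a b c d : S.carrier) (hab : a ≠ b) (hac : a ≠ c)
    (had : a ≠ d) (hbc : b ≠ c) (hbd : b ≠ d) (hcd : c ≠ d) (x : obj S g)
    (θ : MultCyc.Iso ((S.cut c d).cut ⟨a, hac, had⟩ ⟨b, hbc, hbd⟩)
      ((S.cut a b).cut ⟨c, hac.symm, hbc.symm⟩ ⟨d, had.symm, hbd.symm⟩))
    (_ : ∀ α, θ.onArc ((S.cut c d).cutArc ⟨a, hac, had⟩ ⟨b, hbc, hbd⟩ (S.cutArc c d α)) =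
      (S.cut a b).cutArc ⟨c, hac.symm, hbc.symm⟩ ⟨d, had.symm, hbd.symm⟩ (S.cutArc a b α)) :
    map θ (contr (⟨a, hac, had⟩ : Without c d) (⟨b, hbc, hbd⟩ : Without c d)
        (fun h => hab (congrArg Subtype.val h))
        (contr c d hcd x)) =
      contr (⟨c, hac.symm, hbc.symm⟩ : Without a b) (⟨d, had.symm, hbd.symm⟩ : Without a b)
        (fun h => hcd (congrArg Subtype.val h)) (contr a b hab x)
  contr_comp {S T : MultCyc.{u}} {g h k : ℕ} (hk : g + h = k) (a c : S.carrier) (b d : T.carrier)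
    (hac : a ≠ c) (hbd : b ≠ d) (x : obj S g) (y : obj T h)
    (θ : MultCyc.Iso ((S.merge T c d).cut (Graft.left a hac) (Graft.right b hbd))
      ((S.merge T a b).cut (Graft.left c hac.symm) (Graft.right d hbd.symm)))
    (_ : ∀ α, θ.onArc ((S.merge T c d).cutArc (Graft.left a hac) (Graft.right b hbd)
        (S.mergeArcLeft T c d α)) =
      (S.merge T a b).cutArc (Graft.left c hac.symm) (Graft.right d hbd.symm)
        (S.mergeArcLeft T a b α))
    (_ : ∀ α, θ.onArc ((S.merge T c d).cutArc (Graft.left a hac) (Graft.right b hbd)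
        (S.mergeArcRight T c d α)) =
      (S.merge T a b).cutArc (Graft.left c hac.symm) (Graft.right d hbd.symm)
        (S.mergeArcRight T a b α)) :
    map θ (contr (Graft.left a hac) (Graft.right b hbd)
        (fun h => Sum.inl_ne_inr (congrArg Subtype.val h)) (comp c d hk x y)) =
      contr (Graft.left c hac.symm) (Graft.right d hbd.symm)
        (fun h => Sum.inl_ne_inr (congrArg Subtype.val h)) (comp a b hk x y)
  comp_contr {S T : MultCyc.{u}} {g h k : ℕ} (hk : g + h = k) (hk' : g + 1 + h = k + 1)
    (a c d : S.carrier) (b : T.carrier) (hac : a ≠ c) (had : a ≠ d) (hcd : c ≠ d)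
    (x : obj S g) (y : obj T h)
    (θ : MultCyc.Iso ((S.cut c d).merge T ⟨a, hac, had⟩ b)
      ((S.merge T a b).cut (Graft.left c hac.symm) (Graft.left d had.symm)))
    (_ : ∀ α, θ.onArc ((S.cut c d).mergeArcLeft T ⟨a, hac, had⟩ b (S.cutArc c d α)) =
      (S.merge T a b).cutArc (Graft.left c hac.symm) (Graft.left d had.symm)
        (S.mergeArcLeft T a b α))
    (_ : ∀ α, θ.onArc ((S.cut c d).mergeArcRight T ⟨a, hac, had⟩ b α) =
      (S.merge T a b).cutArc (Graft.left c hac.symm) (Graft.left d had.symm)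
        (S.mergeArcRight T a b α)) :
    map θ (comp (⟨a, hac, had⟩ : Without c d) b hk' (contr c d hcd x) y) =
      contr (Graft.left c hac.symm) (Graft.left d had.symm)
        (fun h => hcd (Sum.inl_injective (congrArg Subtype.val h))) (comp a b hk x y)
  map_comp {S T S' T' : MultCyc.{u}} {g h k : ℕ} (hk : g + h = k)
    (ρ : MultCyc.Iso S S') (τ : MultCyc.Iso T T') (a : S.carrier) (b : T.carrier)
    (x : obj S g) (y : obj T h)
    (θ : MultCyc.Iso (S.merge T a b) (S'.merge T' (ρ.toEquiv a) (τ.toEquiv b)))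
    (_ : ∀ α, θ.onArc (S.mergeArcLeft T a b α) =
      S'.mergeArcLeft T' (ρ.toEquiv a) (τ.toEquiv b) (ρ.onArc α))
    (_ : ∀ α, θ.onArc (S.mergeArcRight T a b α) =
      S'.mergeArcRight T' (ρ.toEquiv a) (τ.toEquiv b) (τ.onArc α)) :
    map θ (comp a b hk x y) = comp (ρ.toEquiv a) (τ.toEquiv b) hk (map ρ x) (map τ y)
  map_contr {S S' : MultCyc.{u}} {g : ℕ} (ρ : MultCyc.Iso S S') (a b : S.carrier) (hab : a ≠ b)
    (x : obj S g) (θ : MultCyc.Iso (S.cut a b) (S'.cut (ρ.toEquiv a) (ρ.toEquiv b)))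
    (_ : ∀ α, θ.onArc (S.cutArc a b α) = S'.cutArc (ρ.toEquiv a) (ρ.toEquiv b) (ρ.onArc α)) :
    map θ (contr a b hab x) =
      contr (ρ.toEquiv a) (ρ.toEquiv b) (ρ.toEquiv.injective.ne hab) (map ρ x)

namespace NsModularOperad

/-- A morphism of non-symmetric modular operads. -/
@[ext]
structure Hom (P Q : NsModularOperad.{u, v}) where
  app (S : MultCyc.{u}) (g : ℕ) : P.obj S g → Q.obj S g
  app_map {S T : MultCyc.{u}} {g : ℕ} (ρ : MultCyc.Iso S T) (x : P.obj S g) :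
    app T g (P.map ρ x) = Q.map ρ (app S g x)
  app_comp {S T : MultCyc.{u}} {g h k : ℕ} (a : S.carrier) (b : T.carrier) (hk : g + h = k)
    (x : P.obj S g) (y : P.obj T h) :
    app _ k (P.comp a b hk x y) = Q.comp a b hk (app S g x) (app T h y)
  app_contr {S : MultCyc.{u}} {g : ℕ} (a b : S.carrier) (hab : a ≠ b) (x : P.obj S g) :
    app _ _ (P.contr a b hab x) = Q.contr a b hab (app S g x)

instance : Category NsModularOperad.{u, v} where
  Hom := Hom
  id P :=
    { app := fun _ _ x => x
      app_map := fun _ _ => rfl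
      app_comp := fun _ _ _ _ _ => rfl
      app_contr := fun _ _ _ _ => rfl }
  comp F G :=
    { app := fun S g x => G.app S g (F.app S g x)
      app_map := fun ρ x => by rw [F.app_map, G.app_map]
      app_comp := fun a b hk x y => by rw [F.app_comp, G.app_comp]
      app_contr := fun a b hab x => by rw [F.app_contr, G.app_contr] }

/-- The non-symmetric modular operad whose component at `(S, g)` is a one-point set if `(S, g)` is
geometric, and empty otherwise. -/
def point : NsModularOperad.{u, v} where
  obj S g := {_x : PUnit.{v + 1} // S.Geometric g}
  geometric x := x.2
  map ρ x := ⟨x.1, x.2.iso ρ⟩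
  map_refl _ := rfl
  map_trans _ _ _ := rfl
  comp a b hk x y := ⟨PUnit.unit, x.2.merge y.2 hk a b⟩
  contr _ _ hab x := ⟨PUnit.unit, x.2.cut hab⟩
  contr_symm _ _ _ _ _ _ := rfl
  comp_symm _ _ _ _ _ _ _ _ _ := rfl
  comp_assoc _ _ _ _ _ _ _ _ _ _ _ _ _ _ _ _ := rfl
  contr_contr _ _ _ _ _ _ _ _ _ _ _ _ _ := rfl
  contr_comp _ _ _ _ _ _ _ _ _ _ _ _ := rfl
  comp_contr _ _ _ _ _ _ _ _ _ _ _ _ _ _ := rfl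
  map_comp _ _ _ _ _ _ _ _ _ _ := rfl
  map_contr _ _ _ _ _ _ _ := rfl

/-- The components of a non-symmetric modular operad of genus zero at cyclically ordered sets, a
non-symmetric cyclic operad. -/
def genusZero (P : NsModularOperad.{u, v}) : NsCyclicOperad.{u, v} where
  obj C := P.obj C.1 0
  map ρ := P.map ρ
  map_refl := P.map_refl
  map_trans := P.map_trans
  comp a b := P.comp a b (zero_add 0)
  comp_symm a b := P.comp_symm a b _ _
  comp_assoc := P.comp_assoc _ _ _ _
  map_comp := P.map_comp _

/-- The forgetful functor from non-symmetric modular operads to non-symmetric cyclic operads. -/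
def forget : NsModularOperad.{u, v} ⥤ NsCyclicOperad.{u, v} where
  obj := genusZero
  map F :=
    { app := fun C => F.app C.1 0
      app_map := F.app_map
      app_comp := fun a b => F.app_comp a b _ }

/-- An internal operad in the (geometric) non-symmetric modular operad `P`, consisting of elements
of the components at all geometric pairs. -/
structure IsInternal (P : NsModularOperad.{u, v})
    (ϖ : ∀ (S : MultCyc.{u}) (g : ℕ), S.Geometric g → P.obj S g) : Prop where
  map {S T : MultCyc.{u}} {g : ℕ} (ρ : MultCyc.Iso S T) (hS : S.Geometric g)
    (hT : T.Geometric g) : P.map ρ (ϖ S g hS) = ϖ T g hT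
  comp {S T : MultCyc.{u}} {g h k : ℕ} (a : S.carrier) (b : T.carrier) (hk : g + h = k)
    (hS : S.Geometric g) (hT : T.Geometric h) (hST : (S.merge T a b).Geometric k) :
    P.comp a b hk (ϖ S g hS) (ϖ T h hT) = ϖ (S.merge T a b) k hST
  contr {S : MultCyc.{u}} {g : ℕ} (a b : S.carrier) (hab : a ≠ b) (hS : S.Geometric g)
    (hS' : (S.cut a b).Geometric (g + 1)) :
    P.contr a b hab (ϖ S g hS) = ϖ (S.cut a b) (g + 1) hS'

end NsModularOperad

/-! ### Envelopes -/

/-- `E` is the value at `X` of the left adjoint of `U`: there is a universal morphism from `X` to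
`U`, with target `U.obj E`. -/
def IsEnvelope {D : Type*} [Category D] {C : Type*} [Category C] (U : D ⥤ C) (X : C) (E : D) :
    Prop :=
  ∃ η : X ⟶ U.obj E, ∀ (P : D) (f : X ⟶ U.obj P), ∃! F : E ⟶ P, η ≫ U.map F = f

/-!
An internal operad is determined by its part of genus zero, because every component of positive
genus is reached from a lower genus by a contraction. For the existence one has to show that this
recursion does not depend on the contraction that is used.

In the symmetric case any two presentations of `(S, g + 1)` as a contraction differ by a bijection
of the uncontracted sets. In the non-`Σ` case a presentation is governed, up to isomorphism, by
the two arcs from which the contracted points are removed. By induction on the genus, two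
presentations with the same pair of arcs yield the same element; and the pair of arcs can be moved
by interchanging two contractions, or in genus zero a contraction and a composition, until any two
presentations have a pair in common.
-/

/-! ### Bijections between complements and grafts -/

/-- The restriction of a bijection to complements of two elements. -/
def withoutCongr {S T : Type*} (ρ : S ≃ T) (a b : S) : Without a b ≃ Without (ρ a) (ρ b) :=
  ρ.subtypeEquiv fun x => by simp

/-- The bijection of grafts induced by bijections of the two sets. -/
def graftCongr {S T S' T' : Type*} (ρ : S ≃ S') (τ : T ≃ T') (a : S) (b : T) :
    Graft a b ≃ Graft (ρ a) (τ b) :=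
  withoutCongr (Equiv.sumCongr ρ τ) (Sum.inl a) (Sum.inr b)

theorem graftCongr_val {S T S' T' : Type*} (ρ : S ≃ S') (τ : T ≃ T') (a : S) (b : T)
    (x : Graft a b) : (graftCongr ρ τ a b x).1 = Sum.map ρ τ x.1 := by
  rcases x with ⟨x | x, h⟩ <;> rfl

/-- Interchanging the two sets that are grafted. -/
def graftSwap {S T : Type*} (a : S) (b : T) : Graft b a ≃ Graft a b :=
  (Equiv.sumComm T S).subtypeEquiv fun x => by
    rcases x with x | x <;> simp [and_comm]

theorem graftSwap_val {S T : Type*} (a : S) (b : T) (x : Graft b a) :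
    (graftSwap a b x).1 = x.1.swap := rfl

/-- Removal of `c` and `d` before the grafting at `a`, or after it. -/
def graftWithout {S T : Type*} (a c d : S) (b : T) (hac : a ≠ c) (had : a ≠ d) :
    Graft (⟨a, hac, had⟩ : Without c d) b ≃
      Without (Graft.left c hac.symm : Graft a b) (Graft.left d had.symm) where
  toFun z := ⟨⟨Sum.map Subtype.val id z.1, by
      rcases z with ⟨⟨x, hx⟩ | y, hz⟩
      · simpa [Subtype.ext_iff] using hz
      · simpa using hz⟩, by
      rcases z with ⟨⟨x, hx⟩ | y, hz⟩
      · simpa [Graft.left, Subtype.ext_iff] using hx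
      · simp [Graft.left, Subtype.ext_iff]⟩
  invFun z := match z with
    | ⟨⟨Sum.inl x, h⟩, h'⟩ => ⟨Sum.inl ⟨x, by
        simpa [Graft.left, Subtype.ext_iff] using h'⟩, by
        simpa [Subtype.ext_iff] using h⟩
    | ⟨⟨Sum.inr y, h⟩, _⟩ => ⟨Sum.inr y, by simpa using h⟩
  left_inv z := by rcases z with ⟨⟨x, hx⟩ | y, hz⟩ <;> rfl
  right_inv z := by rcases z with ⟨⟨x | y, h⟩, h'⟩ <;> rfl

theorem graftWithout_val {S T : Type*} (a c d : S) (b : T) (hac : a ≠ c) (had : a ≠ d)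
    (z : Graft (⟨a, hac, had⟩ : Without c d) b) :
    (graftWithout a c d b hac had z).1.1 = Sum.map Subtype.val id z.1 := rfl

/-- Removal of two elements that have been added to a set. -/
def withoutOption (S : Type*) : Without (none : Option (Option S)) (some none) ≃ S where
  toFun x := match x with
    | ⟨none, h⟩ => (h.1 rfl).elim
    | ⟨some none, h⟩ => (h.2 rfl).elim
    | ⟨some (some x), _⟩ => x
  invFun x := ⟨some (some x), by simp, by simp⟩
  left_inv := by
    rintro ⟨_ | _ | x, h⟩
    · exact (h.1 rfl).elim
    · exact (h.2 rfl).elim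
    · rfl
  right_inv x := rfl

/-- Addition of two elements that have been removed from a set. -/
noncomputable def optionWithout {S : Type*} {a b : S} (hab : a ≠ b) :
    Option (Option (Without a b)) ≃ S :=
  Equiv.ofBijective (fun | none => a | some none => b | some (some x) => x.1) <| by
    constructor
    · rintro (_ | _ | ⟨x, hxa, hxb⟩) (_ | _ | ⟨y, hya, hyb⟩) h <;> grind
    · intro x
      by_cases hxa : x = a
      · exact ⟨none, hxa.symm⟩
      by_cases hxb : x = b
      · exact ⟨some none, hxb.symm⟩
      exact ⟨some (some ⟨x, hxa, hxb⟩), rfl⟩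

theorem exists_equiv_extending {S T : Type*} {a b : S} {a' b' : T} (hab : a ≠ b) (hab' : a' ≠ b')
    (e : Without a b ≃ Without a' b') :
    ∃ ρ : S ≃ T, ρ a = a' ∧ ρ b = b' ∧ ∀ x : Without a b, ρ x.1 = (e x).1 := by
  let ρ := (optionWithout hab).symm.trans (e.optionCongr.optionCongr.trans (optionWithout hab'))
  have hρ : ∀ x, ρ (optionWithout hab x) = optionWithout hab' (x.map e.optionCongr) := by
    simp [ρ, Equiv.optionCongr_apply]
  exact ⟨ρ, hρ none, hρ (some none), fun x => hρ (some (some x))⟩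

/-! ### Envelopes and left adjoints -/

theorem IsEnvelope.nonempty_iso {D : Type*} [Category D] {C : Type*} [Category C] {U : D ⥤ C}
    {X : C} {E : D} (hE : IsEnvelope U X E) (F : C ⥤ D) (adj : F ⊣ U) :
    Nonempty (F.obj X ≅ E) := by
  obtain ⟨η, hη⟩ := hE
  obtain ⟨f, hf, -⟩ := hη (F.obj X) (adj.unit.app X)
  let g : F.obj X ⟶ E := (adj.homEquiv X E).symm η
  have hg : adj.unit.app X ≫ U.map g = η := by
    rw [← adj.homEquiv_unit X E g, Equiv.apply_symm_apply]
  refine ⟨⟨g, f, ?_, ?_⟩⟩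
  · apply (adj.homEquiv X _).injective
    rw [adj.homEquiv_unit, adj.homEquiv_unit, U.map_comp, ← Category.assoc, hg, hf]
    simp
  · refine (hη E η).unique ?_ ?_
    · simp only [Functor.map_comp]
      rw [← Category.assoc, hf, hg]
    · simp

/-! ### The symmetric case -/

namespace CyclicOperad

variable {P : CyclicOperad.{u, v}}

theorem nonempty_isTerminal_point : Nonempty (Limits.IsTerminal point.{u, v}) :=
  ⟨Limits.IsTerminal.ofUniqueHom
    (fun _ => Hom.mk (fun _ _ _ => PUnit.unit) (fun _ _ => rfl) (fun _ _ _ _ => rfl))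
    fun _ _ => rfl⟩

theorem isInternal_of_hom (f : point ⟶ P) : P.IsInternal fun S _ => Hom.app f S PUnit.unit where
  map ρ := (Hom.app_map f ρ PUnit.unit).symm
  comp a b := (Hom.app_comp f a b PUnit.unit PUnit.unit).symm

end CyclicOperad

namespace ModularOperad

variable {P : ModularOperad.{u, v}}

theorem nonempty_isTerminal_point : Nonempty (Limits.IsTerminal point.{u, v}) :=
  ⟨Limits.IsTerminal.ofUniqueHom
    (fun _ => Hom.mk (fun _ _ _ _ => PUnit.unit) (fun _ _ => rfl) (fun _ _ _ _ _ => rfl)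
      fun _ _ _ _ => rfl)
    fun _ _ => rfl⟩

theorem isInternal_of_hom (F : point ⟶ P) :
    P.IsInternal fun S _ g => Hom.app F S g PUnit.unit where
  map ρ := (Hom.app_map F ρ PUnit.unit).symm
  comp a b hk := (Hom.app_comp F a b hk PUnit.unit PUnit.unit).symm
  contr a b hab := (Hom.app_contr F a b hab PUnit.unit).symm

/-- The morphism from the one-point operad that corresponds to an internal operad. -/
def IsInternal.hom {ϖ : ∀ (S : Type u) [Finite S] (g : ℕ), P.obj S g} (hϖ : P.IsInternal ϖ) :
    point ⟶ P :=
  Hom.mk (fun S _ g _ => ϖ S g) (fun ρ _ => (hϖ.map ρ).symm)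
    (fun a b hk _ _ => (hϖ.comp a b hk).symm) (fun a b hab _ => (hϖ.contr a b hab).symm)

theorem map_contr_eq_map_contr {g : ℕ} {ω : ∀ (S : Type u) [Finite S], P.obj S g}
    (hω : ∀ {S T : Type u} [Finite S] [Finite T] (ρ : S ≃ T), P.map ρ (ω S) = ω T)
    {S S' R : Type u} [Finite S] [Finite S'] [Finite R] {a b : S} {a' b' : S'} (hab : a ≠ b)
    (hab' : a' ≠ b') (e : Without a b ≃ R) (e' : Without a' b' ≃ R) :
    P.map e (P.contr a b hab (ω S)) = P.map e' (P.contr a' b' hab' (ω S')) := by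
  obtain ⟨ρ, rfl, rfl, hρ⟩ := exists_equiv_extending hab hab' (e.trans e'.symm)
  rw [← hω ρ, ← P.map_contr ρ a b hab _ (e.trans e'.symm) fun z => (hρ z).symm, ← P.map_trans]
  congr 1
  ext x
  simp

/-- The family `ω` is closed under compositions of its members of genera `g` and `h`. -/
def CompClosedAt (ω : ∀ (g : ℕ) (S : Type u) [Finite S], P.obj S g) (g h : ℕ) : Prop :=
  ∀ (S T : Type u) [Finite S] [Finite T] (k : ℕ) (a : S) (b : T) (hk : g + h = k),
    P.comp a b hk (ω g S) (ω h T) = ω k (Graft a b)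

section

variable {ω : ∀ (g : ℕ) (S : Type u) [Finite S], P.obj S g}
  (hmap : ∀ {g : ℕ} {S T : Type u} [Finite S] [Finite T] (ρ : S ≃ T), P.map ρ (ω g S) = ω g T)
  (hcontr : ∀ {g : ℕ} {S : Type u} [Finite S] {a b : S} (hab : a ≠ b),
    P.contr a b hab (ω g S) = ω (g + 1) (Without a b))

include hmap

theorem CompClosedAt.symm {g h : ℕ} (H : CompClosedAt ω g h) : CompClosedAt ω h g := by
  intro S T _ _ k a b hk
  have hk' := (add_comm _ _).trans hk
  rw [← P.comp_symm a b hk hk' _ _ (graftSwap a b) (graftSwap_val a b), H, hmap]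

include hcontr

theorem CompClosedAt.succ_left {g h : ℕ} (H : CompClosedAt ω g h) : CompClosedAt ω (g + 1) h := by
  have comp_without {S T : Type u} [Finite S] [Finite T] (c d : S) (hcd : c ≠ d) {k : ℕ}
      (a : Without c d) (b : T) (hk : g + 1 + h = k) :
      P.comp a b hk (ω (g + 1) (Without c d)) (ω h T) = ω k (Graft a b) := by
    obtain ⟨a, hac, had⟩ := a
    obtain rfl : k = (g + h) + 1 := by omega
    rw [← hcontr hcd, ← hmap (graftWithout a c d b hac had).symm,
      ← hcontr (show Graft.left (a := a) (b := b) c hac.symm ≠ Graft.left d had.symm by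
        simpa [Graft.left] using hcd), ← H S T _ a b rfl,
      ← P.comp_contr rfl hk a c d b hac had hcd _ _ (graftWithout a c d b hac had)
        (graftWithout_val a c d b hac had), ← P.map_trans, Equiv.self_trans_symm, P.map_refl]
  intro S T _ _ k a b hk
  obtain ⟨a, rfl⟩ := (withoutOption S).surjective a
  have hcomp := P.map_comp hk (withoutOption S) (Equiv.refl T) a b (ω (g + 1) _) (ω h T)
    (graftCongr (withoutOption S) (Equiv.refl T) a b) (graftCongr_val _ _ _ _)
  rw [comp_without _ _ (by simp) a, hmap, hmap, P.map_refl] at hcomp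
  exact hcomp.symm

theorem CompClosedAt.of_zero (H : CompClosedAt ω 0 0) (g h : ℕ) : CompClosedAt ω g h := by
  have left (h : ℕ) (H : CompClosedAt ω 0 h) (g : ℕ) : CompClosedAt ω g h := by
    induction g with
    | zero => exact H
    | succ g ih => exact ih.succ_left hmap hcontr
  exact left h ((left 0 H h).symm hmap) g

end

variable (P)

/-- The extension of a family of elements of genus zero to all genera by contractions. -/
def extend (ς : ∀ (S : Type u) [Finite S], P.obj S 0) : ∀ (g : ℕ) (S : Type u) [Finite S], P.obj S g
  | 0, S, _ => ς S
  | g + 1, S, _ => P.map (withoutOption S)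
      (P.contr none (some none) (by simp) (extend ς g (Option (Option S))))

variable {P}

section

variable {ς : ∀ (S : Type u) [Finite S], P.obj S 0} (hς : (forget.obj P).IsInternal ς)
include hς

theorem extend_map {g : ℕ} {S T : Type u} [Finite S] [Finite T] (ρ : S ≃ T) :
    P.map ρ (P.extend ς g S) = P.extend ς g T := by
  induction g generalizing S T with
  | zero => exact hς.map ρ
  | succ g ih =>
    rw [extend, extend, ← P.map_trans]
    exact map_contr_eq_map_contr ih _ _ _ _

theorem extend_contr {g : ℕ} {S : Type u} [Finite S] {a b : S} (hab : a ≠ b) :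
    P.contr a b hab (P.extend ς g S) = P.extend ς (g + 1) (Without a b) := by
  rw [extend, ← P.map_refl (P.contr a b hab _)]
  exact map_contr_eq_map_contr (extend_map hς) _ _ _ _

theorem isInternal_extend : P.IsInternal fun S _ g => P.extend ς g S where
  map := extend_map hς
  comp := by
    refine CompClosedAt.of_zero (extend_map hς) (extend_contr hς)
      (fun S T _ _ k a b hk => ?_) _ _ _ _ _
    obtain rfl := hk
    exact hς.comp a b
  contr _ _ := extend_contr hς

end

theorem IsInternal.eq_extend {ϖ : ∀ (S : Type u) [Finite S] (g : ℕ), P.obj S g}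
    (hϖ : P.IsInternal ϖ) (S : Type u) [Finite S] (g : ℕ) :
    ϖ S g = P.extend (fun S _ => ϖ S 0) g S := by
  induction g generalizing S with
  | zero => rfl
  | succ g ih => rw [extend, ← ih, hϖ.contr, hϖ.map]

theorem existsUnique_isInternal (P : ModularOperad.{u, v})
    (ς : ∀ (S : Type u) [Finite S], P.obj S 0) (hς : (forget.obj P).IsInternal ς) :
    ∃! ϖ : ∀ (S : Type u) [Finite S] (g : ℕ), P.obj S g,
      P.IsInternal ϖ ∧ ∀ (S : Type u) [Finite S], ϖ S 0 = ς S := by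
  refine ⟨fun S _ g => P.extend ς g S, ⟨isInternal_extend hς, fun _ _ => rfl⟩, ?_⟩
  rintro ϖ ⟨hϖ, hzero⟩
  obtain rfl : (fun S [Finite S] => ϖ S 0) = ς := by
    funext S _
    exact hzero S
  funext S _ g
  exact hϖ.eq_extend S g

theorem isEnvelope_point : IsEnvelope forget.{u, v} CyclicOperad.point point := by
  refine ⟨CyclicOperad.Hom.mk (fun _ _ x => x) (fun _ _ => rfl) (fun _ _ _ _ => rfl),
    fun P f => ?_⟩
  obtain ⟨ϖ, ⟨hϖ, hzero⟩, unique⟩ :=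
    P.existsUnique_isInternal _ (CyclicOperad.isInternal_of_hom f)
  refine ⟨hϖ.hom, CyclicOperad.Hom.ext (funext fun S => funext fun _ => funext fun _ => hzero S),
    ?_⟩
  rintro F rfl
  obtain rfl := unique _ ⟨isInternal_of_hom F, fun _ _ => rfl⟩
  rfl

end ModularOperad

namespace GluePerm

variable {α : Type*}

theorem glue_inv_left (σ : Equiv.Perm α) (u v : α) : (glue σ u v)⁻¹ u = σ⁻¹ v := by
  rw [Equiv.Perm.inv_eq_iff_eq, glue_apply_right σ (by simp)]

theorem glue_inv_right (σ : Equiv.Perm α) (u v : α) : (glue σ u v)⁻¹ v = σ⁻¹ u := by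
  rw [Equiv.Perm.inv_eq_iff_eq, glue_apply_left σ (by simp)]

theorem glue_inv_of_ne (σ : Equiv.Perm α) {u v x : α} (hu : x ≠ u) (hv : x ≠ v) :
    (glue σ u v)⁻¹ x = σ⁻¹ x := by
  rw [Equiv.Perm.inv_eq_iff_eq, glue_apply_of_ne σ (by simpa) (by simpa)]
  simp

theorem apply_skip_inv {Z : Type*} (c : α → Z) (φ : Equiv.Perm α) {w x : α}
    (hc : c w = c (φ⁻¹ w)) (hx : x ≠ w) : c ((skip φ w)⁻¹ x) = c (φ⁻¹ x) := by
  obtain ⟨y, rfl⟩ := (skip φ w).surjective x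
  rw [Equiv.Perm.inv_eq_iff_eq.2 rfl]
  have hy : y ≠ w := by
    rintro rfl
    exact hx (skip_self φ y)
  by_cases hyw : φ y = w
  · rw [skip_of_eq φ hyw, Equiv.Perm.inv_eq_iff_eq.2 rfl, hc, ← hyw, Equiv.Perm.inv_eq_iff_eq.2 rfl]
  · rw [skip_of_ne φ hyw hy, Equiv.Perm.inv_eq_iff_eq.2 rfl]

theorem apply_firstReturn_inv {Z : Type*} (c : α → Z) (φ : Equiv.Perm α) {u v : α}
    (hu : c u = c (φ⁻¹ u)) (hv : c v = c (φ⁻¹ v)) (x : {x : α // x ≠ u ∧ x ≠ v}) :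
    c ((firstReturn φ u v)⁻¹ x).1 = c (φ⁻¹ x.1) := by
  have hskip : c v = c ((skip φ u)⁻¹ v) := by
    by_cases h : v = u
    · rw [h, Equiv.Perm.inv_eq_iff_eq.2 (skip_self φ u).symm]
    · rw [apply_skip_inv c φ hu h, hv]
  exact (apply_skip_inv c _ hskip x.2.2).trans (apply_skip_inv c φ hu x.2.1)

theorem sameCycle_of_semiconj {β : Type*} [Finite α] {σ : Equiv.Perm α} {τ : Equiv.Perm β}
    {f : α → β} (hf : Function.Semiconj f σ τ) {x y : α} (h : σ.SameCycle x y) :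
    τ.SameCycle (f x) (f y) := by
  obtain ⟨n, rfl⟩ := h.exists_nat_pow_eq
  refine ⟨n, ?_⟩
  rw [zpow_natCast, ← Equiv.Perm.iterate_eq_pow, ← Equiv.Perm.iterate_eq_pow]
  exact ((hf.iterate_right n).eq x).symm

end GluePerm

theorem exists_equiv_of_kernel {A B C : Type*} {f : A → B} {g : A → C}
    (hf : Function.Surjective f) (hg : Function.Surjective g)
    (h : ∀ a b, f a = f b ↔ g a = g b) : ∃ e : B ≃ C, ∀ a, e (f a) = g a := by
  have hF : ∀ a, g (Function.surjInv hf (f a)) = g a := fun a =>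
    (h _ _).1 (Function.surjInv_eq hf (f a))
  refine ⟨Equiv.ofBijective (g ∘ Function.surjInv hf)
    ⟨fun b c hbc => ?_, fun c => (hg c).imp' f fun a ha => (hF a).trans ha⟩, hF⟩
  rw [← Function.surjInv_eq hf b, ← Function.surjInv_eq hf c]
  exact (h _ _).2 hbc

namespace MultCyc

variable {S T : MultCyc.{u}}

/-! ### Arcs -/

/-- The arc that ends at `x`. -/
def endArc (S : MultCyc.{u}) (x : S.carrier) : S.Arc := Sum.inl (S.next⁻¹ x)

/-- The part to which an arc belongs. -/
def arcPart (S : MultCyc.{u}) : S.Arc → S.index := Sum.elim S.part Subtype.val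

theorem arcPart_inl (x : S.carrier) : S.arcPart (Sum.inl x) = S.part x := rfl

theorem arcPart_inr (i : S.EmptyPart) : S.arcPart (Sum.inr i) = i.1 := rfl

theorem endArc_next (x : S.carrier) : S.endArc (S.next x) = Sum.inl x :=
  congrArg Sum.inl (S.next.symm_apply_apply x)

theorem part_next (x : S.carrier) : S.part (S.next x) = S.part x :=
  (S.part_eq_iff _ _).2 (by simp [Equiv.Perm.SameCycle.refl])

theorem arcPart_endArc (x : S.carrier) : S.arcPart (S.endArc x) = S.part x := by
  rw [endArc, arcPart_inl, ← S.part_next]; simp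

theorem arcPart_surjective (S : MultCyc.{u}) : Function.Surjective S.arcPart := by
  intro i
  by_cases h : ∃ x, S.part x = i
  · exact h.imp' Sum.inl fun _ hx => hx
  · exact ⟨Sum.inr ⟨i, not_exists.1 h⟩, rfl⟩

theorem arcPart_eq_iff {α β : S.Arc} : S.arcPart α = S.arcPart β ↔
    α = β ∨ ∃ x y, α = Sum.inl x ∧ β = Sum.inl y ∧ S.next.SameCycle x y := by
  constructor
  · rcases α with x | i <;> rcases β with y | j <;> intro h
    · exact Or.inr ⟨x, y, rfl, rfl, (S.part_eq_iff x y).1 h⟩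
    · exact (j.2 x h).elim
    · exact (i.2 y h.symm).elim
    · exact Or.inl (congrArg Sum.inr (Subtype.ext h))
  · rintro (rfl | ⟨x, y, rfl, rfl, h⟩)
    · rfl
    · exact (S.part_eq_iff x y).2 h

theorem Iso.onArc_inl (ρ : Iso S T) (x : S.carrier) :
    ρ.onArc (Sum.inl x) = Sum.inl (ρ.toEquiv x) := rfl

theorem Iso.arcPart_onArc (ρ : Iso S T) (α : S.Arc) :
    T.arcPart (ρ.onArc α) = ρ.indexEquiv (S.arcPart α) := by
  rcases α with x | i
  · exact ρ.part_apply x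
  · rfl

theorem Iso.onArc_endArc (ρ : Iso S T) (x : S.carrier) :
    ρ.onArc (S.endArc x) = T.endArc (ρ.toEquiv x) := by
  obtain ⟨x, rfl⟩ := S.next.surjective x
  rw [endArc_next, onArc_inl, ← ρ.next_apply, endArc_next]

theorem Iso.onArc_refl (α : S.Arc) : (Iso.refl S).onArc α = α := by
  rcases α with x | i <;> rfl

theorem Iso.onArc_trans {R : MultCyc.{u}} (ρ : Iso S T) (τ : Iso T R) (α : S.Arc) :
    (ρ.trans τ).onArc α = τ.onArc (ρ.onArc α) := by
  rcases α with x | i <;> rfl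

/-- The inverse isomorphism. -/
def Iso.symm (ρ : Iso S T) : Iso T S where
  toEquiv := ρ.toEquiv.symm
  indexEquiv := ρ.indexEquiv.symm
  part_apply x := by rw [Equiv.eq_symm_apply, ← ρ.part_apply, Equiv.apply_symm_apply]
  next_apply x := by rw [Equiv.eq_symm_apply, ← ρ.next_apply, Equiv.apply_symm_apply]

theorem Iso.symm_onArc_onArc (ρ : Iso S T) (α : S.Arc) : ρ.symm.onArc (ρ.onArc α) = α := by
  rcases α with x | i
  · exact congrArg Sum.inl (ρ.toEquiv.symm_apply_apply x)
  · exact congrArg Sum.inr (Subtype.ext (ρ.indexEquiv.symm_apply_apply i.1))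

theorem Iso.onArc_symm_onArc (ρ : Iso S T) (α : T.Arc) : ρ.onArc (ρ.symm.onArc α) = α :=
  ρ.symm.symm_onArc_onArc α

theorem Iso.onArc_injective (ρ : Iso S T) : Function.Injective ρ.onArc :=
  Function.LeftInverse.injective ρ.symm_onArc_onArc

theorem Iso.onArc_surjective (ρ : Iso S T) : Function.Surjective ρ.onArc :=
  Function.RightInverse.surjective ρ.onArc_symm_onArc

theorem Iso.ext_onArc {ρ τ : Iso S T} (h : ∀ α, ρ.onArc α = τ.onArc α) : ρ = τ := by
  refine Iso.ext (Equiv.ext fun x => Sum.inl_injective (h (Sum.inl x))) (Equiv.ext fun i => ?_)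
  obtain ⟨α, rfl⟩ := S.arcPart_surjective i
  rw [← Iso.arcPart_onArc, ← Iso.arcPart_onArc, h]

theorem arcPart_apply_eq {e : S.carrier → T.carrier} (he : Function.Semiconj e S.next T.next)
    {f : S.Arc → T.Arc} (hf : ∀ x, f (Sum.inl x) = Sum.inl (e x)) {α β : S.Arc}
    (h : S.arcPart α = S.arcPart β) : T.arcPart (f α) = T.arcPart (f β) := by
  rcases arcPart_eq_iff.1 h with rfl | ⟨x, y, rfl, rfl, hxy⟩
  · rfl
  · exact arcPart_eq_iff.2 (Or.inr ⟨_, _, hf x, hf y, GluePerm.sameCycle_of_semiconj he hxy⟩)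

theorem exists_iso_of_arcEquiv (e : S.carrier ≃ T.carrier) (f : S.Arc ≃ T.Arc)
    (hstart : ∀ x, f (Sum.inl x) = Sum.inl (e x)) (hend : ∀ x, f (S.endArc x) = T.endArc (e x)) :
    ∃ θ : Iso S T, θ.toEquiv = e ∧ ∀ α, θ.onArc α = f α := by
  have hnext : Function.Semiconj e S.next T.next := fun x => by
    have h := hend (S.next x)
    rw [endArc_next, hstart] at h
    exact (Equiv.Perm.eq_inv_iff_eq.1 (Sum.inl_injective h)).symm
  have hstart' : ∀ y, f.symm (Sum.inl y) = Sum.inl (e.symm y) := fun y => by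
    rw [Equiv.symm_apply_eq, hstart, Equiv.apply_symm_apply]
  have hnext' : Function.Semiconj e.symm T.next S.next := fun y => by
    rw [Equiv.symm_apply_eq, hnext, Equiv.apply_symm_apply]
  obtain ⟨ι, hι⟩ := exists_equiv_of_kernel (S.arcPart_surjective)
    (T.arcPart_surjective.comp f.surjective) fun α β =>
      ⟨arcPart_apply_eq hnext hstart, fun h => by
        simpa using arcPart_apply_eq hnext' hstart' h⟩
  have hpart : ∀ x, T.part (e x) = ι (S.part x) := fun x => by
    rw [← arcPart_inl, ← hstart, ← arcPart_inl, hι]; rfl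
  refine ⟨⟨e, ι, hpart, fun x => (hnext x).symm⟩, rfl, ?_⟩
  rintro (x | i)
  · exact (hstart x).symm
  · rcases hi : f (Sum.inr i) with y | j
    · cases f.symm_apply_apply (Sum.inr i) ▸ hi ▸ hstart' y
    · exact congrArg Sum.inr (Subtype.ext ((hι (Sum.inr i)).trans (congrArg T.arcPart hi)))

theorem exists_iso_of_arc {A : Type*} {p : A → S.Arc} {q : A → T.Arc}
    (e : S.carrier ≃ T.carrier) (hp : Function.Surjective p) (hq : Function.Surjective q)
    (hf : ∃ f : S.Arc → T.Arc, ∀ a, f (p a) = q a) (hg : ∃ g : T.Arc → S.Arc, ∀ a, g (q a) = p a)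
    (hs : ∀ x, ∃ a, p a = Sum.inl x ∧ q a = Sum.inl (e x))
    (he : ∀ x, ∃ a, p a = S.endArc x ∧ q a = T.endArc (e x)) :
    ∃ θ : Iso S T, θ.toEquiv = e ∧ ∀ a, θ.onArc (p a) = q a := by
  obtain ⟨f, hf⟩ := hf
  obtain ⟨g, hg⟩ := hg
  obtain ⟨F, hF⟩ := exists_equiv_of_kernel hp hq fun a b =>
    ⟨fun h => by rw [← hf, h, hf], fun h => by rw [← hg, h, hg]⟩
  obtain ⟨θ, hθ, hθF⟩ := exists_iso_of_arcEquiv e F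
    (fun x => by obtain ⟨a, ha, ha'⟩ := hs x; rw [← ha, hF, ha'])
    (fun x => by obtain ⟨a, ha, ha'⟩ := he x; rw [← ha, hF, ha'])
  exact ⟨θ, hθ, fun a => (hθF _).trans (hF a)⟩

/-! ### The arcs of a cut -/

section cut

variable (S) (u v : S.carrier)

theorem arcPart_cutArc_inl (x : S.carrier) :
    (S.cut u v).arcPart (S.cutArc u v (Sum.inl x)) = Sum.inr (Quotient.mk _ x) := by
  classical
  simp only [cutArc]
  split_ifs with h
  · refine congrArg Sum.inr ((GluePerm.mk_eq_iff _ _ _).2 ?_)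
    exact (Equiv.Perm.sameCycle_inv.1 ⟨(Nat.find h : ℤ), by rw [zpow_natCast]⟩ :
      (GluePerm.glue S.next u v).SameCycle x _).symm
  · rfl

theorem arcPart_cutArc_inr (i : S.EmptyPart) :
    (S.cut u v).arcPart (S.cutArc u v (Sum.inr i)) = Sum.inl i := rfl

theorem arcPart_cutArc_inl_eq_iff (x y : S.carrier) :
    (S.cut u v).arcPart (S.cutArc u v (Sum.inl x)) =
      (S.cut u v).arcPart (S.cutArc u v (Sum.inl y)) ↔
      (GluePerm.glue S.next u v).SameCycle x y := by
  rw [arcPart_cutArc_inl, arcPart_cutArc_inl, ← GluePerm.mk_eq_iff]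
  exact Sum.inr_injective.eq_iff

theorem arcPart_cutArc_inl_ne_inr (x : S.carrier) (i : S.EmptyPart) :
    (S.cut u v).arcPart (S.cutArc u v (Sum.inl x)) ≠
      (S.cut u v).arcPart (S.cutArc u v (Sum.inr i)) := by
  rw [arcPart_cutArc_inl, arcPart_cutArc_inr]
  exact Sum.inr_ne_inl

theorem arcPart_cutArc_inr_injective {i j : S.EmptyPart}
    (h : (S.cut u v).arcPart (S.cutArc u v (Sum.inr i)) =
      (S.cut u v).arcPart (S.cutArc u v (Sum.inr j))) : i = j :=
  Sum.inl_injective h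

theorem cutArc_of_iterate {n : ℕ} {x : S.carrier}
    (hn : ((GluePerm.glue S.next u v)⁻¹ ^ n) x ≠ u ∧ ((GluePerm.glue S.next u v)⁻¹ ^ n) x ≠ v)
    (hlt : ∀ m < n, ((GluePerm.glue S.next u v)⁻¹ ^ m) x = u ∨
      ((GluePerm.glue S.next u v)⁻¹ ^ m) x = v) :
    S.cutArc u v (Sum.inl x) = Sum.inl ⟨((GluePerm.glue S.next u v)⁻¹ ^ n) x, hn⟩ := by
  classical
  have h : ∃ n : ℕ, ((GluePerm.glue S.next u v)⁻¹ ^ n) x ≠ u ∧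
      ((GluePerm.glue S.next u v)⁻¹ ^ n) x ≠ v := ⟨n, hn⟩
  have hfind : Nat.find h = n :=
    (Nat.find_eq_iff h).2 ⟨hn, fun m hm hm' => (hlt m hm).elim hm'.1 hm'.2⟩
  simp only [cutArc, dif_pos h]
  exact congrArg Sum.inl (Subtype.ext (by simp only [hfind]))

theorem cutArc_cases (x : S.carrier) :
    (∃ (n : ℕ) (hn : ((GluePerm.glue S.next u v)⁻¹ ^ n) x ≠ u ∧
        ((GluePerm.glue S.next u v)⁻¹ ^ n) x ≠ v),
      (∀ m < n, ((GluePerm.glue S.next u v)⁻¹ ^ m) x = u ∨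
        ((GluePerm.glue S.next u v)⁻¹ ^ m) x = v) ∧
      S.cutArc u v (Sum.inl x) = Sum.inl ⟨((GluePerm.glue S.next u v)⁻¹ ^ n) x, hn⟩) ∨
    ((∀ n : ℕ, ((GluePerm.glue S.next u v)⁻¹ ^ n) x = u ∨
        ((GluePerm.glue S.next u v)⁻¹ ^ n) x = v) ∧
      ∃ j, S.cutArc u v (Sum.inl x) = Sum.inr j) := by
  classical
  by_cases h : ∃ n : ℕ, ((GluePerm.glue S.next u v)⁻¹ ^ n) x ≠ u ∧
      ((GluePerm.glue S.next u v)⁻¹ ^ n) x ≠ v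
  · have hlt : ∀ m < Nat.find h, ((GluePerm.glue S.next u v)⁻¹ ^ m) x = u ∨
        ((GluePerm.glue S.next u v)⁻¹ ^ m) x = v := fun m hm => by
      have := Nat.find_min h hm
      tauto
    exact Or.inl ⟨Nat.find h, Nat.find_spec h, hlt, S.cutArc_of_iterate u v _ hlt⟩
  · refine Or.inr ⟨fun n => ?_, ?_⟩
    · by_contra hn
      exact h ⟨n, not_or.1 hn⟩
    · simp only [cutArc]
      exact ⟨_, dif_neg h⟩

theorem cutArc_of_ne (x : Without u v) : S.cutArc u v (Sum.inl x.1) = Sum.inl x :=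
  S.cutArc_of_iterate u v (n := 0) x.2 fun _ hm => (Nat.not_lt_zero _ hm).elim

theorem cutArc_glue_inv {x : S.carrier} (hx : x = u ∨ x = v) :
    S.cutArc u v (Sum.inl x) = S.cutArc u v (Sum.inl ((GluePerm.glue S.next u v)⁻¹ x)) := by
  set φ := GluePerm.glue S.next u v with hφ
  rcases S.cutArc_cases u v x with ⟨n, hn, hlt, h⟩ | ⟨-, j, h⟩
  · obtain _ | n := n
    · exact (hx.elim hn.1 hn.2).elim
    have hpow : ∀ m, (φ⁻¹ ^ (m + 1)) x = (φ⁻¹ ^ m) (φ⁻¹ x) := fun m => by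
      rw [pow_succ, Equiv.Perm.mul_apply]
    have h' := S.cutArc_of_iterate u v (x := φ⁻¹ x) (n := n) (by rwa [← hpow])
      fun m hm => by rw [← hpow]; exact hlt (m + 1) (by lia)
    rw [h, h']
    exact congrArg Sum.inl (Subtype.ext (hpow n))
  · have hpart := (S.arcPart_cutArc_inl_eq_iff u v x (φ⁻¹ x)).2 ⟨-1, by simp [hφ]⟩
    rcases arcPart_eq_iff.1 hpart with h' | ⟨y, -, hy, -⟩
    · exact h'
    · cases h.symm.trans hy

theorem cutArc_start_left : S.cutArc u v (Sum.inl u) = S.cutArc u v (S.endArc v) := by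
  rw [cutArc_glue_inv S u v (Or.inl rfl), GluePerm.glue_inv_left]; rfl

theorem cutArc_start_right : S.cutArc u v (Sum.inl v) = S.cutArc u v (S.endArc u) := by
  rw [cutArc_glue_inv S u v (Or.inr rfl), GluePerm.glue_inv_right]; rfl

theorem cutArc_surjective : Function.Surjective (S.cutArc u v) := by
  rintro (x | ⟨i | q, hi⟩)
  · exact ⟨Sum.inl x.1, S.cutArc_of_ne u v x⟩
  · exact ⟨Sum.inr i, rfl⟩
  · induction q using Quotient.inductionOn with | _ x => ?_
    refine ⟨Sum.inl x, ?_⟩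
    rcases arcPart_eq_iff.1 ((S.arcPart_cutArc_inl u v x).trans
      (arcPart_inr (S := S.cut u v) ⟨Sum.inr (Quotient.mk _ x), hi⟩).symm) with h | ⟨-, y, -, hy, -⟩
    · exact h
    · cases hy

theorem endArc_cut (x : Without u v) :
    (S.cut u v).endArc x = S.cutArc u v (S.endArc x.1) := by
  have h := GluePerm.apply_firstReturn_inv (fun y => S.cutArc u v (Sum.inl y))
    (GluePerm.glue S.next u v) (S.cutArc_glue_inv u v (Or.inl rfl))
    (S.cutArc_glue_inv u v (Or.inr rfl)) x
  simp only [cutArc_of_ne, GluePerm.glue_inv_of_ne S.next x.2.1 x.2.2] at h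
  exact h

theorem eq_of_cutArc_eq {Z : Type*} (h : S.Arc → Z) (h1 : h (Sum.inl u) = h (S.endArc v))
    (h2 : h (Sum.inl v) = h (S.endArc u)) {α β : S.Arc}
    (hαβ : S.cutArc u v α = S.cutArc u v β) : h α = h β := by
  set φ := GluePerm.glue S.next u v with hφ
  have step : ∀ x, (x = u ∨ x = v) → h (Sum.inl x) = h (Sum.inl (φ⁻¹ x)) := by
    rintro x (rfl | rfl)
    · rw [hφ, GluePerm.glue_inv_left]; exact h1
    · rw [hφ, GluePerm.glue_inv_right]; exact h2
  have steps : ∀ (n : ℕ) x, (∀ m < n, (φ⁻¹ ^ m) x = u ∨ (φ⁻¹ ^ m) x = v) →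
      h (Sum.inl x) = h (Sum.inl ((φ⁻¹ ^ n) x)) := by
    intro n x hn
    induction n with
    | zero => rfl
    | succ n ih =>
      rw [ih fun m hm => hn m (by lia), step _ (hn n (by lia)), pow_succ', Equiv.Perm.mul_apply]
  rcases α with x | i <;> rcases β with y | j
  · rcases S.cutArc_cases u v x with ⟨m, hm, hltm, hx⟩ | ⟨hallx, i, hx⟩ <;>
      rcases S.cutArc_cases u v y with ⟨n, hn, hltn, hy⟩ | ⟨-, j, hy⟩
    · rw [hx, hy] at hαβ
      rw [steps m x hltm, steps n y hltn]
      exact congrArg (fun z => h (Sum.inl z.1)) (Sum.inl_injective hαβ)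
    · cases hx.symm.trans (hαβ.trans hy)
    · cases hx.symm.trans (hαβ.trans hy)
    · have hxy := (S.arcPart_cutArc_inl_eq_iff u v x y).1 (congrArg _ hαβ)
      obtain ⟨n, hn⟩ := (Equiv.Perm.sameCycle_inv.2 hxy).exists_nat_pow_eq
      rw [steps n x fun m _ => hallx m, hn]
  · exact (S.arcPart_cutArc_inl_ne_inr u v x j (congrArg _ hαβ)).elim
  · exact (S.arcPart_cutArc_inl_ne_inr u v y i (congrArg _ hαβ).symm).elim
  · rw [S.arcPart_cutArc_inr_injective u v (congrArg _ hαβ)]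

theorem cutArc_lift {Z : Type*} (h : S.Arc → Z) (h1 : h (Sum.inl u) = h (S.endArc v))
    (h2 : h (Sum.inl v) = h (S.endArc u)) :
    ∃ f : (S.cut u v).Arc → Z, ∀ α, f (S.cutArc u v α) = h α :=
  ⟨fun γ => h (Function.surjInv (S.cutArc_surjective u v) γ), fun _ =>
    S.eq_of_cutArc_eq u v h h1 h2 (Function.surjInv_eq _ _)⟩

end cut

/-! ### The arcs of a disjoint union -/

/-- The inclusion of the arcs of the first summand. -/
def unionArcLeft (S T : MultCyc.{u}) (α : S.Arc) : (S.disjointUnion T).Arc :=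
  α.map Sum.inl fun i => ⟨Sum.inl i.1, by
    rintro (x | x) hx
    · exact i.2 x (Sum.inl_injective hx)
    · cases hx⟩

/-- The inclusion of the arcs of the second summand. -/
def unionArcRight (S T : MultCyc.{u}) (α : T.Arc) : (S.disjointUnion T).Arc :=
  α.map Sum.inr fun i => ⟨Sum.inr i.1, by
    rintro (x | x) hx
    · cases hx
    · exact i.2 x (Sum.inr_injective hx)⟩

theorem unionArc_surjective (S T : MultCyc.{u}) :
    Function.Surjective (Sum.elim (S.unionArcLeft T) (S.unionArcRight T)) := by
  rintro ((x | x) | ⟨i | i, hi⟩)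
  · exact ⟨Sum.inl (Sum.inl x), rfl⟩
  · exact ⟨Sum.inr (Sum.inl x), rfl⟩
  · exact ⟨Sum.inl (Sum.inr ⟨i, fun x hx => hi (Sum.inl x) (congrArg Sum.inl hx)⟩), rfl⟩
  · exact ⟨Sum.inr (Sum.inr ⟨i, fun x hx => hi (Sum.inr x) (congrArg Sum.inr hx)⟩), rfl⟩

theorem unionArc_lift {Z : Type*} (h₁ : S.Arc → Z) (h₂ : T.Arc → Z) :
    ∃ f : (S.disjointUnion T).Arc → Z, (∀ α, f (unionArcLeft S T α) = h₁ α) ∧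
      ∀ α, f (unionArcRight S T α) = h₂ α := by
  refine ⟨fun α => match α with
    | Sum.inl (Sum.inl x) => h₁ (Sum.inl x)
    | Sum.inl (Sum.inr x) => h₂ (Sum.inl x)
    | Sum.inr ⟨Sum.inl i, hi⟩ => h₁ (Sum.inr ⟨i, fun x hx => hi (Sum.inl x) (congrArg Sum.inl hx)⟩)
    | Sum.inr ⟨Sum.inr i, hi⟩ => h₂ (Sum.inr ⟨i, fun x hx => hi (Sum.inr x) (congrArg Sum.inr hx)⟩),
    ?_, ?_⟩
  · rintro (x | i) <;> rfl
  · rintro (x | i) <;> rfl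

/-! ### Canonical isomorphisms -/

/-- The isomorphism of disjoint unions induced by isomorphisms of the summands. -/
def unionIso {S' T' : MultCyc.{u}} (ρ : Iso S S') (τ : Iso T T') :
    Iso (S.disjointUnion T) (S'.disjointUnion T') where
  toEquiv := Equiv.sumCongr ρ.toEquiv τ.toEquiv
  indexEquiv := Equiv.sumCongr ρ.indexEquiv τ.indexEquiv
  part_apply := Sum.rec (fun x => congrArg Sum.inl (ρ.part_apply x))
    fun x => congrArg Sum.inr (τ.part_apply x)
  next_apply := Sum.rec (fun x => congrArg Sum.inl (ρ.next_apply x))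
    fun x => congrArg Sum.inr (τ.next_apply x)

/-- Interchanging the summands of a disjoint union. -/
def unionSwap (S T : MultCyc.{u}) : Iso (T.disjointUnion S) (S.disjointUnion T) where
  toEquiv := Equiv.sumComm _ _
  indexEquiv := Equiv.sumComm _ _
  part_apply := Sum.rec (fun _ => rfl) fun _ => rfl
  next_apply := Sum.rec (fun _ => rfl) fun _ => rfl

theorem exists_cut_iso (ρ : Iso S T) {a b : S.carrier} {a' b' : T.carrier}
    (ha : ρ.toEquiv a = a') (hb : ρ.toEquiv b = b') :
    ∃ θ : Iso (S.cut a b) (T.cut a' b'),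
      ∀ α, θ.onArc (S.cutArc a b α) = T.cutArc a' b' (ρ.onArc α) := by
  subst ha hb
  obtain ⟨g, hg⟩ := T.cutArc_lift (ρ.toEquiv a) (ρ.toEquiv b)
    (fun α => S.cutArc a b (ρ.symm.onArc α))
    (by rw [← ρ.onArc_inl, ← ρ.onArc_endArc, ρ.symm_onArc_onArc, ρ.symm_onArc_onArc,
      cutArc_start_left])
    (by rw [← ρ.onArc_inl, ← ρ.onArc_endArc, ρ.symm_onArc_onArc, ρ.symm_onArc_onArc,
      cutArc_start_right])
  obtain ⟨θ, -, h⟩ := exists_iso_of_arc (S := S.cut a b)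
    (T := T.cut (ρ.toEquiv a) (ρ.toEquiv b)) (p := S.cutArc a b)
    (q := fun α => T.cutArc (ρ.toEquiv a) (ρ.toEquiv b) (ρ.onArc α))
    (withoutCongr ρ.toEquiv a b) (S.cutArc_surjective a b)
    ((T.cutArc_surjective _ _).comp ρ.onArc_surjective)
    (S.cutArc_lift a b _
      (by rw [ρ.onArc_inl, ρ.onArc_endArc, cutArc_start_left])
      (by rw [ρ.onArc_inl, ρ.onArc_endArc, cutArc_start_right]))
    ⟨g, fun α => by rw [hg, ρ.symm_onArc_onArc]⟩
    (fun x => ⟨Sum.inl x.1, S.cutArc_of_ne a b x,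
      T.cutArc_of_ne _ _ (withoutCongr ρ.toEquiv a b x)⟩)
    (fun x => ⟨S.endArc x.1, (S.endArc_cut a b x).symm, by
      rw [ρ.onArc_endArc]
      exact (T.endArc_cut _ _ (withoutCongr ρ.toEquiv a b x)).symm⟩)
  exact ⟨θ, h⟩

theorem exists_cut_swap_iso (S : MultCyc.{u}) (a b : S.carrier) :
    ∃ θ : Iso (S.cut b a) (S.cut a b), ∀ α, θ.onArc (S.cutArc b a α) = S.cutArc a b α := by
  let e : Without b a ≃ Without a b := Equiv.subtypeEquivRight fun x => and_comm
  obtain ⟨θ, -, h⟩ := exists_iso_of_arc (S := S.cut b a) (T := S.cut a b) (p := S.cutArc b a)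
    (q := S.cutArc a b) e (S.cutArc_surjective b a) (S.cutArc_surjective a b)
    (S.cutArc_lift b a _ (S.cutArc_start_right a b) (S.cutArc_start_left a b))
    (S.cutArc_lift a b _ (S.cutArc_start_right b a) (S.cutArc_start_left b a))
    (fun x => ⟨Sum.inl x.1, S.cutArc_of_ne b a x, S.cutArc_of_ne a b (e x)⟩)
    (fun x => ⟨S.endArc x.1, (S.endArc_cut b a x).symm, (S.endArc_cut a b (e x)).symm⟩)
  exact ⟨θ, h⟩

theorem cutArc_cutArc_start (S : MultCyc.{u}) {a b c d : S.carrier} (hac : a ≠ c) (had : a ≠ d)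
    (hbc : b ≠ c) (hbd : b ≠ d) :
    let q := fun α => (S.cut c d).cutArc ⟨a, hac, had⟩ ⟨b, hbc, hbd⟩ (S.cutArc c d α)
    q (Sum.inl a) = q (S.endArc b) ∧ q (Sum.inl b) = q (S.endArc a) ∧
      q (Sum.inl c) = q (S.endArc d) ∧ q (Sum.inl d) = q (S.endArc c) := by
  refine ⟨?_, ?_, congrArg _ (S.cutArc_start_left c d), congrArg _ (S.cutArc_start_right c d)⟩
  · simp only
    rw [cutArc_of_ne S c d ⟨a, hac, had⟩, ← endArc_cut S c d ⟨b, hbc, hbd⟩]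
    exact cutArc_start_left _ _ _
  · simp only
    rw [cutArc_of_ne S c d ⟨b, hbc, hbd⟩, ← endArc_cut S c d ⟨a, hac, had⟩]
    exact cutArc_start_right _ _ _

theorem cutArc_cutArc_lift (S : MultCyc.{u}) {a b c d : S.carrier} (hac : a ≠ c) (had : a ≠ d)
    (hbc : b ≠ c) (hbd : b ≠ d) {Z : Type*} (h : S.Arc → Z)
    (h1 : h (Sum.inl a) = h (S.endArc b)) (h2 : h (Sum.inl b) = h (S.endArc a))
    (h3 : h (Sum.inl c) = h (S.endArc d)) (h4 : h (Sum.inl d) = h (S.endArc c)) :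
    ∃ f : ((S.cut c d).cut ⟨a, hac, had⟩ ⟨b, hbc, hbd⟩).Arc → Z,
      ∀ α, f ((S.cut c d).cutArc ⟨a, hac, had⟩ ⟨b, hbc, hbd⟩ (S.cutArc c d α)) = h α := by
  obtain ⟨k, hk⟩ := S.cutArc_lift c d h h3 h4
  have hstart : ∀ x : Without c d, k (Sum.inl x) = h (Sum.inl x.1) := fun x =>
    (congrArg k (S.cutArc_of_ne c d x)).symm.trans (hk _)
  have hend : ∀ x : Without c d, k ((S.cut c d).endArc x) = h (S.endArc x.1) := fun x =>
    (congrArg k (S.endArc_cut c d x)).trans (hk _)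
  obtain ⟨f, hf⟩ := (S.cut c d).cutArc_lift ⟨a, hac, had⟩ ⟨b, hbc, hbd⟩ k
    ((hstart ⟨a, hac, had⟩).trans (h1.trans (hend ⟨b, hbc, hbd⟩).symm))
    ((hstart ⟨b, hbc, hbd⟩).trans (h2.trans (hend ⟨a, hac, had⟩).symm))
  exact ⟨f, fun α => by rw [hf, hk]⟩

/-- The complements that arise by removing two disjoint pairs of elements in either order. -/
def withoutComm {S : Type*} {a b c d : S} (hac : a ≠ c) (had : a ≠ d) (hbc : b ≠ c) (hbd : b ≠ d) :
    Without (⟨a, hac, had⟩ : Without c d) ⟨b, hbc, hbd⟩ ≃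
      Without (⟨c, hac.symm, hbc.symm⟩ : Without a b) ⟨d, had.symm, hbd.symm⟩ where
  toFun x := ⟨⟨x.1.1, fun h => x.2.1 (Subtype.ext h), fun h => x.2.2 (Subtype.ext h)⟩,
    fun h => x.1.2.1 (congrArg Subtype.val h), fun h => x.1.2.2 (congrArg Subtype.val h)⟩
  invFun x := ⟨⟨x.1.1, fun h => x.2.1 (Subtype.ext h), fun h => x.2.2 (Subtype.ext h)⟩,
    fun h => x.1.2.1 (congrArg Subtype.val h), fun h => x.1.2.2 (congrArg Subtype.val h)⟩
  left_inv _ := rfl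
  right_inv _ := rfl

theorem exists_cut_cut_iso (S : MultCyc.{u}) {a b c d : S.carrier} (hac : a ≠ c) (had : a ≠ d)
    (hbc : b ≠ c) (hbd : b ≠ d) :
    ∃ θ : Iso ((S.cut c d).cut ⟨a, hac, had⟩ ⟨b, hbc, hbd⟩)
      ((S.cut a b).cut ⟨c, hac.symm, hbc.symm⟩ ⟨d, had.symm, hbd.symm⟩),
      ∀ α, θ.onArc ((S.cut c d).cutArc ⟨a, hac, had⟩ ⟨b, hbc, hbd⟩ (S.cutArc c d α)) =
        (S.cut a b).cutArc ⟨c, hac.symm, hbc.symm⟩ ⟨d, had.symm, hbd.symm⟩ (S.cutArc a b α) := by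
  let e := withoutComm hac had hbc hbd
  obtain ⟨p1, p2, p3, p4⟩ := S.cutArc_cutArc_start hac had hbc hbd
  obtain ⟨q1, q2, q3, q4⟩ := S.cutArc_cutArc_start hac.symm hbc.symm had.symm hbd.symm
  obtain ⟨θ, -, h⟩ := exists_iso_of_arc (S := (S.cut c d).cut ⟨a, hac, had⟩ ⟨b, hbc, hbd⟩)
    (T := (S.cut a b).cut ⟨c, hac.symm, hbc.symm⟩ ⟨d, had.symm, hbd.symm⟩)
    (p := fun α => (S.cut c d).cutArc ⟨a, hac, had⟩ ⟨b, hbc, hbd⟩ (S.cutArc c d α))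
    (q := fun α => (S.cut a b).cutArc ⟨c, hac.symm, hbc.symm⟩ ⟨d, had.symm, hbd.symm⟩
      (S.cutArc a b α))
    e (((S.cut c d).cutArc_surjective _ _).comp (S.cutArc_surjective _ _))
    (((S.cut a b).cutArc_surjective _ _).comp (S.cutArc_surjective _ _))
    (S.cutArc_cutArc_lift hac had hbc hbd _ q3 q4 q1 q2)
    (S.cutArc_cutArc_lift hac.symm hbc.symm had.symm hbd.symm _ p3 p4 p1 p2)
    (fun x => ⟨Sum.inl x.1.1,
      (congrArg _ (cutArc_of_ne S c d x.1)).trans (cutArc_of_ne (S.cut c d) _ _ x),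
      (congrArg _ (cutArc_of_ne S a b (e x).1)).trans (cutArc_of_ne (S.cut a b) _ _ (e x))⟩)
    (fun x => ⟨S.endArc x.1.1,
      (congrArg _ (endArc_cut S c d x.1).symm).trans (endArc_cut (S.cut c d) _ _ x).symm,
      (congrArg _ (endArc_cut S a b (e x).1).symm).trans (endArc_cut (S.cut a b) _ _ (e x)).symm⟩)
  exact ⟨θ, h⟩

/-- Removal of `c` and `d` before a disjoint union is formed, or after it. -/
def withoutSum {S T : Type*} (c d : S) :
    Without c d ⊕ T ≃ Without (Sum.inl c : S ⊕ T) (Sum.inl d) where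
  toFun := Sum.elim (fun x => ⟨Sum.inl x.1, by simpa using x.2⟩) fun y => ⟨Sum.inr y, by simp⟩
  invFun
    | ⟨Sum.inl x, h⟩ => Sum.inl ⟨x, by simpa using h⟩
    | ⟨Sum.inr y, _⟩ => Sum.inr y
  left_inv := Sum.rec (fun _ => rfl) fun _ => rfl
  right_inv := by rintro ⟨x | y, h⟩ <;> rfl

theorem exists_union_cut_iso (S T : MultCyc.{u}) (c d : S.carrier) :
    ∃ θ : Iso ((S.cut c d).disjointUnion T) ((S.disjointUnion T).cut (Sum.inl c) (Sum.inl d)),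
      θ.toEquiv = withoutSum c d ∧
      (∀ α, θ.onArc ((S.cut c d).unionArcLeft T (S.cutArc c d α)) =
        (S.disjointUnion T).cutArc (Sum.inl c) (Sum.inl d) (S.unionArcLeft T α)) ∧
      ∀ α, θ.onArc ((S.cut c d).unionArcRight T α) =
        (S.disjointUnion T).cutArc (Sum.inl c) (Sum.inl d) (S.unionArcRight T α) := by
  let p := Sum.elim ((S.cut c d).unionArcLeft T ∘ S.cutArc c d) ((S.cut c d).unionArcRight T)
  let cutU := (S.disjointUnion T).cutArc (Sum.inl c) (Sum.inl d)
  have hp : Function.Surjective p := by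
    intro α
    obtain ⟨β | β, rfl⟩ := (S.cut c d).unionArc_surjective T α
    · obtain ⟨γ, rfl⟩ := S.cutArc_surjective _ _ β
      exact ⟨Sum.inl γ, rfl⟩
    · exact ⟨Sum.inr β, rfl⟩
  obtain ⟨k, hk⟩ := S.cutArc_lift c d (fun α => cutU (S.unionArcLeft T α))
    ((S.disjointUnion T).cutArc_start_left _ _) ((S.disjointUnion T).cutArc_start_right _ _)
  obtain ⟨f, hfl, hfr⟩ := unionArc_lift k (fun α => cutU (S.unionArcRight T α))
  obtain ⟨l, hll, hlr⟩ := unionArc_lift (p ∘ Sum.inl) (p ∘ Sum.inr)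
  obtain ⟨g, hg⟩ := (S.disjointUnion T).cutArc_lift (Sum.inl c) (Sum.inl d) l
    ((hll _).trans ((congrArg _ (S.cutArc_start_left c d)).trans (hll (S.endArc d)).symm))
    ((hll _).trans ((congrArg _ (S.cutArc_start_right c d)).trans (hll (S.endArc c)).symm))
  obtain ⟨θ, hθ, h⟩ := exists_iso_of_arc (S := (S.cut c d).disjointUnion T)
    (T := (S.disjointUnion T).cut (Sum.inl c) (Sum.inl d)) (p := p)
    (q := fun α => cutU (Sum.elim (S.unionArcLeft T) (S.unionArcRight T) α)) (withoutSum c d) hp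
    (((S.disjointUnion T).cutArc_surjective _ _).comp (S.unionArc_surjective T))
    ⟨f, Sum.rec (fun _ => (hfl _).trans (hk _)) hfr⟩
    ⟨g, Sum.rec (fun _ => (hg _).trans (hll _)) fun _ => (hg _).trans (hlr _)⟩
    (Sum.rec
      (fun x => ⟨Sum.inl (Sum.inl x.1), congrArg _ (S.cutArc_of_ne c d x),
        (S.disjointUnion T).cutArc_of_ne _ _ (withoutSum c d (Sum.inl x))⟩)
      fun y => ⟨Sum.inr (Sum.inl y), rfl,
        (S.disjointUnion T).cutArc_of_ne _ _ (withoutSum c d (Sum.inr y))⟩)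
    (Sum.rec
      (fun x => ⟨Sum.inl (S.endArc x.1), congrArg _ (S.endArc_cut c d x).symm,
        ((S.disjointUnion T).endArc_cut _ _ (withoutSum c d (Sum.inl x))).symm⟩)
      fun y => ⟨Sum.inr (T.endArc y), rfl,
        ((S.disjointUnion T).endArc_cut _ _ (withoutSum c d (Sum.inr y))).symm⟩)
  exact ⟨θ, hθ, fun α => h (Sum.inl α), fun α => h (Sum.inr α)⟩

theorem exists_merge_cut_iso (S T : MultCyc.{u}) {a c d : S.carrier} (b : T.carrier) (hac : a ≠ c)
    (had : a ≠ d) :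
    ∃ θ : Iso ((S.cut c d).merge T ⟨a, hac, had⟩ b)
      ((S.merge T a b).cut (Graft.left c hac.symm) (Graft.left d had.symm)),
    (∀ α, θ.onArc ((S.cut c d).mergeArcLeft T ⟨a, hac, had⟩ b (S.cutArc c d α)) =
      (S.merge T a b).cutArc (Graft.left c hac.symm) (Graft.left d had.symm)
        (S.mergeArcLeft T a b α)) ∧
    (∀ α, θ.onArc ((S.cut c d).mergeArcRight T ⟨a, hac, had⟩ b α) =
      (S.merge T a b).cutArc (Graft.left c hac.symm) (Graft.left d had.symm)
        (S.mergeArcRight T a b α)) := by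
  obtain ⟨θ, hθ, hl, hr⟩ := S.exists_union_cut_iso T c d
  obtain ⟨τ, hτ⟩ := exists_cut_iso θ (a := Sum.inl ⟨a, hac, had⟩) (b := Sum.inr b)
    (DFunLike.congr_fun hθ _) (DFunLike.congr_fun hθ _)
  obtain ⟨κ, hκ⟩ := (S.disjointUnion T).exists_cut_cut_iso
    (a := Sum.inl a) (b := Sum.inr b) (c := Sum.inl c) (d := Sum.inl d)
    (Sum.inl_injective.ne hac) (Sum.inl_injective.ne had) Sum.inr_ne_inl Sum.inr_ne_inl
  refine ⟨τ.trans κ, fun α => (Iso.onArc_trans τ κ _).trans ?_,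
    fun α => (Iso.onArc_trans τ κ _).trans ?_⟩
  · exact (congrArg _ ((hτ _).trans (congrArg _ (hl α)))).trans (hκ _)
  · exact (congrArg _ ((hτ _).trans (congrArg _ (hr α)))).trans (hκ _)

theorem exists_merge_swap_iso (S T : MultCyc.{u}) (a : S.carrier) (b : T.carrier) :
    ∃ θ : Iso (T.merge S b a) (S.merge T a b),
      (∀ α, θ.onArc (T.mergeArcRight S b a α) = S.mergeArcLeft T a b α) ∧
      (∀ α, θ.onArc (T.mergeArcLeft S b a α) = S.mergeArcRight T a b α) := by
  obtain ⟨θ, h⟩ := exists_cut_iso (S.unionSwap T) (a := Sum.inl b) (b := Sum.inr a) rfl rfl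
  obtain ⟨τ, h'⟩ := (S.disjointUnion T).exists_cut_swap_iso (Sum.inl a) (Sum.inr b)
  refine ⟨θ.trans τ, fun α => (Iso.onArc_trans θ τ _).trans ?_,
    fun α => (Iso.onArc_trans θ τ _).trans ?_⟩
  · exact (congrArg _ (h (T.unionArcRight S α))).trans ((h' _).trans (by rcases α <;> rfl))
  · exact (congrArg _ (h (T.unionArcLeft S α))).trans ((h' _).trans (by rcases α <;> rfl))

theorem exists_merge_iso {S' T' : MultCyc.{u}} (ρ : Iso S S') (τ : Iso T T') (a : S.carrier)
    (b : T.carrier) :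
    ∃ θ : Iso (S.merge T a b) (S'.merge T' (ρ.toEquiv a) (τ.toEquiv b)),
      (∀ α, θ.onArc (S.mergeArcLeft T a b α) =
        S'.mergeArcLeft T' (ρ.toEquiv a) (τ.toEquiv b) (ρ.onArc α)) ∧
      (∀ α, θ.onArc (S.mergeArcRight T a b α) =
        S'.mergeArcRight T' (ρ.toEquiv a) (τ.toEquiv b) (τ.onArc α)) := by
  obtain ⟨θ, h⟩ := exists_cut_iso (unionIso ρ τ) (a := Sum.inl a) (b := Sum.inr b) rfl rfl
  exact ⟨θ, fun α => (h (S.unionArcLeft T α)).trans (by rcases α <;> rfl),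
    fun α => (h (S.unionArcRight T α)).trans (by rcases α <;> rfl)⟩

end MultCyc

namespace GluePerm

variable {α β : Type*}

theorem semiconj_glue {σ : Equiv.Perm α} {σ' : Equiv.Perm β} {ρ : α ≃ β}
    (h : Function.Semiconj ρ σ σ') (u v : α) :
    Function.Semiconj ρ (glue σ u v) (glue σ' (ρ u) (ρ v)) := fun x => by
  classical
  simp only [glue, Equiv.Perm.mul_apply, ← h x, ρ.injective.map_swap]

theorem semiconj_of_skip {φ : Equiv.Perm α} {φ' : Equiv.Perm β} {ρ : α ≃ β} {w : α}
    (hskip : ∀ x, x ≠ w → ρ (skip φ w x) = skip φ' (ρ w) (ρ x))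
    (hw : ∀ x, x ≠ w → (φ x = w ↔ φ' (ρ x) = ρ w)) : Function.Semiconj ρ φ φ' := by
  intro x
  by_cases hx : x = w
  · subst hx
    by_cases hfix : φ x = x
    · obtain ⟨y, hy⟩ := (φ'.surjective.comp ρ.surjective) (ρ x)
      obtain rfl : y = x := by_contra fun h => h (φ.injective (((hw y h).2 hy).trans hfix.symm))
      rw [hfix]
      exact hy.symm
    · have hpre : φ.symm x ≠ x := fun h => hfix (by rw [← h, φ.apply_symm_apply, h])
      have h := hskip _ hpre
      rwa [skip_of_eq φ (φ.apply_symm_apply x),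
        skip_of_eq φ' ((hw _ hpre).1 (φ.apply_symm_apply x))] at h
  · by_cases h : φ x = w
    · rw [h, (hw x hx).1 h]
    · rw [← skip_of_ne φ h hx, hskip x hx, skip_of_ne φ' (mt (hw x hx).2 h) (ρ.injective.ne hx)]

theorem semiconj_of_firstReturn {φ : Equiv.Perm α} {φ' : Equiv.Perm β} {ρ : α ≃ β} {u v : α}
    (hr : ∀ (x : {x : α // x ≠ u ∧ x ≠ v}) (y : {y : β // y ≠ ρ u ∧ y ≠ ρ v}), ρ x.1 = y.1 →
      ρ (firstReturn φ u v x).1 = (firstReturn φ' (ρ u) (ρ v) y).1)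
    (hu : ∀ x, x ≠ u → (φ x = u ↔ φ' (ρ x) = ρ u))
    (hv : ∀ x, x ≠ v → (φ x = v ↔ φ' (ρ x) = ρ v)) : Function.Semiconj ρ φ φ' := by
  refine semiconj_of_skip (w := u) (fun x _ => ?_) hu
  refine semiconj_of_skip (w := v) (fun x hxv => ?_) (fun x hxv => ?_) x
  · by_cases hxu : x = u
    · subst hxu
      rw [skip_of_ne _ (by rwa [skip_self]) hxv, skip_self,
        skip_of_ne _ (by rwa [skip_self, ρ.injective.ne_iff]) (ρ.injective.ne hxv), skip_self]
    · exact hr ⟨x, hxu, hxv⟩ ⟨ρ x, ρ.injective.ne hxu, ρ.injective.ne hxv⟩ rfl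
  · by_cases hxu : x = u
    · rw [hxu, skip_self, skip_self, ρ.injective.eq_iff]
    by_cases h : φ x = u
    · rw [skip_of_eq φ h, skip_of_eq φ' ((hu x hxu).1 h)]
      by_cases huv : u = v
      · subst huv
        exact iff_of_false (fun h' => hxu (φ.injective (h.trans h'.symm))) fun h' =>
          hxu (ρ.injective (φ'.injective (((hu x hxu).1 h).trans h'.symm)))
      · exact hv u huv
    · rw [skip_of_ne φ h hxu, skip_of_ne φ' (mt (hu x hxu).2 h) (ρ.injective.ne hxu)]
      exact hv x hxv

end GluePerm

namespace MultCyc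

section recover

variable (S : MultCyc.{u}) {u v : S.carrier}

theorem cutArc_eq_of_glue {w x : S.carrier} (hw : w = u ∨ w = v)
    (h : GluePerm.glue S.next u v x = w) :
    S.cutArc u v (Sum.inl w) = S.cutArc u v (Sum.inl x) := by
  subst h
  rw [cutArc_glue_inv S u v hw, Equiv.Perm.inv_eq_iff_eq.2 rfl]

theorem cutArc_ne_inl_of_mapsTo {K : Set S.carrier} (hK : Set.MapsTo (GluePerm.glue S.next u v) K K)
    (hKuv : ∀ x ∈ K, x = u ∨ x = v) {w : S.carrier} (hw : w ∈ K) (x : Without u v) :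
    S.cutArc u v (Sum.inl w) ≠ Sum.inl x := by
  intro h
  rw [← cutArc_of_ne S u v x] at h
  obtain ⟨n, hn⟩ := ((S.arcPart_cutArc_inl_eq_iff u v w x.1).1 (congrArg _ h)).exists_nat_pow_eq
  exact (hKuv _ (hn ▸ hK.perm_pow n hw)).elim x.2.1 x.2.2

section

variable (h : S.cutArc u v (Sum.inl u) ≠ S.cutArc u v (Sum.inl v) ∨ S.next u = u)

include h

theorem glue_left_eq_right_iff : GluePerm.glue S.next u v u = v ↔
    S.cutArc u v (Sum.inl u) = S.cutArc u v (Sum.inl v) :=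
  ⟨fun hu => (S.cutArc_eq_of_glue (Or.inr rfl) hu).symm,
    fun huv => GluePerm.glue_apply_left _ (h.resolve_left (not_not.2 huv))⟩

theorem glue_eq_left_iff (huv : u ≠ v) (x : Without u v) :
    GluePerm.glue S.next u v x.1 = u ↔ S.cutArc u v (Sum.inl u) = Sum.inl x := by
  refine ⟨fun hx => (S.cutArc_eq_of_glue (Or.inl rfl) hx).trans (S.cutArc_of_ne u v x),
    fun hx => ?_⟩
  obtain ⟨y, hy⟩ := (GluePerm.glue S.next u v).surjective u
  have hxy := S.cutArc_eq_of_glue (Or.inl rfl) hy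
  by_cases hyu : y = u
  · subst hyu
    exact absurd hx (S.cutArc_ne_inl_of_mapsTo (K := {y}) (by simp [hy]) (by simp) rfl x)
  by_cases hyv : y = v
  · subst hyv
    have huy := (S.glue_left_eq_right_iff h).2 hxy
    exact absurd hx (S.cutArc_ne_inl_of_mapsTo (K := {u, y}) (by simp [Set.MapsTo, hy, huy])
      (by simp) (by simp) x)
  · rw [hxy, S.cutArc_of_ne u v ⟨y, hyu, hyv⟩] at hx
    rw [← Sum.inl_injective hx, hy]

theorem glue_right_eq_left_iff (huv : u ≠ v) : GluePerm.glue S.next u v v = u ↔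
    S.cutArc u v (Sum.inl u) = S.cutArc u v (Sum.inl v) ∧
      ∀ x, S.cutArc u v (Sum.inl u) ≠ Sum.inl x := by
  refine ⟨fun hv => ?_, fun ⟨heq, hno⟩ => ?_⟩
  · have heq := S.cutArc_eq_of_glue (Or.inl rfl) hv
    exact ⟨heq, fun x hx => x.2.2 ((GluePerm.glue S.next u v).injective
      (((S.glue_eq_left_iff h huv x).2 hx).trans hv.symm))⟩
  · obtain ⟨y, hy⟩ := (GluePerm.glue S.next u v).surjective u
    have hyu : y ≠ u := by
      rintro rfl
      exact huv (hy.symm.trans ((S.glue_left_eq_right_iff h).2 heq))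
    by_cases hyv : y = v
    · rwa [hyv] at hy
    · exact absurd ((S.glue_eq_left_iff h huv ⟨y, hyu, hyv⟩).1 hy) (hno _)

theorem glue_eq_right_iff (x : Without u v) : GluePerm.glue S.next u v x.1 = v ↔
    S.cutArc u v (Sum.inl v) = Sum.inl x ∧
      S.cutArc u v (Sum.inl u) ≠ S.cutArc u v (Sum.inl v) := by
  refine ⟨fun hx => ⟨(S.cutArc_eq_of_glue (Or.inr rfl) hx).trans (S.cutArc_of_ne u v x),
    fun heq => x.2.1 ((GluePerm.glue S.next u v).injective
      (hx.trans ((S.glue_left_eq_right_iff h).2 heq).symm))⟩, fun ⟨hx, hne⟩ => ?_⟩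
  obtain ⟨y, hy⟩ := (GluePerm.glue S.next u v).surjective v
  have hxy := S.cutArc_eq_of_glue (Or.inr rfl) hy
  by_cases hyu : y = u
  · exact absurd (hyu ▸ hxy.symm) hne
  by_cases hyv : y = v
  · subst hyv
    exact absurd hx (S.cutArc_ne_inl_of_mapsTo (K := {y}) (by simp [hy]) (by simp) rfl x)
  · rw [hxy, S.cutArc_of_ne u v ⟨y, hyu, hyv⟩] at hx
    rw [← Sum.inl_injective hx, hy]

end

end recover

section

variable {S S' : MultCyc.{u}} {u v : S.carrier} {u' v' : S'.carrier}
  (τ : Iso (S.cut u v) (S'.cut u' v'))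
  (hu : τ.onArc (S.cutArc u v (Sum.inl u)) = S'.cutArc u' v' (Sum.inl u'))
  (hv : τ.onArc (S.cutArc u v (Sum.inl v)) = S'.cutArc u' v' (Sum.inl v'))

include hu hv

theorem exists_onArc_cutArc_inr (i : S.EmptyPart) : ∃ j : S'.EmptyPart,
    τ.onArc (S.cutArc u v (Sum.inr i)) = S'.cutArc u' v' (Sum.inr j) := by
  have hne : ∀ x, S.cutArc u v (Sum.inr i) ≠ S.cutArc u v (Sum.inl x) := fun x hx =>
    S.arcPart_cutArc_inl_ne_inr u v x i (congrArg _ hx.symm)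
  obtain ⟨x | j, hα⟩ := S'.cutArc_surjective u' v' (τ.onArc (S.cutArc u v (Sum.inr i)))
  · by_cases hxu : x = u'
    · rw [hxu, ← hu] at hα
      exact absurd (τ.onArc_injective hα).symm (hne u)
    by_cases hxv : x = v'
    · rw [hxv, ← hv] at hα
      exact absurd (τ.onArc_injective hα).symm (hne v)
    rw [cutArc_of_ne S' u' v' ⟨x, hxu, hxv⟩] at hα
    cases hα
  · exact ⟨j, hα.symm⟩

theorem exists_emptyPart_equiv : ∃ f : S.EmptyPart ≃ S'.EmptyPart,
    ∀ i, τ.onArc (S.cutArc u v (Sum.inr i)) = S'.cutArc u' v' (Sum.inr (f i)) := by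
  choose f hf using exists_onArc_cutArc_inr τ hu hv
  choose g hg using exists_onArc_cutArc_inr τ.symm (by rw [← hu, τ.symm_onArc_onArc])
    (by rw [← hv, τ.symm_onArc_onArc])
  exact ⟨⟨f, g,
    fun i => S.arcPart_cutArc_inr_injective u v (congrArg _ (by
      rw [← hg, ← hf, τ.symm_onArc_onArc])),
    fun j => S'.arcPart_cutArc_inr_injective u' v' (congrArg _ (by
      rw [← hf, ← hg, τ.onArc_symm_onArc]))⟩, hf⟩

theorem semiconj_glue_of_cut_iso (huv : u ≠ v) (huv' : u' ≠ v')
    (h : S.cutArc u v (Sum.inl u) ≠ S.cutArc u v (Sum.inl v) ∨ (S.next u = u ∧ S'.next u' = u'))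
    {e : S.carrier ≃ S'.carrier} (heu : e u = u') (hev : e v = v')
    (he : ∀ x : Without u v, e x.1 = (τ.toEquiv x).1) :
    Function.Semiconj e (GluePerm.glue S.next u v) (GluePerm.glue S'.next u' v') := by
  have hinl : ∀ (α : (S.cut u v).Arc) (x : Without u v),
      α = Sum.inl x ↔ τ.onArc α = Sum.inl (τ.toEquiv x) := fun α x =>
    (τ.onArc_injective.eq_iff (b := Sum.inl x)).symm
  have heq : S.cutArc u v (Sum.inl u) = S.cutArc u v (Sum.inl v) ↔
      S'.cutArc u' v' (Sum.inl u') = S'.cutArc u' v' (Sum.inl v') := by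
    rw [← hu, ← hv, τ.onArc_injective.eq_iff]
  have hS := h.imp_right And.left
  have hS' : S'.cutArc u' v' (Sum.inl u') ≠ S'.cutArc u' v' (Sum.inl v') ∨ S'.next u' = u' :=
    h.imp (mt heq.2) And.right
  subst heu hev
  refine GluePerm.semiconj_of_firstReturn (u := u) (v := v)
    (fun x y hxy => ?_) (fun x hxu => ?_) fun x hxv => ?_
  · obtain rfl : τ.toEquiv x = y := Subtype.ext ((he x).symm.trans hxy)
    exact (he _).trans (congrArg Subtype.val (τ.next_apply x).symm)
  · by_cases hxv : x = v
    · subst hxv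
      rw [S.glue_right_eq_left_iff hS huv, S'.glue_right_eq_left_iff hS' huv', heq, ← hu]
      refine and_congr_right fun _ => τ.toEquiv.forall_congr fun y => ?_
      exact not_congr (hinl _ y)
    · rw [he ⟨x, hxu, hxv⟩]
      refine (S.glue_eq_left_iff hS huv ⟨x, hxu, hxv⟩).trans ((hinl _ _).trans ?_)
      rw [hu]
      exact (S'.glue_eq_left_iff hS' huv' (τ.toEquiv _)).symm
  · by_cases hxu : x = u
    · subst hxu
      rw [S.glue_left_eq_right_iff hS, S'.glue_left_eq_right_iff hS', heq]
    · rw [he ⟨x, hxu, hxv⟩]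
      refine (S.glue_eq_right_iff hS ⟨x, hxu, hxv⟩).trans
        ((and_congr (hinl _ _) (not_congr heq)).trans ?_)
      rw [hv]
      exact (S'.glue_eq_right_iff hS' (τ.toEquiv _)).symm

/-- If both points are removed from the same arc, an isomorphism also has to respect their order on
it; the condition `S.next u = u` says that `u` comes last. -/
theorem exists_iso_of_cut_iso (huv : u ≠ v) (huv' : u' ≠ v')
    (h : S.cutArc u v (Sum.inl u) ≠ S.cutArc u v (Sum.inl v) ∨
      (S.next u = u ∧ S'.next u' = u')) :
    ∃ ρ : Iso S S', ρ.toEquiv u = u' ∧ ρ.toEquiv v = v' ∧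
      ∀ α, τ.onArc (S.cutArc u v α) = S'.cutArc u' v' (ρ.onArc α) := by
  obtain ⟨e, heu, hev, he⟩ := exists_equiv_extending huv huv' τ.toEquiv
  have hglue := semiconj_glue_of_cut_iso τ hu hv huv huv' h heu hev he
  have hnext : Function.Semiconj e S.next S'.next := by
    have h := GluePerm.semiconj_glue hglue u v
    rwa [heu, hev, GluePerm.glue_glue, GluePerm.glue_glue] at h
  obtain ⟨f, hf⟩ := exists_emptyPart_equiv τ hu hv
  obtain ⟨ρ, hρ, hρ'⟩ := exists_iso_of_arcEquiv e (Equiv.sumCongr e f) (fun _ => rfl) fun x =>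
    congrArg Sum.inl (Equiv.Perm.eq_inv_iff_eq.2
      ((hnext _).symm.trans (congrArg e (S.next.apply_symm_apply x))))
  refine ⟨ρ, by rw [hρ, heu], by rw [hρ, hev], ?_⟩
  rintro (x | i)
  · rw [hρ']
    by_cases hxu : x = u
    · rw [hxu, hu, Equiv.sumCongr_apply, Sum.map_inl, heu]
    by_cases hxv : x = v
    · rw [hxv, hv, Equiv.sumCongr_apply, Sum.map_inl, hev]
    rw [S.cutArc_of_ne u v ⟨x, hxu, hxv⟩, Equiv.sumCongr_apply, Sum.map_inl, he ⟨x, hxu, hxv⟩,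
      S'.cutArc_of_ne u' v']
    rfl
  · rw [hρ', hf, Equiv.sumCongr_apply, Sum.map_inr]

end

end MultCyc

namespace GluePerm

variable {α A Z : Type*}

open scoped Classical in
/-- Insertion of an additional point `none` into the arc `γ`, if `p x` is the arc that begins at
`x`. If no point lies on `γ`, then `none` becomes a fixed point. -/
noncomputable def insertPoint (σ : Equiv.Perm α) (p : α → A) (γ : A) : Equiv.Perm (Option α) :=
  if h : ∃ x, p x = γ then σ.optionCongr * Equiv.swap none (some h.choose) else σ.optionCongr

variable {σ : Equiv.Perm α} {p : α → A} {γ : A}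

theorem insertPoint_cases (σ : Equiv.Perm α) (p : α → A) (γ : A) :
    (∃ x, p x = γ ∧ insertPoint σ p γ (some x) = none ∧ insertPoint σ p γ none = some (σ x) ∧
      ∀ y, y ≠ x → insertPoint σ p γ (some y) = some (σ y)) ∨
    ((∀ x, p x ≠ γ) ∧ insertPoint σ p γ none = none ∧
      ∀ y, insertPoint σ p γ (some y) = some (σ y)) := by
  classical
  by_cases h : ∃ x, p x = γ
  · refine Or.inl ⟨h.choose, h.choose_spec, ?_, ?_, fun y hy => ?_⟩
    · simp [insertPoint, h]
    · simp [insertPoint, h]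
    · simp [insertPoint, h, Equiv.swap_apply_of_ne_of_ne, hy]
  · exact Or.inr ⟨not_exists.1 h, by simp [insertPoint, h], by simp [insertPoint, h]⟩

theorem elim_insertPoint {q : α → A} (hq : ∀ x, q (σ x) = p x) (z : Option α) :
    (insertPoint σ p γ z).elim γ q = z.elim γ p := by
  rcases insertPoint_cases σ p γ with ⟨x, rfl, hx, hn, hy⟩ | ⟨-, hn, hy⟩ <;> rcases z with _ | y
  · rw [hn]
    exact hq x
  · by_cases hyx : y = x
    · rw [hyx, hx]
      rfl
    · rw [hy y hyx]
      exact hq y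
  · rw [hn]
    rfl
  · rw [hy]
    exact hq y

theorem apply_of_insertPoint_eq_some {h : Option α → Z}
    (hnone : ∀ z, insertPoint σ p γ z = none → h none = h z) {z : Option α} {y : α}
    (hz : insertPoint σ p γ z = some (σ y)) : h z = h (some y) := by
  rcases insertPoint_cases σ p γ with ⟨x, -, hx, hn, hy⟩ | ⟨-, -, hy⟩
  · by_cases hyx : y = x
    · rw [(insertPoint σ p γ).injective (hz.trans (hyx ▸ hn.symm)), hyx, hnone _ hx]
    · rw [(insertPoint σ p γ).injective (hz.trans (hy y hyx).symm)]
  · rw [(insertPoint σ p γ).injective (hz.trans (hy y).symm)]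

theorem eq_of_elim_eq {h : Option α → Z} (hnone : ∀ z, insertPoint σ p γ z = none → h none = h z)
    (hp : ∀ x y, p x = p y → h (some x) = h (some y)) {z z' : Option α}
    (hz : z.elim γ p = z'.elim γ p) : h z = h z' := by
  have hγ : ∀ y, p y = γ → h none = h (some y) := fun y hy => by
    rcases insertPoint_cases σ p γ with ⟨x, hx, hxn, -⟩ | ⟨hne, -⟩
    · exact (hnone _ hxn).trans (hp _ _ (hx.trans hy.symm))
    · exact absurd hy (hne y)
  rcases z with _ | x <;> rcases z' with _ | y
  · rfl
  · exact hγ y hz.symm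
  · exact (hγ x hz).symm
  · exact hp _ _ hz

end GluePerm

namespace MultCyc

/-! ### Inverting cuts -/

/-- The multicyclically ordered set whose parts are the cycles of a permutation, and additional
empty parts. -/
def ofPerm {α : Type u} (ι : Type u) [Finite α] [Finite ι] [Nonempty α] (σ : Equiv.Perm α) :
    MultCyc.{u} where
  carrier := α
  index := ι ⊕ GluePerm.Cycles σ
  part x := Sum.inr (Quotient.mk _ x)
  next := σ
  finite_carrier := inferInstance
  finite_index := inferInstance
  nonempty_index := ⟨Sum.inr (Quotient.mk _ (Classical.arbitrary α))⟩
  part_eq_iff x y := by rw [Sum.inr.injEq, GluePerm.mk_eq_iff]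

/-- The arcs of `ofPerm ι σ` are the elements of the underlying set and the empty parts in `ι`. -/
noncomputable def ofPermArc {α ι : Type u} [Finite α] [Finite ι] [Nonempty α]
    (σ : Equiv.Perm α) : α ⊕ ι ≃ (ofPerm ι σ).Arc :=
  Equiv.ofBijective
    (Sum.map id fun i => ⟨Sum.inl i, fun x (hx : Sum.inr (Quotient.mk _ x) = Sum.inl i) =>
      Sum.inr_ne_inl hx⟩)
    ⟨Function.Injective.sumMap Function.injective_id fun i j hij =>
      Sum.inl_injective (congrArg Subtype.val hij), by
      rintro (x | ⟨i | q, h⟩)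
      · exact ⟨Sum.inl x, rfl⟩
      · exact ⟨Sum.inr i, rfl⟩
      · induction q using Quotient.inductionOn with | _ x => exact (h x rfl).elim⟩

section uncut

variable (S : MultCyc.{u}) (γ δ : S.Arc)

/-- The permutation obtained from `S` by inserting the point `some none` into the arc `δ` and the
point `none` into the arc `γ`. -/
noncomputable def insertPerm : Equiv.Perm (Option (Option S.carrier)) :=
  GluePerm.insertPoint (GluePerm.insertPoint S.next Sum.inl δ) (Option.elim · δ Sum.inl) γ

/-- The arc of `S` on which the arc beginning at a point of `insertPerm` lies. -/
def insertStart (z : Option (Option S.carrier)) : S.Arc := z.elim γ (Option.elim · δ Sum.inl)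

/-- The arc of `S` on which the arc ending at a point of `insertPerm` lies. -/
def insertEnd (z : Option (Option S.carrier)) : S.Arc := z.elim γ (Option.elim · δ S.endArc)

theorem insertEnd_insertPerm (z : Option (Option S.carrier)) :
    S.insertEnd γ δ (S.insertPerm γ δ z) = S.insertStart γ δ z :=
  GluePerm.elim_insertPoint (GluePerm.elim_insertPoint S.endArc_next) z

theorem insertStart_insertPerm_inv (z : Option (Option S.carrier)) :
    S.insertStart γ δ ((S.insertPerm γ δ)⁻¹ z) = S.insertEnd γ δ z := by
  rw [← insertEnd_insertPerm]
  exact congrArg _ ((S.insertPerm γ δ).apply_symm_apply z)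

theorem eq_of_insertStart_eq {Z : Type*} {h : Option (Option S.carrier) → Z}
    (hγ : h none = h ((S.insertPerm γ δ)⁻¹ none))
    (hδ : h (some none) = h ((S.insertPerm γ δ)⁻¹ (some none))) {z z' : Option (Option S.carrier)}
    (hz : S.insertStart γ δ z = S.insertStart γ δ z') : h z = h z' := by
  have hnone : ∀ z, S.insertPerm γ δ z = none → h none = h z := fun z hz => by
    rw [hγ, Equiv.Perm.inv_eq_iff_eq.2 hz.symm]
  refine GluePerm.eq_of_elim_eq hnone (fun x y hxy => ?_) hz
  refine GluePerm.eq_of_elim_eq (σ := S.next) (h := fun x => h (some x)) (fun x hx => ?_)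
    (fun x y hxy => by rw [Sum.inl_injective hxy]) hxy
  rw [hδ]
  exact GluePerm.apply_of_insertPoint_eq_some hnone
    (((S.insertPerm γ δ).apply_symm_apply _).trans (congrArg some hx.symm))

/-- The multicyclically ordered set from which `S` is obtained by a cut at two points which are
removed from the arcs `γ` and `δ`. -/
noncomputable def uncut : MultCyc.{u} :=
  ofPerm {i : S.EmptyPart // Sum.inr i ≠ δ ∧ Sum.inr i ≠ γ}
    (GluePerm.glue (S.insertPerm γ δ) none (some none))

/-- The arc of `S` into which an arc of `S.uncut γ δ` is merged by the cut. -/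
noncomputable def uncutArc (α : (S.uncut γ δ).Arc) : S.Arc :=
  Sum.elim (S.insertStart γ δ) (fun i => Sum.inr i.1) ((ofPermArc _).symm α)

theorem glue_uncut_next :
    GluePerm.glue (S.uncut γ δ).next none (some none) = S.insertPerm γ δ :=
  GluePerm.glue_glue _ _ _

theorem uncutArc_inl (z : Option (Option S.carrier)) :
    S.uncutArc γ δ (Sum.inl z) = S.insertStart γ δ z :=
  congrArg _ ((ofPermArc _).symm_apply_apply (Sum.inl z))

theorem uncutArc_surjective : Function.Surjective (S.uncutArc γ δ) := by
  refine Function.Surjective.comp ?_ (ofPermArc _).symm.surjective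
  rintro (x | i)
  · exact ⟨Sum.inl (some (some x)), rfl⟩
  · by_cases hδ : Sum.inr i = δ
    · exact ⟨Sum.inl (some none), hδ.symm⟩
    by_cases hγ : Sum.inr i = γ
    · exact ⟨Sum.inl none, hγ.symm⟩
    exact ⟨Sum.inr ⟨i, hδ, hγ⟩, rfl⟩

theorem cutArc_eq_of_uncutArc_eq {α β : (S.uncut γ δ).Arc}
    (h : S.uncutArc γ δ α = S.uncutArc γ δ β) :
    (S.uncut γ δ).cutArc none (some none) α = (S.uncut γ δ).cutArc none (some none) β := by
  obtain ⟨a, rfl⟩ := (ofPermArc _).surjective α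
  obtain ⟨b, rfl⟩ := (ofPermArc _).surjective β
  have hne : ∀ (z : Option (Option S.carrier)) (i : {i // Sum.inr i ≠ δ ∧ Sum.inr i ≠ γ}),
      S.insertStart γ δ z ≠ Sum.inr i.1 := by
    rintro (_ | _ | x) i
    exacts [i.2.2.symm, i.2.1.symm, Sum.inl_ne_inr]
  simp only [uncutArc, Equiv.symm_apply_apply] at h
  rcases a with z | i <;> rcases b with z' | j
  · refine S.eq_of_insertStart_eq γ δ
      (h := fun z => (S.uncut γ δ).cutArc none (some none) (Sum.inl z)) ?_ ?_ h
    · rw [← glue_uncut_next]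
      exact (S.uncut γ δ).cutArc_glue_inv _ _ (Or.inl rfl)
    · rw [← glue_uncut_next]
      exact (S.uncut γ δ).cutArc_glue_inv _ _ (Or.inr rfl)
  · exact absurd h (hne z j)
  · exact absurd h.symm (hne z' i)
  · rw [Subtype.ext (Sum.inr_injective h)]

theorem uncutArc_endArc {z z' : Option (Option S.carrier)}
    (h : (S.uncut γ δ).next⁻¹ z = (S.insertPerm γ δ)⁻¹ z') :
    S.uncutArc γ δ ((S.uncut γ δ).endArc z) = S.insertEnd γ δ z' :=
  (S.uncutArc_inl γ δ _).trans ((congrArg _ h).trans (S.insertStart_insertPerm_inv γ δ z'))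

theorem uncutArc_endArc_left : S.uncutArc γ δ ((S.uncut γ δ).endArc none) = δ :=
  S.uncutArc_endArc γ δ (GluePerm.glue_inv_left _ _ _)

theorem uncutArc_endArc_right : S.uncutArc γ δ ((S.uncut γ δ).endArc (some none)) = γ :=
  S.uncutArc_endArc γ δ (GluePerm.glue_inv_right _ _ _)

theorem uncutArc_endArc_some_some (x : S.carrier) :
    S.uncutArc γ δ ((S.uncut γ δ).endArc (some (some x))) = S.endArc x :=
  S.uncutArc_endArc γ δ (z' := some (some x)) (GluePerm.glue_inv_of_ne _ (Option.some_ne_none _)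
    ((Option.some_injective _).ne (Option.some_ne_none _)))

theorem exists_uncut : ∃ (T : MultCyc.{u}) (c d : T.carrier) (κ : Iso (T.cut c d) S), c ≠ d ∧
    κ.onArc (T.cutArc c d (Sum.inl c)) = γ ∧ κ.onArc (T.cutArc c d (Sum.inl d)) = δ := by
  let T := S.uncut γ δ
  let c : T.carrier := none
  let d : T.carrier := some none
  obtain ⟨κ, -, hκ⟩ := exists_iso_of_arc (S := T.cut c d) (p := T.cutArc c d)
    (q := S.uncutArc γ δ) (withoutOption S.carrier) (T.cutArc_surjective c d)
    (S.uncutArc_surjective γ δ)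
    (T.cutArc_lift c d _ ((S.uncutArc_inl γ δ none).trans (S.uncutArc_endArc_right γ δ).symm)
      ((S.uncutArc_inl γ δ (some none)).trans (S.uncutArc_endArc_left γ δ).symm))
    ⟨fun α => T.cutArc c d (Function.surjInv (S.uncutArc_surjective γ δ) α),
      fun α => S.cutArc_eq_of_uncutArc_eq γ δ (Function.surjInv_eq _ _)⟩
    (fun x => by
      obtain ⟨y, rfl⟩ := (withoutOption S.carrier).symm.surjective x
      exact ⟨_, T.cutArc_of_ne c d _, S.uncutArc_inl γ δ _⟩)
    (fun x => by
      obtain ⟨y, rfl⟩ := (withoutOption S.carrier).symm.surjective x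
      exact ⟨_, (T.endArc_cut c d _).symm, S.uncutArc_endArc_some_some γ δ y⟩)
  exact ⟨T, c, d, κ, (Option.some_ne_none none).symm, (hκ _).trans (S.uncutArc_inl γ δ _),
    (hκ _).trans (S.uncutArc_inl γ δ _)⟩

end uncut

/-! ### Splitting off a part -/

/-- A part of a multicyclically ordered set, as a cyclically ordered set. -/
def partSet (S : MultCyc.{u}) (i : S.index) : CycSet.{u} where
  val :=
    { carrier := {x : S.carrier // S.part x = i}
      index := PUnit
      part := fun _ => PUnit.unit
      next := S.next.subtypePerm fun x => by rw [S.part_next]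
      finite_carrier := inferInstance
      finite_index := inferInstance
      nonempty_index := inferInstance
      part_eq_iff := fun x y => by
        refine iff_of_true rfl ?_
        rw [Equiv.Perm.sameCycle_subtypePerm, ← S.part_eq_iff, x.2, y.2] }
  property := show Subsingleton PUnit from inferInstance

theorem exists_union_iso (S : MultCyc.{u}) {i j : S.index} (hij : i ≠ j)
    (h : ∀ k, k = i ∨ k = j) :
    ∃ ρ : Iso ((S.partSet i).1.disjointUnion (S.partSet j).1) S,
      (∀ x, ρ.toEquiv (Sum.inl x) = x.1) ∧ ∀ x, ρ.toEquiv (Sum.inr x) = x.1 := by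
  let f : {x : S.carrier // S.part x = i} ⊕ {x : S.carrier // S.part x = j} → S.carrier :=
    Sum.elim Subtype.val Subtype.val
  have hf : Function.Bijective f := by
    constructor
    · rintro (⟨x, hx⟩ | ⟨x, hx⟩) (⟨y, hy⟩ | ⟨y, hy⟩) hxy <;> change x = y at hxy <;> subst hxy
      · rfl
      · exact (hij (hx.symm.trans hy)).elim
      · exact (hij (hy.symm.trans hx)).elim
      · rfl
    · intro x
      rcases h (S.part x) with hx | hx
      · exact ⟨Sum.inl ⟨x, hx⟩, rfl⟩
      · exact ⟨Sum.inr ⟨x, hx⟩, rfl⟩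
  let k : PUnit.{u + 1} ⊕ PUnit.{u + 1} → S.index := Sum.elim (fun _ => i) fun _ => j
  have hk : Function.Bijective k := by
    constructor
    · rintro (x | x) (y | y) hxy
      · rfl
      · exact (hij hxy).elim
      · exact (hij hxy.symm).elim
      · rfl
    · intro x
      rcases h x with hx | hx
      · exact ⟨Sum.inl PUnit.unit, hx.symm⟩
      · exact ⟨Sum.inr PUnit.unit, hx.symm⟩
  exact ⟨{ toEquiv := Equiv.ofBijective f hf
           indexEquiv := Equiv.ofBijective k hk
           part_apply := Sum.rec (fun x => x.2) fun x => x.2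
           next_apply := Sum.rec (fun x => rfl) fun x => rfl }, fun _ => rfl, fun _ => rfl⟩

/-! ### Parts and cuts -/

theorem part_eq_of_arcPart_cutArc_ne (S : MultCyc.{u}) {u v : S.carrier}
    (h : (S.cut u v).arcPart (S.cutArc u v (Sum.inl u)) ≠
      (S.cut u v).arcPart (S.cutArc u v (Sum.inl v))) : S.part u = S.part v := by
  rw [ne_eq, arcPart_cutArc_inl_eq_iff] at h
  rw [S.part_eq_iff]
  by_contra h'
  exact h (GluePerm.sameCycle_glue h')

theorem arcPart_cutArc_ne_of_part_eq (S : MultCyc.{u}) {u v : S.carrier} (huv : u ≠ v)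
    (h : S.part u = S.part v) : (S.cut u v).arcPart (S.cutArc u v (Sum.inl u)) ≠
      (S.cut u v).arcPart (S.cutArc u v (Sum.inl v)) := by
  rw [ne_eq, arcPart_cutArc_inl_eq_iff]
  exact GluePerm.not_sameCycle_glue huv ((S.part_eq_iff _ _).1 h)

theorem arcPart_cutArc_cases (S : MultCyc.{u}) (u v : S.carrier) {α β : S.Arc}
    (h : S.arcPart α = S.arcPart β) :
    (S.cut u v).arcPart (S.cutArc u v α) = (S.cut u v).arcPart (S.cutArc u v β) ∨
    (((S.cut u v).arcPart (S.cutArc u v α) = (S.cut u v).arcPart (S.cutArc u v (Sum.inl u)) ∨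
      (S.cut u v).arcPart (S.cutArc u v α) = (S.cut u v).arcPart (S.cutArc u v (Sum.inl v))) ∧
    ((S.cut u v).arcPart (S.cutArc u v β) = (S.cut u v).arcPart (S.cutArc u v (Sum.inl u)) ∨
      (S.cut u v).arcPart (S.cutArc u v β) = (S.cut u v).arcPart (S.cutArc u v (Sum.inl v)))) := by
  rcases α with x | i <;> rcases β with y | j
  · have hs := (S.part_eq_iff x y).1 h
    rw [← GluePerm.glue_glue S.next u v] at hs
    simp only [arcPart_cutArc_inl_eq_iff]
    rcases GluePerm.sameCycle_glue_cases hs with h1 | ⟨h1, h2⟩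
    · exact Or.inl h1
    · exact Or.inr ⟨h1.imp (fun h => h.symm) fun h => h.symm,
        h2.imp (fun h => h.symm) fun h => h.symm⟩
  · exact (j.2 x h).elim
  · exact (i.2 y h.symm).elim
  · rw [show i = j from Subtype.ext h]
    exact Or.inl rfl

theorem next_eq_self_of_cutArc_eq (S : MultCyc.{u}) {u v : S.carrier} (huv : u ≠ v)
    (h : S.cutArc u v (Sum.inl u) = S.cutArc u v (Sum.inl v)) : S.next u = u ∨ S.next v = v := by
  set φ := GluePerm.glue S.next u v with hφ
  suffices φ u = v ∨ φ v = u by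
    rw [← GluePerm.glue_glue S.next u v, ← hφ]
    exact this.imp (GluePerm.glue_apply_right φ) (GluePerm.glue_apply_left φ)
  have hs : φ.SameCycle u v := (S.arcPart_cutArc_inl_eq_iff u v u v).1 (congrArg _ h)
  obtain ⟨y, hy⟩ := φ.surjective u
  obtain ⟨z, hz⟩ := φ.surjective v
  by_cases hyv : y = v
  · exact Or.inr (hyv ▸ hy)
  by_cases hzu : z = u
  · exact Or.inl (hzu ▸ hz)
  by_cases hyu : y = u
  · exact absurd (hs.eq_of_left (hyu ▸ hy)) huv
  by_cases hzv : z = v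
  · exact absurd (hs.eq_of_right (hzv ▸ hz)) huv
  have hyz := (S.cutArc_eq_of_glue (Or.inl rfl) hy).symm.trans
    (h.trans (S.cutArc_eq_of_glue (Or.inr rfl) hz))
  rw [S.cutArc_of_ne u v ⟨y, hyu, hyv⟩, S.cutArc_of_ne u v ⟨z, hzu, hzv⟩] at hyz
  have hyz : y = z := congrArg Subtype.val (Sum.inl_injective hyz)
  exact absurd (hy.symm.trans ((congrArg φ hyz).trans hz)) huv

theorem Geometric.uncut {S T : MultCyc.{u}} {g : ℕ} {c d : T.carrier} (hS : S.Geometric (g + 1))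
    (κ : Iso (T.cut c d) S) (hcd : c ≠ d) (h : T.part c = T.part d ∨ Nat.card S.index ≤ g) :
    T.Geometric g := by
  obtain ⟨G, hG⟩ := hS
  have e := Nat.card_congr κ.indexEquiv
  by_cases hp : T.part c = T.part d
  · rw [card_index_cut_of_eq T hcd hp] at e
    exact ⟨G, by omega⟩
  · have h1 := card_index_cut_of_ne T hp
    have h2 := h.resolve_left hp
    exact ⟨G - 1, by omega⟩

theorem Iso.trans_symm_self {S T : MultCyc.{u}} (ρ : Iso S T) : ρ.trans ρ.symm = Iso.refl S :=
  Iso.ext_onArc fun α => by rw [Iso.onArc_trans, ρ.symm_onArc_onArc, Iso.onArc_refl]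

theorem Geometric.isCyc {S : MultCyc.{u}} (hS : S.Geometric 0) : S.IsCyc := by
  obtain ⟨G, hG⟩ := hS
  have hpos : 0 < Nat.card S.index := Nat.card_pos
  exact (Nat.card_eq_one_iff_unique.1 (by omega : Nat.card S.index = 1)).1

theorem Iso.isCyc {S T : MultCyc.{u}} (ρ : Iso S T) (hS : S.IsCyc) : T.IsCyc :=
  @Function.Injective.subsingleton _ _ _ ρ.indexEquiv.symm.injective hS

theorem part_ne_of_isCyc_cut (T : MultCyc.{u}) {c d : T.carrier} (hcd : c ≠ d)
    (h : (T.cut c d).IsCyc) : T.part c ≠ T.part d ∧ ∀ k, k = T.part c ∨ k = T.part d := by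
  have hcut : Nat.card (T.cut c d).index = 1 := Nat.card_eq_one_iff_unique.2 ⟨h, inferInstance⟩
  have hpos : 0 < Nat.card T.index := Nat.card_pos
  have hne : T.part c ≠ T.part d := fun hp => by
    rw [card_index_cut_of_eq T hcd hp] at hcut
    omega
  obtain ⟨j, -, unique⟩ := (Nat.card_eq_two_iff' (T.part c)).1
    ((card_index_cut_of_ne T hne).symm.trans (congrArg (· + 1) hcut))
  refine ⟨hne, fun k => or_iff_not_imp_left.2 fun hk => ?_⟩
  rw [unique k hk, unique _ hne.symm]

theorem part_ne_of_arcPart_cutArc_cutArc_ne (T : MultCyc.{u}) {a b c d : T.carrier} (hac : a ≠ c)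
    (had : a ≠ d) (hbc : b ≠ c) (hbd : b ≠ d) (hcd : T.part c ≠ T.part d)
    (h : ((T.cut c d).cut ⟨a, hac, had⟩ ⟨b, hbc, hbd⟩).arcPart
        ((T.cut c d).cutArc _ _ (T.cutArc c d (Sum.inl c))) ≠
      ((T.cut c d).cut ⟨a, hac, had⟩ ⟨b, hbc, hbd⟩).arcPart
        ((T.cut c d).cutArc _ _ (T.cutArc c d (Sum.inl d)))) :
    T.part a ≠ T.part b := by
  intro hab
  obtain ⟨θ, hθ⟩ := T.exists_cut_cut_iso hac had hbc hbd
  rw [← θ.indexEquiv.injective.ne_iff, ← θ.arcPart_onArc, ← θ.arcPart_onArc, hθ, hθ,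
    T.cutArc_of_ne a b ⟨c, hac.symm, hbc.symm⟩, T.cutArc_of_ne a b ⟨d, had.symm, hbd.symm⟩] at h
  have hcut := (GluePerm.mk_eq_iff _ _ _).1
    (Sum.inr_injective (part_eq_of_arcPart_cutArc_ne (T.cut a b) h))
  have not_cd : ¬ T.next.SameCycle c d := fun h => hcd ((T.part_eq_iff _ _).2 h)
  have hab := (T.part_eq_iff _ _).1 hab
  rcases GluePerm.sameCycle_glue_cases hcut with hcd | ⟨hc, hd⟩
  · exact not_cd hcd
  · exact not_cd ((hc.elim id hab.trans).symm.trans (hd.elim id hab.trans))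

end MultCyc

namespace NsModularOperad

open MultCyc

/-! ### Iterated contractions -/

variable {P : NsModularOperad.{u, v}} {g : ℕ} {S T : MultCyc.{u}}

theorem map_symm_map (ρ : Iso S T) (x : P.obj S g) : P.map ρ.symm (P.map ρ x) = x := by
  rw [← P.map_trans, Iso.trans_symm_self, P.map_refl]

/-- The elements obtained from a family `ς` of elements of genus zero by iterated contractions and
isomorphisms. The extension of `ς` to genus `g` consists of the reachable elements. -/
def Reachable (ς : ∀ C : CycSet.{u}, P.obj C.1 0) : ∀ (g : ℕ) (S : MultCyc.{u}), P.obj S g → Prop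
  | 0, S, x => ∃ hS : S.IsCyc, x = ς ⟨S, hS⟩
  | g + 1, S, x => ∃ (S' : MultCyc.{u}) (a b : S'.carrier) (hab : a ≠ b) (ρ : Iso (S'.cut a b) S)
      (y : P.obj S' g), Reachable ς g S' y ∧ x = P.map ρ (P.contr a b hab y)

/-- The element `x` is, up to an isomorphism, a contraction of a reachable element, and the two
points of the contraction are removed from the arcs `α` and `β`. -/
def ReachableAt (ς : ∀ C : CycSet.{u}, P.obj C.1 0) (g : ℕ) (S : MultCyc.{u}) (α β : S.Arc)
    (x : P.obj S (g + 1)) : Prop :=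
  ∃ (S' : MultCyc.{u}) (a b : S'.carrier) (hab : a ≠ b) (ρ : Iso (S'.cut a b) S) (y : P.obj S' g),
    Reachable ς g S' y ∧ x = P.map ρ (P.contr a b hab y) ∧
      ρ.onArc (S'.cutArc a b (Sum.inl a)) = α ∧ ρ.onArc (S'.cutArc a b (Sum.inl b)) = β

/-- Each component of genus `g` contains at most one reachable element. -/
def ReachableUnique (ς : ∀ C : CycSet.{u}, P.obj C.1 0) (g : ℕ) : Prop :=
  ∀ ⦃S : MultCyc.{u}⦄ ⦃x y : P.obj S g⦄, Reachable ς g S x → Reachable ς g S y → x = y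

variable {ς : ∀ C : CycSet.{u}, P.obj C.1 0}

theorem Reachable.contr {x : P.obj S g} (hx : Reachable ς g S x) {a b : S.carrier} (hab : a ≠ b) :
    Reachable ς (g + 1) (S.cut a b) (P.contr a b hab x) :=
  ⟨S, a, b, hab, Iso.refl _, x, hx, (P.map_refl _).symm⟩

theorem Reachable.exists_reachableAt {x : P.obj S (g + 1)} (hx : Reachable ς (g + 1) S x) :
    ∃ α β, ReachableAt ς g S α β x := by
  obtain ⟨S', a, b, hab, ρ, y, hy, rfl⟩ := hx
  exact ⟨_, _, S', a, b, hab, ρ, y, hy, rfl, rfl, rfl⟩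

theorem reachableUnique_zero : ReachableUnique ς 0 := by
  rintro S _ _ ⟨_, rfl⟩ ⟨_, rfl⟩
  rfl

theorem Reachable.eq_of_isInternal {ϖ : ∀ (S : MultCyc.{u}) (g : ℕ), S.Geometric g → P.obj S g}
    (hϖ : P.IsInternal ϖ) (hzero : ∀ C : CycSet.{u}, ϖ C.1 0 C.2.geometric_zero = ς C)
    (hS : S.Geometric g) {x : P.obj S g} (hx : Reachable ς g S x) : ϖ S g hS = x := by
  induction g generalizing S with
  | zero =>
    obtain ⟨hC, rfl⟩ := hx
    exact hzero ⟨S, hC⟩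
  | succ g ih =>
    obtain ⟨S', a, b, hab, ρ, y, hy, rfl⟩ := hx
    have hS' := P.geometric y
    rw [← ih hS' hy, hϖ.contr a b hab hS' (hS'.cut hab), hϖ.map ρ _ hS]

section

variable (hς : (forget.obj P).IsInternal ς)
include hς

theorem Reachable.map {x : P.obj S g} (hx : Reachable ς g S x) (ρ : Iso S T) :
    Reachable ς g T (P.map ρ x) := by
  cases g with
  | zero =>
    obtain ⟨hS, rfl⟩ := hx
    exact ⟨ρ.isCyc hS, hς.map (C := ⟨S, hS⟩) (D := ⟨T, ρ.isCyc hS⟩) ρ⟩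
  | succ g =>
    obtain ⟨S', a, b, hab, τ, y, hy, rfl⟩ := hx
    exact ⟨S', a, b, hab, τ.trans ρ, y, hy, (P.map_trans _ _ _).symm⟩

theorem Reachable.comp_of_zero {h : ℕ} {y : P.obj T h}
    (hzero : ∀ (C : CycSet.{u}) (a : C.1.carrier) (b : T.carrier) (k : ℕ) (hk : 0 + h = k),
      Reachable ς k (C.1.merge T a b) (P.comp a b hk (ς C) y))
    {k : ℕ} {x : P.obj S g} (hx : Reachable ς g S x) (a : S.carrier) (b : T.carrier)
    (hk : g + h = k) : Reachable ς k (S.merge T a b) (P.comp a b hk x y) := by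
  induction g generalizing S k with
  | zero =>
    obtain ⟨hS, rfl⟩ := hx
    exact hzero ⟨S, hS⟩ a b k hk
  | succ g ih =>
    obtain ⟨S', c, d, hcd, ρ, x, hx, rfl⟩ := hx
    obtain rfl : k = g + h + 1 := by omega
    obtain ⟨⟨a, hac, had⟩, rfl⟩ := ρ.toEquiv.surjective a
    obtain ⟨θ, hl, hr⟩ := exists_merge_cut_iso S' T b hac had
    obtain ⟨τ, hl', hr'⟩ := exists_merge_iso ρ (Iso.refl T) ⟨a, hac, had⟩ b
    have comp_contr : Reachable ς (g + h + 1) _ (P.comp (S := S'.cut c d) ⟨a, hac, had⟩ b hk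
        (P.contr c d hcd x) y) := by
      rw [← map_symm_map θ (P.comp _ _ _ _ _),
        P.comp_contr rfl hk a c d b hac had hcd x y θ hl hr]
      exact ((ih hx a rfl).contr _).map hς _
    have map_comp := comp_contr.map hς τ
    rwa [P.map_comp hk ρ (Iso.refl T) ⟨a, hac, had⟩ b _ y τ hl' hr', P.map_refl] at map_comp

theorem Reachable.comp {h k : ℕ} {x : P.obj S g} {y : P.obj T h} (hx : Reachable ς g S x)
    (hy : Reachable ς h T y) (a : S.carrier) (b : T.carrier) (hk : g + h = k) :
    Reachable ς k (S.merge T a b) (P.comp a b hk x y) := by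
  refine Reachable.comp_of_zero hς (fun C a b k hk => ?_) hx a b hk
  obtain ⟨θ, hl, hr⟩ := exists_merge_swap_iso C.1 T a b
  have hk' := (add_comm _ _).trans hk
  rw [← P.comp_symm a b hk hk' _ _ θ hl hr]
  refine Reachable.map hς ?_ θ
  refine Reachable.comp_of_zero hς (fun D a b k hk => ?_) hy b a hk'
  obtain rfl := hk
  exact ⟨D.2.merge C.2 a b, hς.comp a b⟩

theorem exists_reachable (hS : S.Geometric g) : ∃ x, Reachable ς g S x := by
  induction g generalizing S with
  | zero => exact ⟨ς ⟨S, hS.isCyc⟩, hS.isCyc, rfl⟩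
  | succ g ih =>
    suffices ∃ γ δ, S.arcPart γ ≠ S.arcPart δ ∨ Nat.card S.index ≤ g by
      obtain ⟨γ, δ, h⟩ := this
      obtain ⟨T, c, d, κ, hcd, rfl, rfl⟩ := S.exists_uncut γ δ
      rw [κ.arcPart_onArc, κ.arcPart_onArc, κ.indexEquiv.injective.ne_iff] at h
      obtain ⟨z, hz⟩ := ih (hS.uncut κ hcd (h.imp_left (part_eq_of_arcPart_cutArc_ne T)))
      exact ⟨_, (hz.contr hcd).map hς κ⟩
    obtain ⟨G, hG⟩ := hS
    by_cases h : Nat.card S.index ≤ g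
    · obtain ⟨γ, -⟩ := S.arcPart_surjective (Classical.arbitrary _)
      exact ⟨γ, γ, Or.inr h⟩
    · obtain ⟨i, j, hij⟩ := Finite.one_lt_card_iff_nontrivial.1 (by omega : 1 < Nat.card S.index)
      obtain ⟨γ, rfl⟩ := S.arcPart_surjective i
      obtain ⟨δ, rfl⟩ := S.arcPart_surjective j
      exact ⟨γ, δ, Or.inl hij⟩

end

/-! ### Contractions at prescribed arcs -/

theorem Reachable.reachableAt_contr {x : P.obj S g} (hx : Reachable ς g S x) {a b : S.carrier}
    (hab : a ≠ b) : ReachableAt ς g (S.cut a b) (S.cutArc a b (Sum.inl a))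
      (S.cutArc a b (Sum.inl b)) (P.contr a b hab x) :=
  ⟨S, a, b, hab, Iso.refl _, x, hx, (P.map_refl _).symm, Iso.onArc_refl _, Iso.onArc_refl _⟩

theorem ReachableAt.map {α β : S.Arc} {x : P.obj S (g + 1)} (hx : ReachableAt ς g S α β x)
    (ρ : Iso S T) : ReachableAt ς g T (ρ.onArc α) (ρ.onArc β) (P.map ρ x) := by
  obtain ⟨S', a, b, hab, τ, y, hy, rfl, rfl, rfl⟩ := hx
  exact ⟨S', a, b, hab, τ.trans ρ, y, hy, (P.map_trans _ _ _).symm, Iso.onArc_trans _ _ _,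
    Iso.onArc_trans _ _ _⟩

theorem ReachableAt.symm {α β : S.Arc} {x : P.obj S (g + 1)} (hx : ReachableAt ς g S α β x) :
    ReachableAt ς g S β α x := by
  obtain ⟨S', a, b, hab, ρ, y, hy, rfl, rfl, rfl⟩ := hx
  obtain ⟨θ, hθ⟩ := S'.exists_cut_swap_iso a b
  have h := ((hy.reachableAt_contr hab.symm).map θ).map ρ
  rwa [hθ, hθ, P.contr_symm a b hab y θ hθ] at h

theorem ReachableAt.arcPart_ne {α β : S.Arc} {x : P.obj S 1} (hx : ReachableAt ς 0 S α β x) :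
    S.arcPart α ≠ S.arcPart β := by
  obtain ⟨S', a, b, hab, ρ, y, -, -, rfl, rfl⟩ := hx
  have : Subsingleton S'.index := (P.geometric y).isCyc
  rw [ρ.arcPart_onArc, ρ.arcPart_onArc, ρ.indexEquiv.injective.ne_iff]
  exact S'.arcPart_cutArc_ne_of_part_eq hab (Subsingleton.elim _ _)

theorem ReachableAt.contr_swap {a b : S.carrier} (hab : a ≠ b) {ε ζ : S.Arc} {y : P.obj S g}
    (h : ReachableAt ς g (S.cut b a) (S.cutArc b a ε) (S.cutArc b a ζ) (P.contr b a hab.symm y)) :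
    ReachableAt ς g (S.cut a b) (S.cutArc a b ε) (S.cutArc a b ζ) (P.contr a b hab y) := by
  obtain ⟨θ, hθ⟩ := S.exists_cut_swap_iso a b
  have h := h.map θ
  rwa [hθ, hθ, P.contr_symm a b hab y θ hθ] at h

theorem ReachableAt.contr_map (κ : Iso S T) {a b : S.carrier} (hab : a ≠ b) {a' b' : T.carrier}
    (ha : κ.toEquiv a = a') (hb : κ.toEquiv b = b') (hab' : a' ≠ b') {ε ζ : S.Arc} {y : P.obj S g}
    (h : ReachableAt ς g (S.cut a b) (S.cutArc a b ε) (S.cutArc a b ζ) (P.contr a b hab y)) :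
    ReachableAt ς g (T.cut a' b') (T.cutArc a' b' (κ.onArc ε)) (T.cutArc a' b' (κ.onArc ζ))
      (P.contr a' b' hab' (P.map κ y)) := by
  subst ha hb
  obtain ⟨θ, hθ⟩ := exists_cut_iso κ (a := a) (b := b) rfl rfl
  have h := h.map θ
  rwa [hθ, hθ, P.map_contr κ a b hab y θ hθ] at h

theorem ReachableAt.exists_next_eq_self {α : S.Arc} {x : P.obj S (g + 1)}
    (hx : ReachableAt ς g S α α x) :
    ∃ (S' : MultCyc.{u}) (a b : S'.carrier) (hab : a ≠ b) (ρ : Iso (S'.cut a b) S) (y : P.obj S' g),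
      Reachable ς g S' y ∧ x = P.map ρ (P.contr a b hab y) ∧
        ρ.onArc (S'.cutArc a b (Sum.inl a)) = α ∧ ρ.onArc (S'.cutArc a b (Sum.inl b)) = α ∧
          S'.next a = a := by
  obtain ⟨S', a, b, hab, ρ, y, hy, rfl, ha, hb⟩ := hx
  rcases S'.next_eq_self_of_cutArc_eq hab (ρ.onArc_injective (ha.trans hb.symm)) with h | h
  · exact ⟨S', a, b, hab, ρ, y, hy, rfl, ha, hb, h⟩
  · obtain ⟨θ, hθ⟩ := S'.exists_cut_swap_iso a b
    refine ⟨S', b, a, hab.symm, θ.trans ρ, y, hy, ?_, ?_, ?_, h⟩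
    · rw [P.map_trans, P.contr_symm a b hab y θ hθ]
    · rw [Iso.onArc_trans, hθ, hb]
    · rw [Iso.onArc_trans, hθ, ha]

theorem Reachable.reachableAt_contr_of_cut {a b c d : S.carrier} (hac : a ≠ c) (had : a ≠ d)
    (hbc : b ≠ c) (hbd : b ≠ d) (hcd : c ≠ d) {z : P.obj (S.cut a b) g}
    (hz : Reachable ς g (S.cut a b) z) :
    ReachableAt ς g ((S.cut a b).cut ⟨c, hac.symm, hbc.symm⟩ ⟨d, had.symm, hbd.symm⟩)
      ((S.cut a b).cutArc _ _ (S.cutArc a b (Sum.inl c)))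
      ((S.cut a b).cutArc _ _ (S.cutArc a b (Sum.inl d)))
      (P.contr (S := S.cut a b) ⟨c, hac.symm, hbc.symm⟩ ⟨d, had.symm, hbd.symm⟩
        (fun h => hcd (congrArg Subtype.val h)) z) := by
  rw [S.cutArc_of_ne a b ⟨c, hac.symm, hbc.symm⟩, S.cutArc_of_ne a b ⟨d, had.symm, hbd.symm⟩]
  exact hz.reachableAt_contr _

theorem Reachable.reachableAt_contr_contr {a b c d : S.carrier} (hac : a ≠ c) (had : a ≠ d)
    (hbc : b ≠ c) (hbd : b ≠ d) (hab : a ≠ b) (hcd : c ≠ d) {z : P.obj S g}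
    (hz : Reachable ς g S z) :
    ReachableAt ς (g + 1) ((S.cut c d).cut ⟨a, hac, had⟩ ⟨b, hbc, hbd⟩)
      ((S.cut c d).cutArc _ _ (S.cutArc c d (Sum.inl c)))
      ((S.cut c d).cutArc _ _ (S.cutArc c d (Sum.inl d)))
      (P.contr (S := S.cut c d) ⟨a, hac, had⟩ ⟨b, hbc, hbd⟩
        (fun h => hab (congrArg Subtype.val h)) (P.contr c d hcd z)) := by
  obtain ⟨θ, hθ⟩ := S.exists_cut_cut_iso hac.symm hbc.symm had.symm hbd.symm
  have h := ((hz.contr hab).reachableAt_contr_of_cut hac had hbc hbd hcd).map θ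
  rwa [hθ, hθ, P.contr_contr c d a b hcd hac.symm hbc.symm had.symm hbd.symm hab z θ hθ] at h

theorem Reachable.reachableAt_contr_comp {h k : ℕ} {a c : S.carrier} {b d : T.carrier}
    (hac : a ≠ c) (hbd : b ≠ d) (hk : g + h = k) {x : P.obj S g} {y : P.obj T h}
    (hxy : Reachable ς k (S.merge T a b) (P.comp a b hk x y)) :
    ReachableAt ς k ((S.merge T c d).cut (Graft.left a hac) (Graft.right b hbd))
      ((S.merge T c d).cutArc _ _ (S.mergeArcLeft T c d (Sum.inl c)))
      ((S.merge T c d).cutArc _ _ (S.mergeArcRight T c d (Sum.inl d)))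
      (P.contr (Graft.left a hac) (Graft.right b hbd)
        (fun h => Sum.inl_ne_inr (congrArg Subtype.val h)) (P.comp c d hk x y)) := by
  have hac' := (Sum.inl_injective (β := T.carrier)).ne hac
  have hbd' := (Sum.inr_injective (α := S.carrier)).ne hbd
  obtain ⟨θ, hθ⟩ := (S.disjointUnion T).exists_cut_cut_iso hac'.symm Sum.inr_ne_inl.symm
    Sum.inl_ne_inr.symm hbd'.symm
  have h := (Reachable.reachableAt_contr_of_cut (S := S.disjointUnion T) hac' Sum.inl_ne_inr
    Sum.inr_ne_inl hbd' Sum.inl_ne_inr hxy).map θ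
  rw [hθ, hθ] at h
  exact (congrArg (ReachableAt ς k _ _ _) (P.contr_comp hk c a d b hac.symm hbd.symm x y θ
    (fun α => hθ (unionArcLeft S T α)) fun α => hθ (unionArcRight S T α))).mp h

end NsModularOperad

theorem exists_ne_not_mem_pairs {I : Type*} [Finite I] (hI : 2 < Nat.card I) (a b a' b' : I) :
    ∃ i j, i ≠ j ∧ ¬((i = a ∨ i = b) ∧ (j = a ∨ j = b)) ∧
      ¬((i = a' ∨ i = b') ∧ (j = a' ∨ j = b')) := by
  have exists_ne_ne (a b : I) : ∃ x, x ≠ a ∧ x ≠ b := by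
    classical
    have := Fintype.ofFinite I
    rw [Nat.card_eq_fintype_card] at hI
    obtain ⟨x, -, hx⟩ := Finset.exists_mem_notMem_of_card_lt_card
      ((Finset.card_le_two (a := a) (b := b)).trans_lt hI)
    exact ⟨x, by simpa using hx⟩
  obtain ⟨x, hxa, hxb⟩ := exists_ne_ne a b
  obtain ⟨y, hya, hyb⟩ := exists_ne_ne a' b'
  obtain rfl | hxy := eq_or_ne x y
  · obtain ⟨z, hz, -⟩ := exists_ne_ne x x
    exact ⟨z, x, hz, by tauto, by tauto⟩
  · exact ⟨x, y, hxy, by tauto, by tauto⟩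

namespace MultCyc

theorem exists_merge_partSet_iso (S : MultCyc.{u}) {c d : S.carrier} (hcd : S.part c ≠ S.part d)
    (h : ∀ k, k = S.part c ∨ k = S.part d) :
    let C := (S.partSet (S.part c)).1
    let D := (S.partSet (S.part d)).1
    let c' : C.carrier := ⟨c, rfl⟩
    let d' : D.carrier := ⟨d, rfl⟩
    ∃ θ : Iso (C.merge D c' d') (S.cut c d),
      (∀ x (hx : x ≠ c'), (θ.toEquiv (Graft.left x hx)).1 = x.1) ∧
      (∀ x (hx : x ≠ d'), (θ.toEquiv (Graft.right x hx)).1 = x.1) ∧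
      (∀ x, θ.onArc (C.mergeArcLeft D c' d' (Sum.inl x)) = S.cutArc c d (Sum.inl x.1)) ∧
      ∀ x, θ.onArc (C.mergeArcRight D c' d' (Sum.inl x)) = S.cutArc c d (Sum.inl x.1) := by
  intro C D c' d'
  obtain ⟨σ, hl, hr⟩ := S.exists_union_iso hcd h
  obtain ⟨θ, hθ⟩ := exists_cut_iso σ (hl c') (hr d')
  have val_of_arc {x : (C.merge D c' d').carrier} {y : S.carrier}
      (hxy : θ.onArc ((C.disjointUnion D).cutArc (Sum.inl c') (Sum.inr d') (Sum.inl x.1)) =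
        S.cutArc c d (Sum.inl y)) (hy : y ≠ c ∧ y ≠ d) : (θ.toEquiv x).1 = y :=
    congrArg Subtype.val <| Sum.inl_injective (β := (S.cut c d).EmptyPart) <|
      (congrArg θ.onArc (cutArc_of_ne (C.disjointUnion D) (Sum.inl c') (Sum.inr d') x).symm).trans
        (hxy.trans (S.cutArc_of_ne c d ⟨y, hy⟩))
  have arc_left (x) : θ.onArc (C.mergeArcLeft D c' d' (Sum.inl x)) = S.cutArc c d (Sum.inl x.1) :=
    (hθ (Sum.inl (Sum.inl x))).trans (congrArg (fun x => S.cutArc c d (Sum.inl x)) (hl x))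
  have arc_right (x) : θ.onArc (C.mergeArcRight D c' d' (Sum.inl x)) = S.cutArc c d (Sum.inl x.1) :=
    (hθ (Sum.inl (Sum.inr x))).trans (congrArg (fun x => S.cutArc c d (Sum.inl x)) (hr x))
  refine ⟨θ, fun x hx => val_of_arc (arc_left x) ⟨fun h => hx (Subtype.ext h), fun h => ?_⟩,
    fun x hx => val_of_arc (arc_right x) ⟨fun h => ?_, fun h => hx (Subtype.ext h)⟩,
    arc_left, arc_right⟩
  · exact hcd (x.2.symm.trans (congrArg S.part h))
  · exact hcd ((congrArg S.part h).symm.trans x.2)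

end MultCyc

namespace NsModularOperad

open MultCyc

variable {P : NsModularOperad.{u, v}} {g : ℕ} {R S : MultCyc.{u}}
  {ς : ∀ C : CycSet.{u}, P.obj C.1 0} (hς : (forget.obj P).IsInternal ς)
include hς

/-! ### Moving the arcs of a contraction -/

theorem ReachableUnique.map_contr_eq (hg : ReachableUnique ς g) {S' : MultCyc.{u}}
    {a b : S.carrier} {a' b' : S'.carrier} (hab : a ≠ b) (hab' : a' ≠ b') (ρ : Iso (S.cut a b) R)
    (ρ' : Iso (S'.cut a' b') R) {x : P.obj S g} {x' : P.obj S' g}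
    (hx : Reachable ς g S x) (hx' : Reachable ς g S' x')
    (ha : ρ.onArc (S.cutArc a b (Sum.inl a)) = ρ'.onArc (S'.cutArc a' b' (Sum.inl a')))
    (hb : ρ.onArc (S.cutArc a b (Sum.inl b)) = ρ'.onArc (S'.cutArc a' b' (Sum.inl b')))
    (h : S.cutArc a b (Sum.inl a) ≠ S.cutArc a b (Sum.inl b) ∨
      (S.next a = a ∧ S'.next a' = a')) :
    P.map ρ (P.contr a b hab x) = P.map ρ' (P.contr a' b' hab' x') := by
  obtain ⟨σ, rfl, rfl, hσ⟩ := exists_iso_of_cut_iso (ρ.trans ρ'.symm)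
    (by rw [Iso.onArc_trans, ha, ρ'.symm_onArc_onArc])
    (by rw [Iso.onArc_trans, hb, ρ'.symm_onArc_onArc]) hab hab' h
  obtain ⟨θ, hθ⟩ := exists_cut_iso σ (a := a) (b := b) rfl rfl
  have hρ : ρ = θ.trans ρ' := Iso.ext_onArc fun α => by
    obtain ⟨β, rfl⟩ := S.cutArc_surjective a b α
    rw [Iso.onArc_trans, hθ, ← hσ, Iso.onArc_trans, ρ'.onArc_symm_onArc]
  rw [hρ, P.map_trans, P.map_contr σ a b hab x θ hθ, hg (hx.map hς σ) hx']

theorem ReachableAt.unique (hg : ReachableUnique ς g) {α β : S.Arc} {x y : P.obj S (g + 1)}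
    (hx : ReachableAt ς g S α β x) (hy : ReachableAt ς g S α β y) : x = y := by
  by_cases hαβ : α = β
  · subst hαβ
    obtain ⟨_, _, _, hab, ρ, x', hx', rfl, ha, hb, hnext⟩ := hx.exists_next_eq_self
    obtain ⟨_, _, _, hab', ρ', y', hy', rfl, ha', hb', hnext'⟩ := hy.exists_next_eq_self
    exact hg.map_contr_eq hς hab hab' ρ ρ' hx' hy' (ha.trans ha'.symm) (hb.trans hb'.symm)
      (Or.inr ⟨hnext, hnext'⟩)
  · obtain ⟨_, _, _, hab, ρ, x, hx, rfl, rfl, rfl⟩ := hx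
    obtain ⟨_, _, _, hab', ρ', y, hy, rfl, ha', hb'⟩ := hy
    exact hg.map_contr_eq hς hab hab' ρ ρ' hx hy ha'.symm hb'.symm
      (Or.inl (ne_of_apply_ne ρ.onArc hαβ))

theorem Reachable.reachableAt_contr_succ (hg : ReachableUnique ς (g + 1)) {y : P.obj S (g + 1)}
    (hy : Reachable ς (g + 1) S y) {a b : S.carrier} (hab : a ≠ b) {ε ζ : S.Arc}
    (h : S.arcPart ε ≠ S.arcPart ζ ∨ Nat.card S.index ≤ g) :
    ReachableAt ς (g + 1) (S.cut a b) (S.cutArc a b ε) (S.cutArc a b ζ) (P.contr a b hab y) := by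
  obtain ⟨T, c, d, κ, hcd, rfl, rfl⟩ := S.exists_uncut ε ζ
  rw [κ.arcPart_onArc, κ.arcPart_onArc, κ.indexEquiv.injective.ne_iff] at h
  obtain ⟨z, hz⟩ := exists_reachable hς
    ((P.geometric y).uncut κ hcd (h.imp_left (part_eq_of_arcPart_cutArc_ne T)))
  obtain rfl := hg ((hz.contr hcd).map hς κ) hy
  obtain ⟨⟨a, hac, had⟩, rfl⟩ := κ.toEquiv.surjective a
  obtain ⟨⟨b, hbc, hbd⟩, rfl⟩ := κ.toEquiv.surjective b
  have hab' : a ≠ b := fun h => hab (by subst h; rfl)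
  exact (hz.reachableAt_contr_contr hac had hbc hbd hab' hcd).contr_map κ _ rfl rfl hab

theorem ReachableAt.of_card_le (hg : ReachableUnique ς (g + 1)) (hR : Nat.card R.index ≤ g + 1)
    {α β : R.Arc} {x : P.obj R (g + 1 + 1)} (hx : ReachableAt ς (g + 1) R α β x) (ζ : R.Arc) :
    ReachableAt ς (g + 1) R α ζ x := by
  obtain ⟨S, a, b, hab, ρ, y, hy, rfl, rfl, rfl⟩ := hx
  obtain ⟨ζ, rfl⟩ := ρ.onArc_surjective ζ
  obtain ⟨ζ, rfl⟩ := S.cutArc_surjective a b ζ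
  suffices ∃ ε, S.cutArc a b (Sum.inl a) = S.cutArc a b ε ∧
      (S.arcPart ε ≠ S.arcPart ζ ∨ Nat.card S.index ≤ g) by
    obtain ⟨ε, hε, h⟩ := this
    rw [hε]
    exact (hy.reachableAt_contr_succ hς hg hab h).map ρ
  by_cases hS : Nat.card S.index ≤ g
  · exact ⟨_, rfl, Or.inr hS⟩
  have hne : S.part a ≠ S.part b := fun hp => by
    have hcard := Nat.card_congr ρ.indexEquiv
    rw [card_index_cut_of_eq S hab hp] at hcard
    obtain ⟨G, hG⟩ := P.geometric y
    omega
  by_cases hζ : S.part a = S.arcPart ζ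
  · refine ⟨S.endArc b, S.cutArc_start_left a b, Or.inl ?_⟩
    rw [arcPart_endArc, ← hζ]
    exact hne.symm
  · exact ⟨_, rfl, Or.inl hζ⟩

theorem ReachableAt.of_arcPart_ne (hg : ReachableUnique ς (g + 1)) {α β ε ζ : R.Arc}
    {x : P.obj R (g + 1 + 1)} (hx : ReachableAt ς (g + 1) R α β x)
    (h : R.arcPart ε ≠ R.arcPart ζ)
    (h' : ¬((R.arcPart ε = R.arcPart α ∨ R.arcPart ε = R.arcPart β) ∧
      (R.arcPart ζ = R.arcPart α ∨ R.arcPart ζ = R.arcPart β))) :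
    ReachableAt ς (g + 1) R ε ζ x := by
  obtain ⟨S, a, b, hab, ρ, y, hy, rfl, rfl, rfl⟩ := hx
  obtain ⟨ε, rfl⟩ := (ρ.onArc_surjective.comp (S.cutArc_surjective a b)) ε
  obtain ⟨ζ, rfl⟩ := (ρ.onArc_surjective.comp (S.cutArc_surjective a b)) ζ
  simp only [Function.comp_apply, ρ.arcPart_onArc, ρ.indexEquiv.injective.eq_iff, ne_eq] at h h'
  refine (hy.reachableAt_contr_succ hς hg hab (Or.inl fun hp => ?_)).map ρ
  exact (S.arcPart_cutArc_cases a b hp).elim h h'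

/-! ### Genus zero -/

theorem Reachable.reachableAt_contr_of_two_parts {T : MultCyc.{u}} {c d : T.carrier}
    (hcd : T.part c ≠ T.part d) (hT : ∀ k, k = T.part c ∨ k = T.part d) {a b : Without c d}
    (hac : T.part a.1 = T.part c) (hbd : T.part b.1 = T.part d) (hab : a ≠ b)
    {y : P.obj (T.cut c d) 0} (hy : Reachable ς 0 (T.cut c d) y) :
    ReachableAt ς 0 ((T.cut c d).cut a b) ((T.cut c d).cutArc _ _ (T.cutArc c d (Sum.inl c)))
      ((T.cut c d).cutArc _ _ (T.cutArc c d (Sum.inl d)))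
      (P.contr (S := T.cut c d) a b hab y) := by
  let C := T.partSet (T.part c)
  let D := T.partSet (T.part d)
  obtain ⟨θ, hl, hr, arc_left, arc_right⟩ := T.exists_merge_partSet_iso hcd hT
  have hac' : (⟨a.1, hac⟩ : C.1.carrier) ≠ ⟨c, rfl⟩ := fun h => a.2.1 (congrArg Subtype.val h)
  have hbd' : (⟨b.1, hbd⟩ : D.1.carrier) ≠ ⟨d, rfl⟩ := fun h => b.2.2 (congrArg Subtype.val h)
  have reachable_comp {e : C.1.carrier} {f : D.1.carrier} :
      Reachable ς 0 (C.1.merge D.1 e f) (P.comp e f (zero_add 0) (ς C) (ς D)) :=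
    ⟨C.2.merge D.2 e f, hς.comp e f⟩
  obtain rfl := reachableUnique_zero (Reachable.map hς reachable_comp θ) hy
  have h := (reachableAt_contr_comp hac' hbd' (zero_add 0) reachable_comp).contr_map θ _
    (Subtype.ext (hl _ hac')) (Subtype.ext (hr _ hbd')) hab
  rwa [← arc_left ⟨c, rfl⟩, ← arc_right ⟨d, rfl⟩]

theorem Reachable.reachableAt_contr_zero {y : P.obj S 0} (hy : Reachable ς 0 S y)
    {a b : S.carrier} (hab : a ≠ b) {ε ζ : S.Arc}
    (h : (S.cut a b).arcPart (S.cutArc a b ε) ≠ (S.cut a b).arcPart (S.cutArc a b ζ)) :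
    ReachableAt ς 0 (S.cut a b) (S.cutArc a b ε) (S.cutArc a b ζ) (P.contr a b hab y) := by
  obtain ⟨T, c, d, κ, hcd, rfl, rfl⟩ := S.exists_uncut ε ζ
  have hcut : (T.cut c d).IsCyc := κ.symm.isCyc (P.geometric y).isCyc
  obtain ⟨z, hz⟩ : ∃ z, Reachable ς 0 (T.cut c d) z := ⟨_, hcut, rfl⟩
  obtain rfl := reachableUnique_zero (hz.map hς κ) hy
  obtain ⟨hcd, hT⟩ := T.part_ne_of_isCyc_cut hcd hcut
  obtain ⟨⟨a, hac, had⟩, rfl⟩ := κ.toEquiv.surjective a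
  obtain ⟨⟨b, hbc, hbd⟩, rfl⟩ := κ.toEquiv.surjective b
  obtain ⟨θ, hθ⟩ := exists_cut_iso κ (a := ⟨a, hac, had⟩) (b := ⟨b, hbc, hbd⟩) rfl rfl
  rw [← hθ, ← hθ, θ.arcPart_onArc, θ.arcPart_onArc, θ.indexEquiv.injective.ne_iff] at h
  have hab' := T.part_ne_of_arcPart_cutArc_cutArc_ne hac had hbc hbd hcd h
  refine ReachableAt.contr_map κ (ne_of_apply_ne _ hab) rfl rfl hab ?_
  rcases hT (T.part a) with ha | ha
  · have hb := (hT (T.part b)).resolve_left (ha ▸ hab'.symm)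
    exact hz.reachableAt_contr_of_two_parts hς hcd hT ha hb _
  · have hb := (hT (T.part b)).resolve_right (ha ▸ hab'.symm)
    exact (hz.reachableAt_contr_of_two_parts hς hcd hT hb ha _).contr_swap _

theorem Reachable.reachableAt_zero {x : P.obj R 1} (hx : Reachable ς 1 R x) {α β : R.Arc}
    (h : R.arcPart α ≠ R.arcPart β) : ReachableAt ς 0 R α β x := by
  obtain ⟨S, a, b, hab, ρ, y, hy, rfl⟩ := hx
  obtain ⟨α, rfl⟩ := (ρ.onArc_surjective.comp (S.cutArc_surjective a b)) α
  obtain ⟨β, rfl⟩ := (ρ.onArc_surjective.comp (S.cutArc_surjective a b)) β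
  simp only [Function.comp_apply, ρ.arcPart_onArc, ρ.indexEquiv.injective.ne_iff] at h
  exact (hy.reachableAt_contr_zero hς hab h).map ρ

/-! ### Uniqueness -/

theorem ReachableUnique.succ_zero : ReachableUnique ς 1 := by
  intro R x y hx hy
  obtain ⟨α, β, hy⟩ := hy.exists_reachableAt
  exact ReachableAt.unique hς reachableUnique_zero
    (hx.reachableAt_zero hς hy.arcPart_ne) hy

theorem ReachableUnique.succ_succ (hg : ReachableUnique ς (g + 1)) :
    ReachableUnique ς (g + 1 + 1) := by
  intro R x y hx hy
  obtain ⟨α, β, hx⟩ := hx.exists_reachableAt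
  obtain ⟨α', β', hy⟩ := hy.exists_reachableAt
  by_cases hR : Nat.card R.index ≤ g + 1
  · exact ReachableAt.unique hς hg (hx.of_card_le hς hg hR α') (hy.of_card_le hς hg hR α).symm
  obtain ⟨G, hG⟩ := P.geometric x
  obtain ⟨i, j, hij, hx_ij, hy_ij⟩ := exists_ne_not_mem_pairs (by omega : 2 < Nat.card R.index)
    (R.arcPart α) (R.arcPart β) (R.arcPart α') (R.arcPart β')
  obtain ⟨ε, rfl⟩ := R.arcPart_surjective i
  obtain ⟨ζ, rfl⟩ := R.arcPart_surjective j
  exact ReachableAt.unique hς hg (hx.of_arcPart_ne hς hg hij hx_ij)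
    (hy.of_arcPart_ne hς hg hij hy_ij)

theorem reachableUnique (g : ℕ) : ReachableUnique ς g := by
  induction g with
  | zero => exact reachableUnique_zero
  | succ g ih =>
    cases g with
    | zero => exact ReachableUnique.succ_zero hς
    | succ g => exact ih.succ_succ hς

end NsModularOperad

/-! ### The non-`Σ` envelope -/

namespace NsCyclicOperad

variable {P : NsCyclicOperad.{u, v}}

theorem nonempty_isTerminal_point : Nonempty (Limits.IsTerminal point.{u, v}) :=
  ⟨Limits.IsTerminal.ofUniqueHom
    (fun _ => Hom.mk (fun _ _ => PUnit.unit) (fun _ _ => rfl) (fun _ _ _ _ => rfl))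
    fun _ _ => rfl⟩

theorem isInternal_of_hom (f : point ⟶ P) : P.IsInternal fun C => Hom.app f C PUnit.unit where
  map ρ := (Hom.app_map f ρ PUnit.unit).symm
  comp a b := (Hom.app_comp f a b PUnit.unit PUnit.unit).symm

end NsCyclicOperad

namespace NsModularOperad

variable {P : NsModularOperad.{u, v}}

theorem nonempty_isTerminal_point : Nonempty (Limits.IsTerminal point.{u, v}) :=
  ⟨Limits.IsTerminal.ofUniqueHom
    (fun P => Hom.mk (fun _ _ x => ⟨PUnit.unit, P.geometric x⟩) (fun _ _ => rfl)
      (fun _ _ _ _ _ => rfl) fun _ _ _ _ => rfl)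
    fun _ _ => rfl⟩

theorem isInternal_of_hom (F : point ⟶ P) :
    P.IsInternal fun S g hS => Hom.app F S g ⟨PUnit.unit, hS⟩ where
  map ρ hS _ := (Hom.app_map F ρ ⟨PUnit.unit, hS⟩).symm
  comp a b hk hS hT _ := (Hom.app_comp F a b hk ⟨PUnit.unit, hS⟩ ⟨PUnit.unit, hT⟩).symm
  contr a b hab hS _ := (Hom.app_contr F a b hab ⟨PUnit.unit, hS⟩).symm

/-- The morphism from the one-point operad that corresponds to an internal operad. -/
def IsInternal.hom {ϖ : ∀ (S : MultCyc.{u}) (g : ℕ), S.Geometric g → P.obj S g}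
    (hϖ : P.IsInternal ϖ) : point ⟶ P :=
  Hom.mk (fun S g x => ϖ S g x.2) (fun ρ _ => (hϖ.map ρ _ _).symm)
    (fun a b hk _ _ => (hϖ.comp a b hk _ _ _).symm) fun a b hab _ => (hϖ.contr a b hab _ _).symm

theorem existsUnique_isInternal (P : NsModularOperad.{u, v}) (ς : ∀ C : CycSet.{u}, P.obj C.1 0)
    (hς : (forget.obj P).IsInternal ς) :
    ∃! ϖ : ∀ (S : MultCyc.{u}) (g : ℕ), S.Geometric g → P.obj S g,
      P.IsInternal ϖ ∧ ∀ C : CycSet.{u}, ϖ C.1 0 C.2.geometric_zero = ς C := by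
  choose ϖ hϖ using fun (S : MultCyc.{u}) (g : ℕ) (hS : S.Geometric g) => exists_reachable hς hS
  refine ⟨ϖ, ⟨⟨fun ρ hS hT => ?_, fun a b hk hS hT hST => ?_, fun a b hab hS hS' => ?_⟩,
    fun C => ?_⟩, ?_⟩
  · exact reachableUnique hς _ ((hϖ _ _ hS).map hς ρ) (hϖ _ _ hT)
  · exact reachableUnique hς _ ((hϖ _ _ hS).comp hς (hϖ _ _ hT) a b hk) (hϖ _ _ hST)
  · exact reachableUnique hς _ ((hϖ _ _ hS).contr hab) (hϖ _ _ hS')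
  · exact reachableUnique hς _ (hϖ _ _ _) ⟨C.2, rfl⟩
  · rintro ϖ' ⟨hϖ', hzero⟩
    funext S g hS
    exact (hϖ S g hS).eq_of_isInternal hϖ' hzero hS

theorem isEnvelope_point : IsEnvelope forget.{u, v} NsCyclicOperad.point point := by
  refine ⟨NsCyclicOperad.Hom.mk (fun C _ => ⟨PUnit.unit, C.2.geometric_zero⟩) (fun _ _ => rfl)
    (fun _ _ _ _ => rfl), fun P f => ?_⟩
  obtain ⟨ϖ, ⟨hϖ, hzero⟩, unique⟩ :=
    P.existsUnique_isInternal _ (NsCyclicOperad.isInternal_of_hom f)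
  refine ⟨hϖ.hom, NsCyclicOperad.Hom.ext (funext fun C => funext fun _ => hzero C), ?_⟩
  rintro F rfl
  obtain rfl := unique _ ⟨isInternal_of_hom F, fun _ => rfl⟩
  rfl

end NsModularOperad

theorem mainTheorem1 :
    -- the symmetric case
    (Nonempty (Limits.IsTerminal CyclicOperad.point.{u, v}) ∧
      Nonempty (Limits.IsTerminal ModularOperad.point.{u, v}) ∧
      IsEnvelope ModularOperad.forget.{u, v} CyclicOperad.point ModularOperad.point ∧
      (∀ Mod : CyclicOperad.{u, v} ⥤ ModularOperad.{u, v}, (Mod ⊣ ModularOperad.forget) →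
        Nonempty (Mod.obj CyclicOperad.point ≅ ModularOperad.point)) ∧
      (∀ (P : ModularOperad.{u, v}) (ς : ∀ (S : Type u) [Finite S], P.obj S 0),
        (ModularOperad.forget.obj P).IsInternal ς →
          ∃! ϖ : ∀ (S : Type u) [Finite S] (g : ℕ), P.obj S g,
            P.IsInternal ϖ ∧ ∀ (S : Type u) [Finite S], ϖ S 0 = ς S)) ∧
    -- the non-symmetric case
    (Nonempty (Limits.IsTerminal NsCyclicOperad.point.{u, v}) ∧
      Nonempty (Limits.IsTerminal NsModularOperad.point.{u, v}) ∧
      IsEnvelope NsModularOperad.forget.{u, v} NsCyclicOperad.point NsModularOperad.point ∧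
      (∀ Mod : NsCyclicOperad.{u, v} ⥤ NsModularOperad.{u, v}, (Mod ⊣ NsModularOperad.forget) →
        Nonempty (Mod.obj NsCyclicOperad.point ≅ NsModularOperad.point)) ∧
      (∀ (P : NsModularOperad.{u, v}) (ς : ∀ C : CycSet.{u}, P.obj C.1 0),
        (NsModularOperad.forget.obj P).IsInternal ς →
          ∃! ϖ : ∀ (S : MultCyc.{u}) (g : ℕ), S.Geometric g → P.obj S g,
            P.IsInternal ϖ ∧ ∀ C : CycSet.{u}, ϖ C.1 0 C.2.geometric_zero = ς C)) := by
  exact ⟨⟨CyclicOperad.nonempty_isTerminal_point, ModularOperad.nonempty_isTerminal_point,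
    ModularOperad.isEnvelope_point, ModularOperad.isEnvelope_point.nonempty_iso,
    ModularOperad.existsUnique_isInternal⟩,
    NsCyclicOperad.nonempty_isTerminal_point, NsModularOperad.nonempty_isTerminal_point,
    NsModularOperad.isEnvelope_point, NsModularOperad.isEnvelope_point.nonempty_iso,
    NsModularOperad.existsUnique_isInternal⟩
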